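/- For a finite ranked poset $P$ with rank function $\mathrm{rk}$ (so $\mathrm{rk}=0$ on minimal elements and $\mathrm{rk}(y)=\mathrm{rk}(x)+1$ if $y$ covers $x$), let $\mathrm{rk}(P)$ be the maximal rank, $P_i=\{p\in P:\mathrm{rk}(p)=i\}$, and $\mathcal A(P)$ the set of antichains of $P$. For $p\in P$ the toggle $\tau_p:\mathcal A(P)\to\mathcal A(P)$ sends $A$ to $A\setminus\{p\}$ if $p\in A$, to $A\cup\{p\}$ if $p\notin A$ and $A\cup\{p\}$ is an antichain, and to $A$ otherwise. Put $\boldsymbol\tau_i=\prod_{p\in P_i}\tau_p$ (these toggles commute), and define rowvacuation, writing $m=\mathrm{rk}(P)$, by $$\mathrm{Rvac}_P=(\boldsymbol\tau_{m})(\boldsymbol\tau_{m}\boldsymbol\tau_{m-1})\cdots(\boldsymbol\tau_{m}\cdots\boldsymbol\tau_1)(\boldsymbol\tau_{m}\cdots\boldsymbol\tau_1\boldsymbol\tau_0).$$ Let $\Phi$ be a reduced crystallographic root system in an $r$-dimensional real vector space $V$ with a chosen set $\Delta$ of simple roots. Order the set $\Phi^+$ of positive roots by $\alpha\le\beta$ iff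 $\beta-\alpha$ is a nonnegative integer combination of simple roots. For $J\subseteq\Delta$ let $\Phi_J$ be the parabolic subsystem with simple roots $J$, and write $\mathrm{Rvac}_J=\mathrm{Rvac}_{\Phi_J^+}$ and $\mathrm{Rvac}=\mathrm{Rvac}_\Delta$. Then: - For every $J\subseteq\Delta$ the poset $\Phi_J^+$ is ranked, and $\mathrm{Rvac}_J$ is an involution on $\mathcal A(\Phi_J^+)$. - If $J=J'\sqcup J''\subseteq\Delta$ with $J'$ orthogonal to $J''$, then $\mathrm{Rvac}_J(A)=\mathrm{Rvac}_{J'}(A\cap\Phi_{J'}^+)\cup\mathrm{Rvac}_{J''}(A\cap\Phi_{J''}^+)$ for all $A\in\mathcal A(\Phi_J^+)$. Suppose moreover that $\Phi$ is of classical type $A_n$ $(n\ge1)$, $B_n$ $(n\ge2)$, $C_n$ $(n\ge2)$ or $D_n$ $(n\ge4)$, and let $h$ be its Coxeter number, i.e. $h=n+1,\,2n,\,2n,\,2n-2$ respectively. Then for all $A\in\mathcal A(\Phi^+)$: 1. $\#A+\#\mathrm{Rvac}(A)=r$; 2. the distribution of root lengths (long and short roots, with respect to the canonical Weyl-invariant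 inner product) in the multiset union of $A$ and $\mathrm{Rvac}(A)$ is the same as in $\Delta$; 3. $\mathrm{Rvac}(\Phi^+_i)=\Phi^+_{h-1-i}$ for all $0\le i\le h-1$, where $\Phi^+_i$ is the set of positive roots of rank $i$; 4. if $\alpha\in A$ for a simple root $\alpha$, then $A\setminus\{\alpha\}\subseteq\Phi_{\Delta\setminus\{\alpha\}}^+$ and $\mathrm{Rvac}(A)=\mathrm{Rvac}_{\Delta\setminus\{\alpha\}}(A\setminus\{\alpha\})$; 5. if $A\subseteq\Phi_{\Delta\setminus\{\alpha\}}^+$ for a simple root $\alpha$, then $\mathrm{Rvac}(A)=\{\alpha\}\cup\mathrm{Rvac}_{\Delta\setminus\{\alpha\}}(A)$. -/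

import Mathlib

open scoped Classical

noncomputable section

namespace Rowvacuation

/-! ### Ranks, antichain toggles and rowvacuation of a finite poset -/

section Poset

variable {Q : Type*} [PartialOrder Q]

/-- The rank of `p`: the largest length of a chain with top element `p`. In a ranked poset this is
the unique rank function. -/
def rank (p : Q) : ℕ := (Order.height p).toNat

theorem rank_strictMono [Fintype Q] : StrictMono (rank : Q → ℕ) := by
  have hfin : ∀ x : Q, Order.height x < ⊤ := fun x => by
    have hle : Order.height x ≤ (Fintype.card Q : ℕ∞) := by
      refine Order.height_le fun p _ => ?_
      have h1 : p.length + 1 ≤ Fintype.card Q := by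
        simpa using Fintype.card_le_of_injective p p.strictMono.injective
      exact_mod_cast (Nat.le_succ _).trans h1
    exact lt_of_le_of_lt hle (ENat.natCast_lt_top _)
  intro x y hxy
  have h := Order.height_strictMono hxy (hfin x)
  rw [← ENat.natCast_toNat (hfin x).ne, ← ENat.natCast_toNat (hfin y).ne] at h
  exact_mod_cast h

/-- A poset is ranked if every covering relation raises the rank by exactly one (minimal elements
have rank zero in any case). -/
def IsRanked (Q : Type*) [PartialOrder Q] : Prop :=
  ∀ x y : Q, x ⋖ y → rank y = rank x + 1

/-- The rank of the whole poset: the maximal value of the rank function. -/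
def posetRank (Q : Type*) [PartialOrder Q] [Fintype Q] : ℕ :=
  Finset.univ.sup (rank : Q → ℕ)

/-- The antichains of a poset. -/
abbrev Antichains (Q : Type*) [PartialOrder Q] : Type _ :=
  {A : Finset Q // IsAntichain (· ≤ ·) (A : Set Q)}

/-- The set `Q_i` of all elements of rank `i`, as an antichain. -/
def rankLevel (Q : Type*) [PartialOrder Q] [Fintype Q] (i : ℕ) : Antichains Q :=
  ⟨Finset.univ.filter fun p => rank p = i, by
    intro x hx y hy hne hle
    simp only [Finset.coe_filter, Finset.mem_univ, true_and, Set.mem_ofPred_eq] at hx hy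
    exact absurd (rank_strictMono (lt_of_le_of_ne hle hne)) (by omega)⟩

/-- The antichain toggle at `p`. -/
def toggle (p : Q) : Function.End (Antichains Q) := fun A =>
  if p ∈ A.1 then ⟨A.1.erase p, A.2.subset (by simp)⟩
  else if h : IsAntichain (· ≤ ·) ((insert p A.1 : Finset Q) : Set Q) then ⟨insert p A.1, h⟩
  else A

theorem antichain_insert_iff {A : Finset Q} {p : Q} :
    IsAntichain (· ≤ ·) ((insert p A : Finset Q) : Set Q) ↔
      IsAntichain (· ≤ ·) (A : Set Q) ∧ ∀ x ∈ A, p ≠ x → ¬ p ≤ x ∧ ¬ x ≤ p := by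
  rw [Finset.coe_insert, isAntichain_insert]
  rfl

theorem mem_toggle {A : Antichains Q} {p x : Q} :
    x ∈ (toggle p A).1 ↔
      (x ∈ A.1 ∧ x ≠ p) ∨ (x = p ∧ p ∉ A.1 ∧ ∀ y ∈ A.1, ¬ p ≤ y ∧ ¬ y ≤ p) := by
  have hA := A.2
  by_cases h1 : p ∈ A.1
  · have : (toggle p A).1 = A.1.erase p := by simp [toggle, h1]
    rw [this, Finset.mem_erase]; tauto
  · by_cases h2 : IsAntichain (· ≤ ·) ((insert p A.1 : Finset Q) : Set Q)
    · have : (toggle p A).1 = insert p A.1 := by simp only [toggle, if_neg h1, dif_pos h2]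
      rw [this, Finset.mem_insert]
      rw [antichain_insert_iff] at h2
      grind
    · have : (toggle p A).1 = A.1 := by simp only [toggle, if_neg h1, dif_neg h2]
      rw [this]
      rw [antichain_insert_iff] at h2
      grind

theorem toggle_commute {p q : Q} (h₁ : ¬ p ≤ q) (h₂ : ¬ q ≤ p) :
    Commute (toggle p) (toggle q) := by
  funext A
  apply Subtype.ext
  ext x
  change x ∈ (toggle p (toggle q A)).1 ↔ x ∈ (toggle q (toggle p A)).1
  simp only [mem_toggle]
  have hne : p ≠ q := fun h => h₁ h.le
  grind

/-- The rank toggle: the product of the (commuting) toggles at the elements of rank `i`. -/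
def rankToggle (Q : Type*) [PartialOrder Q] [Fintype Q] (i : ℕ) : Function.End (Antichains Q) :=
  (Finset.univ.filter fun p : Q => rank p = i).noncommProd toggle (by
    intro p hp q hq hne
    simp only [Finset.coe_filter, Finset.mem_univ, true_and, Set.mem_ofPred_eq] at hp hq
    exact toggle_commute
      (fun h => absurd (rank_strictMono (lt_of_le_of_ne h hne)) (by omega))
      (fun h => absurd (rank_strictMono (lt_of_le_of_ne h hne.symm)) (by omega)))

/-- `τ_r τ_{r-1} ⋯ τ_k` with `r` the rank of the poset (the rightmost factor acts first). -/
def rankToggleRun (Q : Type*) [PartialOrder Q] [Fintype Q] (k : ℕ) :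
    Function.End (Antichains Q) :=
  ((List.range' k (posetRank Q + 1 - k)).reverse.map (rankToggle Q)).prod

/-- Rowvacuation `(τ_r) (τ_r τ_{r-1}) ⋯ (τ_r ⋯ τ_1) (τ_r ⋯ τ_1 τ_0)`, with `r` the rank of the
poset (the rightmost factor acts first). -/
def rvac [Fintype Q] : Antichains Q → Antichains Q :=
  ((List.range (posetRank Q + 1)).reverse.map (rankToggleRun Q)).prod

end Poset

/-! ### Root posets of root systems and of their standard parabolic subsystems -/

section Root

variable {ι M N : Type*} [AddCommGroup M] [Module ℝ M] [AddCommGroup N] [Module ℝ N]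
  {P : RootPairing ι ℝ M N}

/-- The nonnegative integer combinations of a set `J` of simple roots. -/
def simpleCone (b : P.Base) (J : Finset b.support) : AddSubmonoid M :=
  AddSubmonoid.closure ((fun i : b.support => P.root i) '' (J : Set b.support))

/-- The positive roots of the parabolic subsystem with simple roots `J`. The positive roots of the
whole root system are obtained for `J = Finset.univ`. -/
def PosRoot (b : P.Base) (J : Finset b.support) : Type _ :=
  {i : ι // P.root i ∈ simpleCone b J}

instance [Fintype ι] (b : P.Base) (J : Finset b.support) : Fintype (PosRoot b J) :=
  inferInstanceAs (Fintype {i : ι // P.root i ∈ simpleCone b J})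

theorem simpleCone_eq_zero (b : P.Base) (J : Finset b.support) {x : M}
    (h₁ : x ∈ simpleCone b J) (h₂ : -x ∈ simpleCone b J) : x = 0 := by
  have hli : LinearIndependent ℝ (fun i : b.support => P.root i) := b.linearIndepOn_root
  obtain ⟨f, hf⟩ : ∃ f : M →ₗ[ℝ] ℝ, ∀ i : b.support, f (P.root i) = 1 := by
    let B := Module.Basis.extend hli.linearIndepOn_id
    refine ⟨B.constr ℝ fun _ => (1 : ℝ), fun i => ?_⟩
    have hi : P.root i ∈ hli.linearIndepOn_id.extend (Set.subset_univ _) :=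
      hli.linearIndepOn_id.subset_extend _ ⟨i, rfl⟩
    have : B ⟨P.root i, hi⟩ = P.root i := Module.Basis.extend_apply_self _ _
    rw [← this, Module.Basis.constr_basis]
  have key : ∀ y ∈ simpleCone b J, y = 0 ∨ 0 < f y := by
    intro y hy
    induction hy using AddSubmonoid.closure_induction with
    | mem y hy =>
      obtain ⟨i, -, rfl⟩ := hy
      right; simp [hf]
    | zero => left; rfl
    | add y z _ _ hy hz =>
      rcases hy with rfl | hy
      · simpa using hz
      · rcases hz with rfl | hz
        · right; simpa using hy
        · right; rw [map_add]; positivity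
  rcases key x h₁ with h | h
  · exact h
  · rcases key (-x) h₂ with h' | h'
    · simpa using h'
    · rw [map_neg] at h'; linarith

/-- The order of the root poset: `α ≤ β` if `β - α` is a nonnegative sum of simple roots. -/
instance (b : P.Base) (J : Finset b.support) : PartialOrder (PosRoot b J) where
  le α β := P.root β.1 - P.root α.1 ∈ simpleCone b J
  le_refl α := by simp
  le_trans α β γ h₁ h₂ := by
    have := add_mem h₁ h₂
    rwa [sub_add_sub_comm, add_comm (P.root β.1), add_sub_add_right_eq_sub] at this
  le_antisymm α β h₁ h₂ := by
    have := simpleCone_eq_zero b J h₁ (by rwa [neg_sub])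
    exact Subtype.ext (P.root.injective (sub_eq_zero.1 this).symm)

/-- The nonnesting partitions: antichains of the root poset. -/
abbrev NN (b : P.Base) (J : Finset b.support) : Type _ := Antichains (PosRoot b J)

/-- The underlying set of roots of a nonnesting partition, as a set of indices of roots of the whole
root system. This allows to compare nonnesting partitions of different parabolic subsystems. -/
def NN.roots {b : P.Base} {J : Finset b.support} (A : NN b J) : Finset ι :=
  A.1.map (Function.Embedding.subtype _)

end Root

/-! ### Classical types -/

/-- The labels `A n`, `B n`, `C n`, `D n` of the classical types, `n` being the rank. -/
inductive ClassicalType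
  | A (n : ℕ)
  | B (n : ℕ)
  | C (n : ℕ)
  | D (n : ℕ)

namespace ClassicalType

/-- The usual restrictions on the rank. -/
def Admissible : ClassicalType → Prop
  | A n => 1 ≤ n
  | B n => 2 ≤ n
  | C n => 2 ≤ n
  | D n => 4 ≤ n

/-- The rank. -/
def size : ClassicalType → ℕ
  | A n => n
  | B n => n
  | C n => n
  | D n => n

/-- The Cartan matrix. -/
def cartanMatrix : (X : ClassicalType) → Matrix (Fin X.size) (Fin X.size) ℤ
  | A n => CartanMatrix.A n
  | B n => CartanMatrix.B n
  | C n => CartanMatrix.C n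
  | D n => CartanMatrix.D n

/-- The Coxeter number, i.e. the largest degree of the Weyl group. -/
def coxeterNumber : ClassicalType → ℕ
  | A n => n + 1
  | B n => 2 * n
  | C n => 2 * n
  | D n => 2 * n - 2

end ClassicalType

/-- The root system with base `b` has type `X`: after a suitable numbering of the simple roots its
Cartan matrix is the Cartan matrix of type `X`. -/
def HasType {ι M N : Type*} [AddCommGroup M] [Module ℝ M] [AddCommGroup N] [Module ℝ N]
    {P : RootPairing ι ℝ M N} [P.IsCrystallographic] (b : P.Base) (X : ClassicalType) : Prop :=
  ∃ e : b.support ≃ Fin X.size, ∀ i j, b.cartanMatrix i j = X.cartanMatrix (e i) (e j)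

end Rowvacuation

end

open scoped Classical

noncomputable section

set_option linter.unusedSectionVars false

namespace Rowvacuation

/-! ### Toggles and runs in terms of order ideals -/

section Poset

variable {Q : Type*} [PartialOrder Q]

/-! Poset half. The run starting at rank 0 is rowmotion `row`: it sends an antichain `A` to the
minimal elements outside the order ideal of `A`. The run starting at rank `k` freezes the ranks
below `k` and acts above like rowmotion, so after `k` runs the ideal in ranks at least `k` is that
of `row^[k] A` (`partialRvac_invariant`). Hence `x` belongs to `rvac A` iff it lies outside the
ideal of `row^[rank x] A` but, unless its rank is 0, inside that of `row^[rank x - 1] A`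
(`mem_rvac`). It follows that the ideal of `rvac (row A)` is obtained by reading the ideal of
`row^[i] A` at each rank `i` (`below_rvac_row`). This gives `row_rvac_row`, which says that `rvac`
conjugates rowmotion to its inverse, and then `rvac_involutive`.

Compatibility with orthogonal unions is locality of the runs. Statement 5 holds for every root
system: a minimal element with nothing of `A` above it is inserted by the first run and then
excludes everything above it (`mem_rvac_iff_of_minimal`). Statement 4 is statement 5 read backwards
through the involution. Statement 3 holds because rowmotion permutes the rank levels together with
the empty antichain cyclically once there is a greatest element.

Cardinalities and lengths use a model. `Cell c two` consists of the intervals of `1, …, 2c-1` modulo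
the reflection `l ↦ 2c - l`. With `two = false` it is the root poset of both `B_c` and `C_c`;
doubling the intervals that end at the centre `c` gives `D_{c+1}`. The poset of `A_n` is what
remains of `Cell (n+1) false` after removing everything above one minimal element, so it follows
from the same minimal element argument.

The set `Line A` collects the left ends of the unfolded antichain, with a correction at `c`.
Rowmotion shifts it to the left by one, and the right ends below `c` of `rvac A` are exactly the
positions below `c` not in `Line A` (`exists_mem_rvac_of_not_line`, `not_line_of_mem_rvac`).
Counting gives `lo_add_lo_rvac`; applied to `A` and to `rvac A`, together with an analysis of the
intervals ending at `c`, it leaves only parity arithmetic (`card_single`, `card_double`). The simple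
root of exceptional length corresponds to intervals ending at `c` in type `B` and to symmetric
intervals in type `C`; each kind occurs exactly once in `A` and `rvac A` together.

The model is matched with an abstract root system through its Cartan matrix alone: a `LetterSystem`
reconstructs the vectors usually called `±e_i`, on which the simple reflections act by signed
permutations. -/

/-- `x` lies in the order ideal generated by the antichain `A`. -/
def Below (A : Antichains Q) (x : Q) : Prop := ∃ a ∈ A.1, x ≤ a

theorem Below.mono {A : Antichains Q} {x y : Q} (h : Below A x) (hyx : y ≤ x) : Below A y := by
  obtain ⟨a, ha, hxa⟩ := h
  exact ⟨a, ha, hyx.trans hxa⟩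

theorem below_of_mem {A : Antichains Q} {x : Q} (h : x ∈ A.1) : Below A x := ⟨x, h, le_rfl⟩

theorem eq_of_mem_of_le {A : Antichains Q} {x y : Q} (hx : x ∈ A.1) (hy : y ∈ A.1) (h : x ≤ y) :
    x = y := by
  by_contra hne
  exact A.2 hx hy hne h

theorem not_below_of_mem_of_lt {A : Antichains Q} {x y : Q} (hx : x ∈ A.1) (h : x < y) :
    ¬ Below A y := by
  rintro ⟨a, ha, hya⟩
  have := eq_of_mem_of_le hx ha (h.le.trans hya)
  exact absurd (h.trans_le hya) (by rw [this]; exact lt_irrefl _)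

theorem mem_iff_below {A : Antichains Q} {x : Q} :
    x ∈ A.1 ↔ Below A x ∧ ∀ y, x < y → ¬ Below A y := by
  refine ⟨fun h => ⟨below_of_mem h, fun y hy => not_below_of_mem_of_lt h hy⟩, ?_⟩
  rintro ⟨⟨a, ha, hxa⟩, h⟩
  rcases hxa.eq_or_lt with rfl | hlt
  · exact ha
  · exact absurd (below_of_mem ha) (h a hlt)

theorem antichain_ext {A B : Antichains Q} (h : ∀ x, x ∈ A.1 ↔ x ∈ B.1) : A = B :=
  Subtype.ext (Finset.ext h)

theorem antichain_ext_below {A B : Antichains Q} (h : ∀ x, Below A x ↔ Below B x) : A = B :=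
  antichain_ext fun x => by simp only [mem_iff_below, h]

/-- Toggles at pairwise incomparable elements do not influence each other, so the product acts on
all of them simultaneously. -/
theorem mem_noncommProd_toggle {A : Antichains Q} (S : Finset Q)
    (hS : IsAntichain (· ≤ ·) (S : Set Q))
    (comm : (S : Set Q).Pairwise (Function.onFun Commute toggle)) (x : Q) :
    x ∈ (S.noncommProd toggle comm A).1 ↔
      (x ∈ A.1 ∧ x ∉ S) ∨ (x ∈ S ∧ x ∉ A.1 ∧ ∀ y ∈ A.1, ¬ x ≤ y ∧ ¬ y ≤ x) := by
  induction S using Finset.induction_on generalizing x with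
  | empty =>
    rw [Finset.noncommProd_empty]
    change x ∈ A.1 ↔ _
    simp
  | insert p S hp ih =>
    rw [Finset.noncommProd_insert_of_notMem _ _ _ _ hp]
    have ih' := ih (hS.subset (by simp)) (comm.mono (by simp))
    change x ∈ (toggle p (S.noncommProd toggle _ A)).1 ↔ _
    rw [mem_toggle]
    simp only [ih', Finset.mem_insert]
    have hinc : ∀ y ∈ S, ¬ p ≤ y ∧ ¬ y ≤ p := by
      intro y hy
      have hne : p ≠ y := by rintro rfl; exact hp hy
      exact ⟨hS (by simp) (by simp [hy]) hne, hS (by simp [hy]) (by simp) hne.symm⟩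
    grind

variable [Fintype Q]

/-- The second alternative includes `y = x`, so it already forces `x ∉ A`. -/
theorem mem_rankToggle {A : Antichains Q} {i : ℕ} {x : Q} :
    x ∈ (rankToggle Q i A).1 ↔
      (x ∈ A.1 ∧ rank x ≠ i) ∨ (rank x = i ∧ ∀ y ∈ A.1, ¬ x ≤ y ∧ ¬ y ≤ x) := by
  refine (mem_noncommProd_toggle _ (rankLevel Q i).2 _ x).trans ?_
  have hl : x ∈ (rankLevel Q i).1 ↔ rank x = i := by simp [rankLevel]
  rw [hl]
  constructor
  · rintro (h | h)
    · exact Or.inl h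
    · exact Or.inr ⟨h.1, h.2.2⟩
  · rintro (h | h)
    · exact Or.inl h
    · exact Or.inr ⟨h.1, fun hx => (h.2 x hx).1 le_rfl, h.2⟩

theorem rank_le_posetRank (x : Q) : rank x ≤ posetRank Q :=
  Finset.le_sup (f := (rank : Q → ℕ)) (Finset.mem_univ x)

/-- The membership condition of the run `τ_{k+n-1} ⋯ τ_k`. -/
theorem mem_prod_rankToggle (A : Antichains Q) (k n : ℕ) (x : Q) :
    x ∈ (((List.range' k n).reverse.map (rankToggle Q)).prod A).1 ↔
      ((rank x < k ∨ k + n ≤ rank x) ∧ x ∈ A.1) ∨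
      (k ≤ rank x ∧ rank x < k + n ∧ ¬ Below A x ∧ (∀ f ∈ A.1, rank f < k → ¬ f ≤ x) ∧
        ∀ y < x, k ≤ rank y → Below A y) := by
  induction n generalizing x with
  | zero =>
    simp only [List.range'_zero, List.reverse_nil, List.map_nil, List.prod_nil, Nat.add_zero]
    change x ∈ A.1 ↔ _
    have := Nat.lt_or_ge (rank x) k
    constructor
    · intro h; exact Or.inl ⟨this, h⟩
    · rintro (h | h)
      · exact h.2
      · omega
  | succ n ih =>
    rw [List.range'_concat, List.reverse_append, List.map_append, List.prod_append]
    simp only [List.reverse_singleton, List.map_singleton, List.prod_singleton, one_mul]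
    change x ∈ (rankToggle Q (k + n) (((List.range' k n).reverse.map (rankToggle Q)).prod A)).1 ↔ _
    rw [mem_rankToggle]
    by_cases hx : rank x = k + n
    · simp only [hx, ne_eq, not_true_eq_false, and_false, true_and, false_or]
      have h0 : ¬ ((k + n < k ∨ k + (n + 1) ≤ k + n) ∧ x ∈ A.1) := by omega
      rw [or_iff_right h0]
      have h1 : k ≤ k + n ∧ k + n < k + (n + 1) := by omega
      constructor
      · intro h
        have hb : ¬ Below A x := by
          rintro ⟨a, ha, hxa⟩
          have hr : rank x ≤ rank a := rank_strictMono.monotone hxa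
          exact (h a ((ih a).2 (Or.inl ⟨by omega, ha⟩))).1 hxa
        have hf : ∀ f ∈ A.1, rank f < k → ¬ f ≤ x := fun f hf hr =>
          (h f ((ih f).2 (Or.inl ⟨Or.inl hr, hf⟩))).2
        refine ⟨h1.1, h1.2, hb, hf, ?_⟩
        -- A minimal `y < x` of rank at least `k` outside the ideal of `A` would have been inserted
        -- by an earlier toggle of this run, and would then block `x`.
        by_contra hcon
        push Not at hcon
        obtain ⟨y, ⟨hyx, hyk, hyb⟩, hmin⟩ := WellFounded.has_min
          (r := ((· < ·) : Q → Q → Prop)) wellFounded_lt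
          {y | y < x ∧ k ≤ rank y ∧ ¬ Below A y} hcon
        have hry := rank_strictMono hyx
        refine (h y ((ih y).2 (Or.inr ⟨hyk, by omega, hyb,
          fun f hf' hr hle => hf f hf' hr (hle.trans hyx.le), fun z hz hzk => ?_⟩))).2 hyx.le
        by_contra hzb
        exact hmin z ⟨hz.trans hyx, hzk, hzb⟩ hz
      · rintro ⟨-, -, hb, hf, hl⟩ y hy
        rcases (ih y).1 hy with ⟨hr, hyA⟩ | ⟨hk, -, hyb, -, -⟩
        · refine ⟨fun hle => hb ⟨y, hyA, hle⟩, fun hle => ?_⟩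
          rcases hr with hr | hr
          · exact hf y hyA hr hle
          · have := rank_strictMono.monotone hle
            rcases hle.eq_or_lt with rfl | hlt
            · exact hb (below_of_mem hyA)
            · have := rank_strictMono hlt; omega
        · constructor
          · intro hle
            have := rank_strictMono.monotone hle
            rcases hle.eq_or_lt with rfl | hlt
            · have hy2 := (ih x).1 hy
              rcases hy2 with h | h
              · exact hb (below_of_mem h.2)
              · omega
            · have := rank_strictMono hlt
              have hy2 := (ih y).1 hy
              rcases hy2 with h | h
              · exact hb ⟨y, h.2, hle⟩
              · omega
          · intro hle
            rcases hle.eq_or_lt with rfl | hlt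
            · have hy2 := (ih y).1 hy
              rcases hy2 with h | h
              · exact hb (below_of_mem h.2)
              · omega
            · exact hyb (hl y hlt hk)
    · simp only [hx, ne_eq, not_false_eq_true, and_true, false_and, or_false, ih]
      constructor
      · rintro (h | h)
        · exact Or.inl ⟨by omega, h.2⟩
        · exact Or.inr ⟨h.1, by omega, h.2.2⟩
      · rintro (h | h)
        · exact Or.inl ⟨by omega, h.2⟩
        · exact Or.inr ⟨h.1, by omega, h.2.2⟩

theorem mem_rankToggleRun {A : Antichains Q} {k : ℕ} {x : Q} :
    x ∈ (rankToggleRun Q k A).1 ↔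
      (rank x < k ∧ x ∈ A.1) ∨
      (k ≤ rank x ∧ ¬ Below A x ∧ (∀ f ∈ A.1, rank f < k → ¬ f ≤ x) ∧
        ∀ y < x, k ≤ rank y → Below A y) := by
  rw [rankToggleRun, mem_prod_rankToggle]
  have := rank_le_posetRank x
  constructor
  · rintro (h | h)
    · exact Or.inl ⟨by omega, h.2⟩
    · exact Or.inr ⟨h.1, h.2.2⟩
  · rintro (h | h)
    · exact Or.inl ⟨by omega, h.2⟩
    · exact Or.inr ⟨h.1, by omega, h.2⟩

/-! ### Rowmotion, and rowvacuation as rowmotion read rank by rank -/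

/-- Rowmotion of antichains. -/
def row (A : Antichains Q) : Antichains Q := rankToggleRun Q 0 A

theorem mem_row {A : Antichains Q} {x : Q} :
    x ∈ (row A).1 ↔ ¬ Below A x ∧ ∀ y < x, Below A y := by
  simp [row, mem_rankToggleRun]

/-- The product of the first `k` runs of rowvacuation. -/
def partialRvac : ℕ → Antichains Q → Antichains Q
  | 0, A => A
  | k + 1, A => rankToggleRun Q k (partialRvac k A)

theorem partialRvac_eq_prod (k : ℕ) (A : Antichains Q) :
    ((List.range k).reverse.map (rankToggleRun Q)).prod A = partialRvac k A := by
  induction k with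
  | zero => rfl
  | succ k ih =>
    rw [List.range_succ, List.reverse_append, List.map_append, List.prod_append]
    simp only [List.reverse_singleton, List.map_singleton, List.prod_singleton]
    change rankToggleRun Q k (((List.range k).reverse.map (rankToggleRun Q)).prod A) = _
    rw [ih]; rfl

theorem rvac_eq_partialRvac (A : Antichains Q) : rvac A = partialRvac (posetRank Q + 1) A :=
  partialRvac_eq_prod _ A

theorem mem_partialRvac_succ_of_lt {A : Antichains Q} {k : ℕ} {x : Q} (h : rank x < k) :
    x ∈ (partialRvac (k + 1) A).1 ↔ x ∈ (partialRvac k A).1 := by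
  rw [partialRvac, mem_rankToggleRun]
  constructor
  · rintro (h' | h')
    · exact h'.2
    · omega
  · exact fun h' => Or.inl ⟨h, h'⟩

theorem mem_partialRvac_of_lt {A : Antichains Q} {k n : ℕ} {x : Q} (h : rank x < k) (hn : k ≤ n) :
    x ∈ (partialRvac n A).1 ↔ x ∈ (partialRvac k A).1 := by
  induction n, hn using Nat.le_induction with
  | base => rfl
  | succ n hn ih => rw [mem_partialRvac_succ_of_lt (by omega), ih]

theorem mem_rvac_iff_partialRvac {A : Antichains Q} {k : ℕ} {x : Q} (h : rank x < k) :
    x ∈ (rvac A).1 ↔ x ∈ (partialRvac k A).1 := by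
  have := rank_le_posetRank x
  rw [rvac_eq_partialRvac, mem_partialRvac_of_lt (k := rank x + 1) (by omega) (by omega),
    mem_partialRvac_of_lt (k := rank x + 1) (n := k) (by omega) (by omega)]

theorem below_of_below_row_of_lt {A : Antichains Q} {x y : Q} (h : Below (row A) x) (hyx : y < x) :
    Below A y := by
  obtain ⟨g, hg, hxg⟩ := h
  exact (mem_row.1 hg).2 y (hyx.trans_le hxg)

theorem exists_rank_eq_between (hQ : IsRanked Q) {x y : Q} (hxy : x ≤ y) {k : ℕ}
    (hk : rank x ≤ k) (hk' : k ≤ rank y) : ∃ z, x ≤ z ∧ z ≤ y ∧ rank z = k := by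
  obtain ⟨n, hn⟩ : ∃ n, k = rank x + n := ⟨k - rank x, by omega⟩
  induction n generalizing k with
  | zero => exact ⟨x, le_rfl, hxy, by omega⟩
  | succ n ih =>
    obtain ⟨z, hxz, hzy, hz⟩ := ih (k := rank x + n) (by omega) (by omega) rfl
    have hlt : z < y := lt_of_le_of_ne hzy (by rintro rfl; omega)
    obtain ⟨w, hzw, hwy⟩ := exists_covBy_le_of_lt hlt
    exact ⟨w, hxz.trans hzw.le, hwy, by rw [hQ z w hzw]; omega⟩

theorem not_below_row_of_lt {A : Antichains Q} {y z : Q} (hz : ¬ Below A z) (hzy : z < y) :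
    ¬ Below (row A) y := fun h => hz (below_of_below_row_of_lt h hzy)

theorem iterate_row_succ (k : ℕ) (A : Antichains Q) : row^[k + 1] A = row (row^[k] A) :=
  Function.iterate_succ_apply' _ _ _

/-- The ranks not yet frozen evolve by rowmotion. The second half describes the frozen elements only
through what they block, which is all the next run needs; it makes the induction close. For `k = 0`
both of its sides are false. -/
theorem partialRvac_invariant (hQ : IsRanked Q) (A : Antichains Q) (k : ℕ) :
    (∀ x, k ≤ rank x → (Below (partialRvac k A) x ↔ Below (row^[k] A) x)) ∧
    ∀ x, k ≤ rank x → ((∃ f ∈ (partialRvac k A).1, rank f < k ∧ f ≤ x) ↔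
      ∃ y ≤ x, rank y + 1 = k ∧ ¬ Below (row^[k - 1] A) y) := by
  induction k with
  | zero => exact ⟨fun x _ => Iff.rfl, fun x _ => by simp⟩
  | succ k ih =>
    obtain ⟨ih1, ih2⟩ := ih
    -- An element outside the ideal keeps everything strictly above it outside after one more
    -- rowmotion. So whatever the frozen part blocks is something that rowmotion would not have
    -- inserted either.
    have hblock : ∀ x, k + 1 ≤ rank x → (∃ y ≤ x, rank y + 1 = k ∧ ¬ Below (row^[k - 1] A) y) →
        ∃ y ≤ x, rank y = k ∧ ¬ Below (row^[k] A) y := by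
      rintro x hx ⟨z, hzx, hzk, hz⟩
      obtain ⟨y, hzy, hyx, hy⟩ := exists_rank_eq_between hQ hzx (k := k) (by omega) (by omega)
      refine ⟨y, hyx, hy, ?_⟩
      obtain ⟨k, rfl⟩ : ∃ k', k = k' + 1 := ⟨k - 1, by omega⟩
      rw [iterate_row_succ]
      exact not_below_row_of_lt hz (lt_of_le_of_ne hzy (by rintro rfl; omega))
    constructor
    · intro x hx
      rw [iterate_row_succ]
      constructor
      · rintro ⟨g, hg, hxg⟩
        have hrg := rank_strictMono.monotone hxg
        rcases mem_rankToggleRun.1 hg with ⟨h, -⟩ | ⟨h, hgb, hgf, hgl⟩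
        · omega
        refine ⟨g, mem_row.2 ⟨fun h => hgb ((ih1 g (by omega)).2 h), fun y hy => ?_⟩, hxg⟩
        have hry := rank_strictMono hy
        by_cases hyk : k ≤ rank y
        · exact (ih1 y hyk).1 (hgl y hy hyk)
        · obtain ⟨w, hyw, hwg, hw⟩ := exists_rank_eq_between hQ hy.le (k := k) (by omega) (by omega)
          have hwg' : w < g := lt_of_le_of_ne hwg (by rintro rfl; omega)
          exact ((ih1 w hw.ge).1 (hgl w hwg' hw.ge)).mono hyw
      · rintro ⟨g, hg, hxg⟩
        have hrg := rank_strictMono.monotone hxg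
        rw [mem_row] at hg
        refine ⟨g, mem_rankToggleRun.2 (Or.inr ⟨by omega,
          fun h => hg.1 ((ih1 g (by omega)).1 h), ?_,
          fun y hy hyk => (ih1 y hyk).2 (hg.2 y hy)⟩), hxg⟩
        intro f hf hfk hfg
        obtain ⟨y, hyg, hyk, hy⟩ := hblock g (by omega) ((ih2 g (by omega)).1 ⟨f, hf, hfk, hfg⟩)
        exact hy (hg.2 y (lt_of_le_of_ne hyg (by rintro rfl; omega)))
    · intro x hx
      simp only [Nat.add_sub_cancel, Nat.add_right_cancel_iff]
      constructor
      · rintro ⟨f, hf, hfk, hfx⟩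
        rcases mem_rankToggleRun.1 hf with ⟨h, hfA⟩ | ⟨h, hfb, hff, -⟩
        · exact hblock x hx ((ih2 x (by omega)).1 ⟨f, hfA, h, hfx⟩)
        · exact ⟨f, hfx, by omega, fun h' => hfb ((ih1 f h).2 h')⟩
      · rintro ⟨y, hyx, hyk, hy⟩
        by_cases hb : ∃ f ∈ (partialRvac k A).1, rank f < k ∧ f ≤ y
        · obtain ⟨f, hf, hfk, hfy⟩ := hb
          exact ⟨f, mem_rankToggleRun.2 (Or.inl ⟨hfk, hf⟩), by omega, hfy.trans hyx⟩
        · push Not at hb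
          refine ⟨y, mem_rankToggleRun.2 (Or.inr ⟨by omega, fun h => hy ((ih1 y hyk.ge).1 h),
            fun f hf hfk => hb f hf hfk, fun z hz hzk => ?_⟩), by omega, hyx⟩
          have := rank_strictMono hz
          omega

theorem mem_rvac_iff_forall (hQ : IsRanked Q) {A : Antichains Q} {x : Q} :
    x ∈ (rvac A).1 ↔ ¬ Below (row^[rank x] A) x ∧
      ∀ y < x, rank y + 1 = rank x → Below (row^[rank x - 1] A) y := by
  rw [mem_rvac_iff_partialRvac (Nat.lt_succ_self _), Nat.succ_eq_add_one, partialRvac,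
    mem_rankToggleRun]
  obtain ⟨h1, h2⟩ := partialRvac_invariant hQ A (rank x)
  rw [h1 x le_rfl]
  have h2 := h2 x le_rfl
  constructor
  · rintro (h | ⟨-, hb, hf, -⟩)
    · omega
    · refine ⟨hb, fun y hy hr => ?_⟩
      by_contra hyb
      obtain ⟨f, hfm, hfr, hfx⟩ := h2.2 ⟨y, hy.le, hr, hyb⟩
      exact hf f hfm hfr hfx
  · rintro ⟨hb, hl⟩
    refine Or.inr ⟨le_rfl, hb, fun f hf hfr hfx => ?_, fun y hy hr => ?_⟩
    · obtain ⟨y, hyx, hyr, hyb⟩ := h2.1 ⟨f, hf, hfr, hfx⟩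
      exact hyb (hl y (lt_of_le_of_ne hyx (by rintro rfl; omega)) hyr)
    · have := rank_strictMono hy
      omega

theorem below_pred_of_forall_lt (hQ : IsRanked Q) {A : Antichains Q} {x : Q}
    (h : ∀ y < x, rank y + 1 = rank x → Below A y) : ∀ y < x, Below A y := by
  intro y hy
  have hr := rank_strictMono hy
  obtain ⟨z, hyz, hzx, hz⟩ := exists_rank_eq_between hQ hy.le (k := rank x - 1) (by omega) (by omega)
  exact (h z (lt_of_le_of_ne hzx (by rintro rfl; omega)) (by omega)).mono hyz

/-- If everything below `x` lies in the ideal at time `rank x - 1` but `x` does not, rowmotion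
inserts `x`, against its being outside at time `rank x`. So the condition on the elements below `x`
may be replaced by one on `x` itself. -/
theorem mem_rvac (hQ : IsRanked Q) {A : Antichains Q} {x : Q} :
    x ∈ (rvac A).1 ↔ ¬ Below (row^[rank x] A) x ∧
      (rank x ≠ 0 → Below (row^[rank x - 1] A) x) := by
  rw [mem_rvac_iff_forall hQ]
  refine and_congr_right fun hb => ⟨fun h hx => ?_, fun h y hy hr => (h (by omega)).mono hy.le⟩
  by_contra hxb
  refine hb ?_
  obtain ⟨k, hk⟩ : ∃ k, rank x = k + 1 := ⟨rank x - 1, by omega⟩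
  have h' := below_pred_of_forall_lt hQ h
  rw [hk, Nat.add_sub_cancel] at hxb h'
  rw [hk, iterate_row_succ]
  exact below_of_mem (mem_row.2 ⟨hxb, h'⟩)

/-- The complement of the ideal of `A` is the filter generated by its minimal elements, which form
`row A`. Hence `row A` determines `A`. -/
theorem below_iff_of_row (A : Antichains Q) (x : Q) :
    Below A x ↔ ∀ y ∈ (row A).1, ¬ y ≤ x := by
  constructor
  · intro h y hy hyx
    exact (mem_row.1 hy).1 (h.mono hyx)
  · intro h
    by_contra hx
    obtain ⟨y, ⟨hyx, hyb⟩, hmin⟩ := WellFounded.has_min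
      (r := ((· < ·) : Q → Q → Prop)) wellFounded_lt {y | y ≤ x ∧ ¬ Below A y} ⟨x, le_rfl, hx⟩
    refine h y (mem_row.2 ⟨hyb, fun z hz => ?_⟩) hyx
    by_contra hzb
    exact hmin z ⟨hz.le.trans hyx, hzb⟩ hz

theorem row_injective : Function.Injective (row : Antichains Q → Antichains Q) := by
  intro A B h
  exact antichain_ext_below fun x => by rw [below_iff_of_row, below_iff_of_row, h]

theorem row_surjective : Function.Surjective (row : Antichains Q → Antichains Q) :=
  Finite.surjective_of_injective row_injective

/-- Rowmotion shifted along the ranks gives the order ideal of rowvacuation. -/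
theorem below_rvac_row (hQ : IsRanked Q) (A : Antichains Q) (x : Q) :
    Below (rvac (row A)) x ↔ Below (row^[rank x] A) x := by
  constructor
  · rintro ⟨g, hg, hxg⟩
    rw [mem_rvac hQ] at hg
    have hgb : Below (row^[rank g] A) g := by
      by_cases h0 : rank g = 0
      · by_contra hcon
        refine hg.1 ?_
        rw [h0] at hcon ⊢
        refine below_of_mem (mem_row.2 ⟨hcon, fun y hy => ?_⟩)
        have := rank_strictMono hy
        omega
      · have := hg.2 h0
        rwa [← Function.iterate_succ_apply, Nat.succ_eq_add_one, Nat.sub_add_cancel (by omega)]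
          at this
    obtain ⟨n, hn⟩ : ∃ n, rank g = rank x + n :=
      ⟨rank g - rank x, by have := rank_strictMono.monotone hxg; omega⟩
    clear hg
    induction n generalizing g with
    | zero =>
      have : x = g := by
        by_contra hne
        have := rank_strictMono (lt_of_le_of_ne hxg hne)
        omega
      rwa [this]
    | succ n ih =>
      obtain ⟨z, hxz, hzg, hz⟩ := exists_rank_eq_between hQ hxg (k := rank x + n)
        (by omega) (by omega)
      refine ih z hxz ?_ hz
      rw [hn, ← add_assoc, iterate_row_succ] at hgb
      rw [hz]
      exact below_of_below_row_of_lt hgb (lt_of_le_of_ne hzg (by rintro rfl; omega))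
  · intro h
    obtain ⟨n, hn⟩ : ∃ n, n = posetRank Q - rank x := ⟨_, rfl⟩
    induction n using Nat.strong_induction_on generalizing x with
    | _ n ih =>
      -- Outside the ideal one step later, `x` itself belongs to `rvac (row A)`. Otherwise some
      -- cover of `x` satisfies the hypothesis at its own rank, and the distance to the top rank
      -- drops.
      by_cases hb : Below (row^[rank x] (row A)) x
      · rw [← Function.iterate_succ_apply, Nat.succ_eq_add_one, iterate_row_succ] at hb
        obtain ⟨g, hg, hxg⟩ := hb
        have hne : x ≠ g := by rintro rfl; exact (mem_row.1 hg).1 h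
        obtain ⟨z, hxz, hzg⟩ := exists_covBy_le_of_lt (lt_of_le_of_ne hxg hne)
        have hz := hQ x z hxz
        have := rank_le_posetRank z
        refine Below.mono (ih (posetRank Q - rank z) (by omega) z ?_ rfl) hxz.le
        rw [hz, iterate_row_succ]
        exact ⟨g, hg, hzg⟩
      · refine below_of_mem ((mem_rvac hQ).2 ⟨hb, fun h0 => ?_⟩)
        rwa [← Function.iterate_succ_apply, Nat.succ_eq_add_one, Nat.sub_add_cancel (by omega)]

/-- By `below_rvac_row`, minimality outside the ideal of `rvac (row A)` only involves `row^[rank x]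
A` at `x` and `row^[rank x - 1] A` one rank lower, which is the criterion `mem_rvac_iff_forall`. -/
theorem row_rvac_row (hQ : IsRanked Q) (A : Antichains Q) : row (rvac (row A)) = rvac A := by
  refine antichain_ext fun x => ?_
  rw [mem_row, mem_rvac_iff_forall hQ, below_rvac_row hQ]
  refine and_congr_right fun _ => ⟨fun h y hy hr => ?_, fun h y hy => ?_⟩
  · have := (below_rvac_row hQ A y).1 (h y hy)
    rwa [← hr, Nat.add_sub_cancel]
  · have hr := rank_strictMono hy
    obtain ⟨z, hyz, hzx, hz⟩ := exists_rank_eq_between hQ hy.le (k := rank x - 1)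
      (by omega) (by omega)
    refine Below.mono ((below_rvac_row hQ A z).2 ?_) hyz
    rw [hz]
    exact h z (lt_of_le_of_ne hzx (by rintro rfl; omega)) (by omega)

theorem iterate_row_rvac_iterate_row (hQ : IsRanked Q) (k : ℕ) (A : Antichains Q) :
    row^[k] (rvac (row^[k] A)) = rvac A := by
  induction k generalizing A with
  | zero => rfl
  | succ k ih =>
    rw [Function.iterate_succ_apply, Function.iterate_succ_apply', row_rvac_row hQ, ih]

/-- Rowmotion is bijective, so `A` can be written as an iterate applied to some `B`. Then `row^[k] ∘
rvac ∘ row^[k] = rvac` turns an iterate of `rvac A` into `rvac (row B)`, whose ideal at `x` is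
known. -/
theorem rvac_involutive (hQ : IsRanked Q) :
    Function.Involutive (rvac : Antichains Q → Antichains Q) := by
  intro A
  have hsurj : ∀ k, Function.Surjective (row^[k] : Antichains Q → Antichains Q) :=
    fun k => row_surjective.iterate k
  have key : ∀ (x : Q) (B : Antichains Q), row^[rank x + 1] B = A →
      (Below (row^[rank x] (rvac A)) x ↔ Below (row^[rank x] B) x) := by
    intro x B hB
    have h1 : row^[rank x] (rvac A) = rvac (row B) := by
      rw [← hB, Function.iterate_succ_apply, iterate_row_rvac_iterate_row hQ]
    rw [h1, below_rvac_row hQ]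
  refine antichain_ext fun x => ?_
  rw [mem_rvac hQ]
  obtain ⟨B, hB⟩ := hsurj (rank x + 1) A
  rw [key x B hB]
  rw [iterate_row_succ] at hB
  -- The same argument one step earlier: with `A = row^[k] (row D)` and `k = rank x - 1`, the ideal
  -- at `x` is that of `row^[rank x] D = A`.
  have h2 : rank x ≠ 0 → (Below (row^[rank x - 1] (rvac A)) x ↔ Below A x) := by
    intro h0
    obtain ⟨k, hk⟩ : ∃ k, rank x = k + 1 := ⟨rank x - 1, by omega⟩
    obtain ⟨C, hC⟩ := hsurj k A
    obtain ⟨D, rfl⟩ := row_surjective C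
    have h1 : row^[k] (rvac A) = rvac (row D) := by
      rw [← hC, iterate_row_rvac_iterate_row hQ]
    rw [hk, Nat.add_sub_cancel, h1, below_rvac_row hQ, hk, Function.iterate_succ_apply, hC]
  constructor
  · rintro ⟨hb, h⟩
    by_cases h0 : rank x = 0
    · rw [← hB, mem_row]
      refine ⟨hb, fun y hy => ?_⟩
      have := rank_strictMono hy
      omega
    · obtain ⟨g, hg, hxg⟩ := (h2 h0).1 (h h0)
      rcases hxg.eq_or_lt with rfl | hlt
      · exact hg
      · rw [← hB] at hg
        exact absurd ((mem_row.1 hg).2 x hlt) hb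
  · intro hx
    refine ⟨?_, fun h0 => (h2 h0).2 (below_of_mem hx)⟩
    rw [← hB] at hx
    exact (mem_row.1 hx).1

end Poset

/-! ### Recognising the rank function -/

section Rank

variable {Q : Type*} [PartialOrder Q]

/-- Strict monotonicity bounds chains from above, and descending by one at a time produces a chain
of full length. -/
theorem rank_eq_of_strictMono {f : Q → ℕ} (hf : StrictMono f)
    (h : ∀ x, f x ≠ 0 → ∃ y < x, f y + 1 = f x) (x : Q) : rank x = f x := by
  suffices Order.height x = f x by rw [rank, this]; rfl
  obtain ⟨n, hn⟩ : ∃ n, f x = n := ⟨_, rfl⟩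
  induction n using Nat.strong_induction_on generalizing x with
  | _ n ih =>
    apply le_antisymm
    · rw [Order.height_le_coe_iff]
      intro y hy
      rw [ih (f y) (hn ▸ hf hy) y rfl]
      exact_mod_cast hf hy
    · by_cases h0 : f x = 0
      · simp [h0]
      · obtain ⟨y, hy, hyx⟩ := h x h0
        have := Order.height_add_one_le hy
        rw [ih (f y) (by omega) y rfl] at this
        rw [← hyx]
        exact_mod_cast this

theorem isRanked_of_strictMono {f : Q → ℕ} (hf : StrictMono f)
    (h : ∀ x, f x ≠ 0 → ∃ y < x, f y + 1 = f x) (h' : ∀ x y, x ⋖ y → f y = f x + 1) :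
    IsRanked Q := fun x y hxy => by
  rw [rank_eq_of_strictMono hf h, rank_eq_of_strictMono hf h, h' x y hxy]

variable [Fintype Q]

theorem exists_lt_rank_add_one {x : Q} (hx : rank x ≠ 0) : ∃ y < x, rank y + 1 = rank x := by
  by_contra hcon
  push Not at hcon
  have hlt : ∀ y < x, rank y < rank x - 1 := fun y hy => by
    have h1 := rank_strictMono hy
    have h2 := hcon y hy
    omega
  have hfin : ∀ y : Q, Order.height y ≠ ⊤ := fun y hy => by
    obtain ⟨p, -, hp⟩ := Order.exists_series_of_le_height y (n := Fintype.card Q)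
      (by rw [hy]; exact le_top)
    have h1 : p.length + 1 ≤ Fintype.card Q := by
      simpa using Fintype.card_le_of_injective p p.strictMono.injective
    omega
  have hle : Order.height x ≤ ((rank x - 1 : ℕ) : ℕ∞) := by
    rw [Order.height_le_coe_iff]
    intro y hy
    rw [← ENat.natCast_toNat (hfin y)]
    exact_mod_cast hlt y hy
  rw [← ENat.natCast_toNat (hfin x)] at hle
  have : rank x ≤ rank x - 1 := by exact_mod_cast hle
  omega

end Rank

/-! ### Rowvacuation under order embeddings -/

section Transfer

variable {Q Q' : Type*} [PartialOrder Q] [PartialOrder Q']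

theorem rank_orderEmbedding [Fintype Q] (f : Q' ↪o Q) (hlow : ∀ x y, y ≤ f x → ∃ z, f z = y)
    (x : Q') : rank (f x) = rank x := by
  refine (rank_eq_of_strictMono (f := fun x => rank (f x))
    (rank_strictMono.comp f.strictMono) (fun x hx => ?_) x).symm
  obtain ⟨y, hy, hr⟩ := exists_lt_rank_add_one hx
  obtain ⟨z, rfl⟩ := hlow x y hy.le
  exact ⟨z, f.lt_iff_lt.1 hy, hr⟩

variable (f : Q' ↪o Q)

theorem below_orderEmbedding {A : Antichains Q} {A' : Antichains Q'}
    (hmem : ∀ x, f x ∈ A.1 ↔ x ∈ A'.1) (hab : ∀ a ∈ A.1, ∀ x, f x ≤ a → ∃ z, f z = a) (x : Q') :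
    Below A (f x) ↔ Below A' x := by
  constructor
  · rintro ⟨a, ha, hxa⟩
    obtain ⟨z, rfl⟩ := hab a ha x hxa
    exact ⟨z, (hmem z).1 ha, f.le_iff_le.1 hxa⟩
  · rintro ⟨a, ha, hxa⟩
    exact ⟨f a, (hmem a).2 ha, f.le_iff_le.2 hxa⟩

variable [Fintype Q] [Fintype Q']

/-- The run at `f x` only looks at elements below `f x` and at members of `A` comparable with those.
So it is enough that the range is a lower set and that members of `A` above the range lie in it. -/
theorem mem_rankToggleRun_orderEmbedding (hlow : ∀ x y, y ≤ f x → ∃ z, f z = y)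
    {A : Antichains Q} {A' : Antichains Q'}
    (hmem : ∀ x, f x ∈ A.1 ↔ x ∈ A'.1) (hab : ∀ a ∈ A.1, ∀ x, f x ≤ a → ∃ z, f z = a)
    (k : ℕ) (x : Q') : f x ∈ (rankToggleRun Q k A).1 ↔ x ∈ (rankToggleRun Q' k A').1 := by
  have hB := below_orderEmbedding f hmem hab
  rw [mem_rankToggleRun, mem_rankToggleRun, hmem, hB, rank_orderEmbedding f hlow]
  refine or_congr Iff.rfl (and_congr_right fun _ => and_congr_right fun _ => and_congr ?_ ?_)
  · constructor
    · intro h g hg hr hgx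
      exact h (f g) ((hmem g).2 hg) (by rwa [rank_orderEmbedding f hlow]) (f.le_iff_le.2 hgx)
    · intro h g hg hr hgx
      obtain ⟨z, rfl⟩ := hlow x g hgx
      rw [rank_orderEmbedding f hlow] at hr
      exact h z ((hmem z).1 hg) hr (f.le_iff_le.1 hgx)
  · constructor
    · intro h y hy hr
      exact (hB y).1 (h (f y) (f.lt_iff_lt.2 hy) (by rwa [rank_orderEmbedding f hlow]))
    · intro h y hy hr
      obtain ⟨z, rfl⟩ := hlow x y hy.le
      rw [rank_orderEmbedding f hlow] at hr
      exact (hB z).2 (h z (f.lt_iff_lt.1 hy) hr)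

/-- Rowvacuation is compatible with the inclusion of a union of connected components. -/
theorem mem_rvac_orderEmbedding (hlow : ∀ x y, y ≤ f x → ∃ z, f z = y)
    (hup : ∀ x y, f x ≤ y → ∃ z, f z = y) {A : Antichains Q} {A' : Antichains Q'}
    (hmem : ∀ x, f x ∈ A.1 ↔ x ∈ A'.1) (x : Q') : f x ∈ (rvac A).1 ↔ x ∈ (rvac A').1 := by
  have key : ∀ k x, f x ∈ (partialRvac k A).1 ↔ x ∈ (partialRvac k A').1 := by
    intro k
    induction k with
    | zero => exact hmem
    | succ k ih =>
      exact mem_rankToggleRun_orderEmbedding f hlow ih (fun a _ x h => hup x a h) k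
  rw [mem_rvac_iff_partialRvac (k := rank x + 1) (by rw [rank_orderEmbedding f hlow]; omega),
    mem_rvac_iff_partialRvac (k := rank x + 1) (by omega), key]

/-- Rowvacuation of an antichain none of whose elements lies above the minimal element `α`. -/
theorem mem_rvac_iff_of_minimal {α : Q} (hmin : ∀ y, y ≤ α → y = α)
    (hrange : ∀ y, (∃ x, f x = y) ↔ ¬ α ≤ y) {A : Antichains Q} {A' : Antichains Q'}
    (hmem : ∀ x, f x ∈ A.1 ↔ x ∈ A'.1) (hA : ∀ a ∈ A.1, ¬ α ≤ a) (y : Q) :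
    y ∈ (rvac A).1 ↔ y = α ∨ ∃ x ∈ (rvac A').1, f x = y := by
  have hlow : ∀ x y, y ≤ f x → ∃ z, f z = y := fun x y h =>
    (hrange y).2 fun hy => (hrange (f x)).1 ⟨x, rfl⟩ (hy.trans h)
  have hrα : rank α = 0 := by
    by_contra h
    obtain ⟨y, hy, -⟩ := exists_lt_rank_add_one h
    exact hy.ne (hmin y hy.le)
  have hrun : ∀ k B B', (∀ x, f x ∈ B.1 ↔ x ∈ B'.1) → (∀ a ∈ B.1, α ≤ a → a = α) →
      ∀ x, f x ∈ (rankToggleRun Q k B).1 ↔ x ∈ (rankToggleRun Q' k B').1 := by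
    intro k B B' h1 h2
    refine mem_rankToggleRun_orderEmbedding f hlow h1 (fun a ha x hxa => ?_) k
    rw [hrange]
    intro hαa
    obtain rfl := h2 a ha hαa
    exact (hrange (f x)).1 ⟨x, rfl⟩ (hmin _ hxa).ge
  -- After the first run `α` is present, and having rank 0 it stays frozen. From then on `α` is the
  -- only member of the antichain above `α`, and it is above nothing in the range of `f`.
  have key : ∀ k, (∀ x, f x ∈ (partialRvac (k + 1) A).1 ↔ x ∈ (partialRvac (k + 1) A').1) ∧
      α ∈ (partialRvac (k + 1) A).1 := by
    intro k
    induction k with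
    | zero =>
      refine ⟨hrun 0 A A' hmem fun a ha hαa => absurd hαa (hA a ha), ?_⟩
      refine mem_rankToggleRun.2 (Or.inr ⟨Nat.zero_le _, ?_, fun _ _ h => absurd h (Nat.not_lt_zero _),
        fun y hy => ?_⟩)
      · rintro ⟨a, ha, hαa⟩
        exact hA a ha hαa
      · exact absurd (hmin y hy.le) hy.ne
    | succ k ih =>
      refine ⟨hrun (k + 1) _ _ ih.1 fun a ha hαa => (eq_of_mem_of_le ih.2 ha hαa).symm, ?_⟩
      exact mem_rankToggleRun.2 (Or.inl ⟨by omega, ih.2⟩)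
  have hα : α ∈ (rvac A).1 := (mem_rvac_iff_partialRvac (k := 1) (by omega)).2 (key 0).2
  have hx : ∀ x, f x ∈ (rvac A).1 ↔ x ∈ (rvac A').1 := fun x => by
    rw [mem_rvac_iff_partialRvac (k := rank x + 1) (by rw [rank_orderEmbedding f hlow]; omega),
      mem_rvac_iff_partialRvac (k := rank x + 1) (by omega), (key _).1]
  constructor
  · intro hy
    by_cases h : α ≤ y
    · exact Or.inl (eq_of_mem_of_le hα hy h).symm
    · obtain ⟨x, rfl⟩ := (hrange y).2 h
      exact Or.inr ⟨x, (hx x).1 hy, rfl⟩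
  · rintro (rfl | ⟨x, h, rfl⟩)
    · exact hα
    · exact (hx x).2 h

end Transfer

/-! ### Rank levels in a poset with a greatest element -/

section RankLevel

variable {Q : Type*} [PartialOrder Q] [Fintype Q]

theorem mem_rankLevel {i : ℕ} {x : Q} : x ∈ (rankLevel Q i).1 ↔ rank x = i := by
  simp [rankLevel]

theorem below_rankLevel (hQ : IsRanked Q) {t : Q} (ht : ∀ x, x ≤ t) {i : ℕ} (hi : i ≤ rank t)
    (x : Q) : Below (rankLevel Q i) x ↔ rank x ≤ i := by
  constructor
  · rintro ⟨a, ha, hxa⟩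
    rw [mem_rankLevel] at ha
    exact ha ▸ rank_strictMono.monotone hxa
  · intro h
    obtain ⟨z, hxz, -, hz⟩ := exists_rank_eq_between hQ (ht x) h hi
    exact ⟨z, mem_rankLevel.2 hz, hxz⟩

theorem not_below_rankLevel_succ_rank {t : Q} (ht : ∀ x, x ≤ t) (x : Q) :
    ¬ Below (rankLevel Q (rank t + 1)) x := by
  rintro ⟨a, ha, -⟩
  rw [mem_rankLevel] at ha
  have := rank_strictMono.monotone (ht a)
  omega

theorem row_rankLevel (hQ : IsRanked Q) {t : Q} (ht : ∀ x, x ≤ t) {i : ℕ} (hi : i ≤ rank t) :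
    row (rankLevel Q i) = rankLevel Q (i + 1) := by
  refine antichain_ext fun x => ?_
  simp only [mem_row, mem_rankLevel, below_rankLevel hQ ht hi]
  constructor
  · rintro ⟨h1, h2⟩
    obtain ⟨y, hy, hr⟩ := exists_lt_rank_add_one (x := x) (by omega)
    have := h2 y hy
    omega
  · intro h
    refine ⟨by omega, fun y hy => ?_⟩
    have := rank_strictMono hy
    omega

theorem row_rankLevel_succ_rank {t : Q} (ht : ∀ x, x ≤ t) :
    row (rankLevel Q (rank t + 1)) = rankLevel Q 0 := by
  refine antichain_ext fun x => ?_
  simp only [mem_row, mem_rankLevel, not_below_rankLevel_succ_rank ht, not_false_eq_true, true_and]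
  constructor
  · intro h
    by_contra h0
    obtain ⟨y, hy, -⟩ := exists_lt_rank_add_one h0
    exact h y hy
  · intro h y hy
    have := rank_strictMono hy
    omega

/-- Level `rank t + 1` is empty, and rowmotion runs cyclically through the levels `0, …, rank t +
1`. The empty level is computed directly; `row_rvac_row` then lowers `i` step by step. -/
theorem rvac_rankLevel (hQ : IsRanked Q) {t : Q} (ht : ∀ x, x ≤ t) {i : ℕ}
    (hi : i ≤ rank t + 1) : rvac (rankLevel Q i) = rankLevel Q (rank t + 1 - i) := by
  obtain ⟨n, hn⟩ : ∃ n, rank t + 1 = i + n := ⟨rank t + 1 - i, by omega⟩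
  induction n generalizing i with
  | zero =>
    have hit : ∀ k, k ≤ rank t → row^[k + 1] (rankLevel Q (rank t + 1)) = rankLevel Q k := by
      intro k hk
      induction k with
      | zero => exact row_rankLevel_succ_rank ht
      | succ k ih => rw [iterate_row_succ, ih (by omega), row_rankLevel hQ ht (by omega)]
    obtain rfl : i = rank t + 1 := by omega
    rw [Nat.sub_self]
    refine antichain_ext fun x => ?_
    rw [mem_rvac hQ, mem_rankLevel]
    have hx := rank_strictMono.monotone (ht x)
    constructor
    · rintro ⟨h1, h2⟩
      by_contra h0
      have h2 := h2 h0
      obtain ⟨k, hk⟩ : ∃ k, rank x = k + 1 := ⟨rank x - 1, by omega⟩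
      rw [hk, Nat.add_sub_cancel] at h2
      cases k with
      | zero => exact not_below_rankLevel_succ_rank ht x h2
      | succ k =>
        rw [hit k (by omega), below_rankLevel hQ ht (by omega)] at h2
        omega
    · intro h0
      refine ⟨?_, fun h => absurd h0 h⟩
      rw [h0]
      exact not_below_rankLevel_succ_rank ht x
  | succ n ih =>
    have h1 := ih (i := i + 1) (by omega) (by omega)
    rw [← row_rvac_row hQ, row_rankLevel hQ ht (by omega), h1, row_rankLevel hQ ht (by omega)]
    congr 1
    omega

end RankLevel

/-! ### The interval model and the effect of rowmotion on left ends -/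

/-- A model of the root posets of the types `B`, `C` (`two = false`) and `D` (`two = true`): the
intervals `[i, j]` with `i + j ≤ 2 * c`, those with `j = c` being doubled if `two = true`. -/
@[ext] structure Cell (c : ℕ) (two : Bool) where
  /-- The left end of the interval. -/
  i : ℕ
  /-- The right end of the interval. -/
  j : ℕ
  /-- The copy of the interval. -/
  s : Bool
  one_le : 1 ≤ i
  le_j : i ≤ j
  sum_le : i + j ≤ 2 * c
  sign : s = true → j = c ∧ two = true

namespace Cell

variable {c : ℕ} {two : Bool}

instance : PartialOrder (Cell c two) where
  le x y := y.i ≤ x.i ∧ x.j ≤ y.j ∧ (x.j = c → y.j = c → x.s = y.s)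
  le_refl x := ⟨le_rfl, le_rfl, fun _ _ => rfl⟩
  le_trans x y z h₁ h₂ := ⟨h₂.1.trans h₁.1, h₁.2.1.trans h₂.2.1, fun hx hz => by
    have hy : y.j = c := by have := h₁.2.1; have := h₂.2.1; omega
    rw [h₁.2.2 hx hy, h₂.2.2 hy hz]⟩
  le_antisymm x y h₁ h₂ := by
    have hj : x.j = y.j := le_antisymm h₁.2.1 h₂.2.1
    refine Cell.ext (le_antisymm h₂.1 h₁.1) hj ?_
    by_cases hc : x.j = c
    · exact h₁.2.2 hc (hj ▸ hc)
    · have hx : x.s = false := by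
        by_contra h
        exact hc (x.sign (by simpa using h)).1
      have hy : y.s = false := by
        by_contra h
        exact hc (hj ▸ (y.sign (by simpa using h)).1)
      rw [hx, hy]

theorem le_def {x y : Cell c two} :
    x ≤ y ↔ y.i ≤ x.i ∧ x.j ≤ y.j ∧ (x.j = c → y.j = c → x.s = y.s) := Iff.rfl

theorem s_eq_false {x : Cell c two} (h : x.j ≠ c) : x.s = false := by
  by_contra h'
  exact h (x.sign (by simpa using h')).1

theorem ext_of_ne {x y : Cell c two} (hi : x.i = y.i) (hj : x.j = y.j) (h : x.j ≠ c) : x = y :=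
  Cell.ext hi hj (by rw [s_eq_false h, s_eq_false (hj ▸ h)])

instance : Fintype (Cell c two) :=
  Fintype.ofInjective
    (fun x => ((⟨x.i, by have := x.sum_le; omega⟩, ⟨x.j, by have := x.sum_le; omega⟩, x.s) :
      Fin (2 * c + 1) × Fin (2 * c + 1) × Bool)) (by
    intro x y h
    simp only [Prod.mk.injEq, Fin.mk.injEq] at h
    exact Cell.ext h.1 h.2.1 h.2.2)

theorem strictMono_length : StrictMono fun x : Cell c two => x.j - x.i := by
  intro x y hxy
  have h := hxy.le
  rw [le_def] at h
  have hx := x.le_j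
  have hne : ¬ (x.i = y.i ∧ x.j = y.j) := fun hij => hxy.not_ge <| by
    rw [le_def]
    exact ⟨hij.1.le, hij.2.ge, fun h1 h2 => (h.2.2 h2 h1).symm⟩
  change x.j - x.i < y.j - y.i
  omega

theorem exists_lt_length (x : Cell c two) (hx : x.j - x.i ≠ 0) :
    ∃ y < x, (y.j - y.i) + 1 = x.j - x.i := by
  have h1 := x.one_le
  have h2 := x.sum_le
  suffices ∃ y ≤ x, (y.j - y.i) + 1 = x.j - x.i by
    obtain ⟨y, hy, h⟩ := this
    exact ⟨y, lt_of_le_of_ne hy (by rintro rfl; omega), h⟩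
  -- A symmetric interval can only be shortened on the right: raising its left end would break the
  -- bound on `i + j`.
  by_cases hd : x.i + x.j = 2 * c
  · refine ⟨⟨x.i, x.j - 1, false, h1, by omega, by omega, by simp⟩, ?_, ?_⟩
    · rw [le_def]
      exact ⟨le_rfl, by simp, by simp only; omega⟩
    · simp only; omega
  · refine ⟨⟨x.i + 1, x.j, x.s, by omega, by omega, by omega, x.sign⟩, ?_, ?_⟩
    · rw [le_def]
      exact ⟨by simp, le_rfl, fun _ _ => rfl⟩
    · simp only; omega

theorem rank_eq (x : Cell c two) : rank x = x.j - x.i :=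
  rank_eq_of_strictMono strictMono_length exists_lt_length x

theorem isRanked : IsRanked (Cell c two) := by
  refine isRanked_of_strictMono strictMono_length exists_lt_length fun x y hxy => ?_
  have h := hxy.le
  have hlt := strictMono_length hxy.lt
  simp only at hlt
  rw [le_def] at h
  have hx1 := x.one_le
  have hx2 := x.le_j
  have hx3 := x.sum_le
  have hy1 := y.one_le
  have hy3 := y.sum_le
  suffices ∃ z, x ≤ z ∧ z ≤ y ∧ z.j - z.i = x.j - x.i + 1 by
    obtain ⟨z, hxz, hzy, hz⟩ := this
    rcases hxy.eq_or_eq hxz hzy with rfl | rfl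
    · omega
    · exact hz
  by_cases hi : y.i < x.i
  · refine ⟨⟨x.i - 1, x.j, x.s, by omega, by omega, by omega, x.sign⟩, ?_, ?_, ?_⟩
    · rw [le_def]; exact ⟨by simp, le_rfl, fun _ _ => rfl⟩
    · rw [le_def]; exact ⟨by simp only; omega, h.2.1, h.2.2⟩
    · simp only; omega
  -- When the right end reaches the centre, the new interval must lie in the same copy as `y`.
  · by_cases hc : x.j + 1 = c ∧ y.j = c
    · refine ⟨⟨x.i, x.j + 1, y.s, hx1, by omega, by omega, fun hs => ⟨hc.1, (y.sign hs).2⟩⟩,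
        ?_, ?_, ?_⟩
      · rw [le_def]; exact ⟨le_rfl, by simp, by simp only; omega⟩
      · rw [le_def]; exact ⟨h.1, by simp only; omega, fun _ _ => rfl⟩
      · simp only; omega
    · refine ⟨⟨x.i, x.j + 1, false, hx1, by omega, by omega, by simp⟩, ?_, ?_, ?_⟩
      · rw [le_def]; exact ⟨le_rfl, by simp, by simp only; omega⟩
      · rw [le_def]; exact ⟨h.1, by simp only; omega, fun h1 h2 => absurd ⟨h1, h2⟩ hc⟩
      · simp only; omega

/-- The set of left ends of the intervals of `A` and of the mirror images of its intervals reaching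
beyond the centre. -/
def Line (A : Antichains (Cell c two)) (l : ℕ) : Prop :=
  (∃ x ∈ A.1, x.i = l) ∨ (∃ x ∈ A.1, c < x.j ∧ x.j + l = 2 * c) ∨
    (l = c ∧ ∃ k, 1 ≤ k ∧ k < c ∧ (∀ y : Cell c two, y.i = k → y.j = c → Below A y) ∧
      ∀ y : Cell c two, y.i = k → y.j = c + 1 → ¬ Below A y)

/-- A member of `A` above `x` cannot extend further left than `x`, since it would then also lie
above the left neighbour. -/
theorem line_of_below {A : Antichains (Cell c two)} {x : Cell c two} (hx : Below A x)
    (h : ∀ y : Cell c two, y.j = x.j → y.s = x.s → y.i + 1 = x.i → ¬ Below A y) : Line A x.i := by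
  obtain ⟨a, ha, hxa⟩ := hx
  rw [le_def] at hxa
  have ha1 := a.one_le
  have hx2 := x.le_j
  have hx3 := x.sum_le
  by_cases hi : a.i = x.i
  · exact Or.inl ⟨a, ha, hi⟩
  · refine absurd ⟨a, ha, ?_⟩ (h ⟨x.i - 1, x.j, x.s, by omega, by omega, by omega, x.sign⟩
      rfl rfl (by simp only; omega))
    rw [le_def]
    exact ⟨by simp only; omega, hxa.2⟩

/-- A member `g` of `row A` is minimal outside the ideal, so shortening `g` on the left lands in the
ideal of `A` while `g` does not; `line_of_below` then finds a left end at `l + 1`. Beyond the centre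
the right end plays this role for the mirror image. The hypothesis on `[l, l]` excludes that `g` is
too short to be shortened. -/
theorem line_succ_of_line_row {A : Antichains (Cell c two)} {l : ℕ} (hlc : l + 1 ≤ c)
    (hz : ∀ z : Cell c two, z.i = l → z.j = l → Below A z) (h : Line (row A) l) :
    Line A (l + 1) := by
  have hupper : ∀ g ∈ (row A).1, c < g.j → g.j + l = 2 * c → Line A (l + 1) := by
    intro g hg hgj hgl
    rw [mem_row] at hg
    have hg1 := g.one_le
    have hg3 := g.sum_le
    have hlow : ∀ y : Cell c two, y.i = g.i → y.j + 1 = g.j → Below A y := by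
      intro y hyi hyj
      refine hg.2 y (lt_of_le_of_ne ?_ (by rintro rfl; omega))
      rw [le_def]
      exact ⟨hyi.ge, by omega, by omega⟩
    -- Shortening across the centre meets all copies of the interval at once, which is the third
    -- clause of `Line`; otherwise the member of `A` above the shortened interval ends exactly
    -- there.
    by_cases hgc : g.j = c + 1
    · refine Or.inr (Or.inr ⟨by omega, g.i, hg1, by omega, fun y h1 h2 => hlow y h1 (by omega),
        fun y h1 h2 => ?_⟩)
      rw [ext_of_ne (x := y) (y := g) h1 (by omega) (by omega)]
      exact hg.1
    · obtain ⟨a, ha, hle⟩ := hlow ⟨g.i, g.j - 1, false, hg1, by omega, by omega, by simp⟩ rfl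
        (by simp only; omega)
      rw [le_def] at hle
      simp only at hle
      have haj : ¬ g.j ≤ a.j := fun hj => hg.1 ⟨a, ha, by
        rw [le_def]; exact ⟨hle.1, hj, by omega⟩⟩
      exact Or.inr (Or.inl ⟨a, ha, by omega, by omega⟩)
  rcases h with ⟨g, hg, hgi⟩ | ⟨g, hg, hgj, hgl⟩ | ⟨h, -⟩
  · have hg' := mem_row.1 hg
    have hg2 := g.le_j
    have hg3 := g.sum_le
    by_cases hd : g.i + g.j = 2 * c
    · exact hupper g hg (by omega) (by omega)
    · by_cases hgj : g.j = l
      · exact absurd (hz g hgi hgj) hg'.1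
      · have hb : Below A ⟨l + 1, g.j, g.s, by omega, by omega, by omega, g.sign⟩ := by
          refine hg'.2 _ (lt_of_le_of_ne ?_ fun h => ?_)
          · rw [le_def]
            exact ⟨by simp only; omega, le_rfl, fun _ _ => rfl⟩
          · have := congrArg Cell.i h
            simp only at this
            omega
        refine line_of_below hb fun y h1 h2 h3 => ?_
        simp only at h1 h2 h3
        rw [Cell.ext (x := y) (y := g) (by omega) h1 h2]
        exact hg'.1
  · exact hupper g hg hgj hgl
  · omega

/-- Extending a member of `A` by one position leaves the ideal, and a minimal element outside the
ideal within that row or column belongs to `row A`. The extra data on `g` records how far it reaches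
and is needed at the centre, where the two copies interfere. -/
theorem exists_mem_row_of_line {A : Antichains (Cell c two)} {l : ℕ} (hl : 1 ≤ l)
    (h : Line A (l + 1)) : ∃ g ∈ (row A).1,
      (g.i = l ∧ (g.j = l ∨ ∃ y : Cell c two, y.i = l + 1 ∧ y.j = g.j ∧ y.s = g.s ∧ Below A y)) ∨
      (c < g.j ∧ g.j + l = 2 * c) := by
  have hleft : ∀ x ∈ A.1, x.i = l + 1 → ∃ g ∈ (row A).1, g.i = l ∧
      (g.j = l ∨ ∃ y : Cell c two, y.i = l + 1 ∧ y.j = g.j ∧ y.s = g.s ∧ Below A y) := by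
    intro x hx hxi
    have hx2 := x.le_j
    have hx3 := x.sum_le
    obtain ⟨g, ⟨hgi, hgb, hgj, hgs⟩, hmin⟩ := WellFounded.has_min
      (r := ((· < ·) : Cell c two → Cell c two → Prop)) wellFounded_lt
      {z | z.i = l ∧ ¬ Below A z ∧ z.j ≤ x.j ∧ (z.j = x.j → z.s = x.s)}
      ⟨⟨l, x.j, x.s, hl, by omega, by omega, x.sign⟩, rfl, by
        refine not_below_of_mem_of_lt hx (lt_of_le_of_ne ?_ fun h => ?_)
        · rw [le_def]; exact ⟨by simp only; omega, le_rfl, fun _ _ => rfl⟩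
        · have := congrArg Cell.i h
          simp only at this
          omega, le_rfl, fun _ => rfl⟩
    refine ⟨g, mem_row.2 ⟨hgb, fun y hy => ?_⟩, hgi, ?_⟩
    · have hyg := hy.le
      rw [le_def] at hyg
      by_cases hyi : y.i = l
      · by_contra hyb
        refine hmin y ⟨hyi, hyb, by omega, fun hyj => ?_⟩ hy
        by_cases hyc : y.j = c
        · rw [hyg.2.2 hyc (by omega), hgs (by omega)]
        · rw [s_eq_false hyc, s_eq_false (hyj ▸ hyc)]
      · refine ⟨x, hx, ?_⟩
        rw [le_def]
        refine ⟨by omega, by omega, fun h1 h2 => ?_⟩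
        rw [hyg.2.2 h1 (by omega), hgs (by omega)]
    · by_cases hgl : g.j = l
      · exact Or.inl hgl
      · have hg2 := g.le_j
        refine Or.inr ⟨⟨l + 1, g.j, g.s, by omega, by omega, by omega, g.sign⟩, rfl, rfl, rfl,
          x, hx, ?_⟩
        rw [le_def]
        exact ⟨hxi.le, hgj, fun h1 h2 => hgs (h1.trans h2.symm)⟩
  have hcol : ∀ j k, 1 ≤ k → k + j + 1 ≤ 2 * c → c ≤ j →
      (∀ y : Cell c two, y.i = k → y.j = j → Below A y) →
      (∀ y : Cell c two, y.i = k → y.j = j + 1 → ¬ Below A y) → ∃ g ∈ (row A).1, g.j = j + 1 := by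
    intro j k hk hkj hj h1 h2
    obtain ⟨g, ⟨hgi, hgj, hgb⟩, hmin⟩ := WellFounded.has_min
      (r := ((· < ·) : Cell c two → Cell c two → Prop)) wellFounded_lt
      {z | k ≤ z.i ∧ z.j = j + 1 ∧ ¬ Below A z}
      ⟨⟨k, j + 1, false, hk, by omega, by omega, by simp⟩, le_rfl, rfl, h2 _ rfl rfl⟩
    refine ⟨g, mem_row.2 ⟨hgb, fun y hy => ?_⟩, hgj⟩
    have hyg := hy.le
    rw [le_def] at hyg
    by_cases hyj : y.j = j + 1
    · by_contra hyb
      exact hmin y ⟨by omega, hyj, hyb⟩ hy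
    -- If `y` ends at the centre, the comparison interval must be taken in the copy containing `y`;
    -- this is why all copies are assumed to lie in the ideal.
    · refine Below.mono (h1 ⟨k, j, if j = c then (if y.j = c then y.s else false) else false, hk,
        by omega, by omega, fun h => ?_⟩ rfl rfl) ?_
      · split_ifs at h with hjc hyc
        · exact ⟨hjc, (y.sign h).2⟩
      · rw [le_def]
        refine ⟨by simp only; omega, by simp only; omega, fun h3 h4 => ?_⟩
        simp only at h4
        simp [h3, h4]
  rcases h with ⟨x, hx, hxi⟩ | ⟨x, hx, hxj, hxl⟩ | ⟨hl', k, hk, hkc, h1, h2⟩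
  · obtain ⟨g, hg, h⟩ := hleft x hx hxi
    exact ⟨g, hg, Or.inl h⟩
  · by_cases hd : x.i = l + 1
    · obtain ⟨g, hg, h⟩ := hleft x hx hd
      exact ⟨g, hg, Or.inl h⟩
    · have hx3 := x.sum_le
      obtain ⟨g, hg, hgj⟩ := hcol x.j x.i x.one_le (by omega) hxj.le (fun y hyi hyj => by
          rw [ext_of_ne (x := y) (y := x) hyi hyj (by omega)]
          exact below_of_mem hx) (fun y hyi hyj => by
          refine not_below_of_mem_of_lt hx (lt_of_le_of_ne ?_ (by rintro rfl; omega))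
          rw [le_def]
          exact ⟨hyi.le, by omega, by omega⟩)
      exact ⟨g, hg, Or.inr ⟨by omega, by omega⟩⟩
  · obtain ⟨g, hg, hgj⟩ := hcol c k hk (by omega) le_rfl h1 h2
    exact ⟨g, hg, Or.inr ⟨by omega, by omega⟩⟩

theorem line_row_of_line {A : Antichains (Cell c two)} {l : ℕ} (hl : 1 ≤ l)
    (h : Line A (l + 1)) : Line (row A) l := by
  obtain ⟨g, hg, h | h⟩ := exists_mem_row_of_line hl h
  · exact Or.inl ⟨g, hg, h.1⟩
  · exact Or.inr (Or.inl ⟨g, hg, h⟩)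

/-- The member of `row A` supplied by the line cannot lie below `x`, which is in the ideal of `A`,
so it ends strictly beyond `x` and lies above it. -/
theorem below_row_of_line {A : Antichains (Cell c two)} {x : Cell c two} (hxc : x.j < c)
    (hx : Below A x) (h : Line A (x.i + 1)) : Below (row A) x := by
  have hx2 := x.le_j
  obtain ⟨g, hg, hgi | hgj⟩ := exists_mem_row_of_line x.one_le h
  · have hgj : ¬ g.j ≤ x.j := fun hj => (mem_row.1 hg).1 (hx.mono (by
      rw [le_def]; exact ⟨by omega, hj, by omega⟩))
    exact ⟨g, hg, by rw [le_def]; exact ⟨by omega, by omega, by omega⟩⟩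
  · have hg3 := g.sum_le
    exact ⟨g, hg, by rw [le_def]; exact ⟨by omega, by omega, by omega⟩⟩

/-- At the centre the argument of `below_row_of_line` can fail only because the member of `row A`
supplied by the line ends at the centre in the other copy. -/
theorem exists_other_sign {A : Antichains (Cell c two)} {x : Cell c two} (hxc : x.j = c)
    (hxi : x.i + 1 ≤ c) (hx : Below A x) (hx' : ¬ Below (row A) x) (h : Line A (x.i + 1)) :
    (∃ y : Cell c two, y.i = x.i + 1 ∧ y.j = c ∧ y.s ≠ x.s ∧ Below A y) ∧
      ∀ y : Cell c two, y.i = x.i → y.j = c → y.s ≠ x.s → ¬ Below A y := by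
  have hx1 := x.one_le
  obtain ⟨g, hg, ⟨hgi, hy⟩ | hgj⟩ := exists_mem_row_of_line hx1 h
  · have h1 : ¬ g ≤ x := fun hle => (mem_row.1 hg).1 (hx.mono hle)
    have h2 : ¬ x ≤ g := fun hle => hx' ⟨g, hg, hle⟩
    rw [le_def] at h1 h2
    have hgc : g.j = c := by
      by_contra hne
      rcases Nat.lt_or_ge g.j c with hlt | hge
      · exact h1 ⟨by omega, by omega, by omega⟩
      · exact h2 ⟨by omega, by omega, by omega⟩
    have hgs : g.s ≠ x.s := fun hs => h1 ⟨by omega, by omega, fun _ _ => hs⟩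
    constructor
    · rcases hy with hy | ⟨y, hyi, hyj, hys, hyb⟩
      · omega
      · exact ⟨y, hyi, by omega, hys ▸ hgs, hyb⟩
    · intro y hyi hyj hys
      have : y.s = g.s := by
        revert hys hgs
        cases y.s <;> cases g.s <;> cases x.s <;> simp
      rw [Cell.ext (x := y) (y := g) (by omega) (by omega) this]
      exact (mem_row.1 hg).1
  · have hg3 := g.sum_le
    exact absurd ⟨g, hg, by rw [le_def]; exact ⟨by omega, by omega, by omega⟩⟩ hx'

end Cell

/-! ### Right ends of the intervals in rowvacuation -/

namespace Cell

variable {c : ℕ} {two : Bool}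

/-- If no such interval existed, the intervals ending at `j` would stay in the ideals at the times
equal to their lengths minus one, while the absence of a line moves left. This ends with `[1, j]` in
the ideal and no line at 1, although nothing extends further left. -/
theorem exists_mem_rvac_of_not_line {A : Antichains (Cell c two)} {j : ℕ} {σ : Bool} (hj : 1 ≤ j)
    (hjc : j ≤ c) (hσ : σ = true → j = c ∧ two = true) (h : ¬ Line A j) :
    ∃ x ∈ (rvac A).1, x.j = j ∧ x.s = σ := by
  by_contra hcon
  push Not at hcon
  have key : ∀ t, t < j → (∀ x : Cell c two, x.i + t = j → x.j = j → x.s = σ →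
      Below (row^[t] A) x) ∧ ¬ Line (row^[t] A) (j - t) := by
    intro t
    induction t with
    | zero =>
      refine fun _ => ⟨fun x hi hxj hs => ?_, h⟩
      by_contra hb
      have hr : rank x = 0 := by rw [rank_eq]; omega
      exact hcon x ((mem_rvac isRanked).2 ⟨by rwa [hr], by omega⟩) hxj hs
    | succ t ih =>
      intro ht
      obtain ⟨ih1, ih2⟩ := ih (by omega)
      have hb : ∀ x : Cell c two, x.i + (t + 1) = j → x.j = j → x.s = σ →
          Below (row^[t] A) x := by
        intro x hxi hxj hxs
        by_contra hxb
        refine ih2 (line_of_below (ih1 ⟨j - t, j, σ, by omega, by omega, by omega, hσ⟩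
          (by simp only; omega) rfl rfl) fun y h1 h2 h3 => ?_)
        simp only at h1 h2 h3
        rwa [Cell.ext (x := y) (y := x) (by omega) (by omega) (by rw [h2, hxs])]
      constructor
      · intro x hxi hxj hxs
        by_contra hxb
        have hr : rank x = t + 1 := by rw [rank_eq]; omega
        exact hcon x ((mem_rvac isRanked).2 ⟨by rwa [hr], fun _ => by
          rw [hr]; exact hb x hxi hxj hxs⟩) hxj hxs
      · intro hline
        rw [iterate_row_succ] at hline
        have := line_succ_of_line_row (by omega) (fun z hzi hzj => ?_) hline
        · rw [show j - (t + 1) + 1 = j - t by omega] at this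
          exact ih2 this
        · refine (hb ⟨j - (t + 1), j, σ, by omega, by omega, by omega, hσ⟩
            (by simp only; omega) rfl rfl).mono ?_
          rw [le_def]
          exact ⟨by simp only; omega, by simp only; omega, by simp only; omega⟩
  obtain ⟨h1, h2⟩ := key (j - 1) (by omega)
  rw [show j - (j - 1) = 1 by omega] at h2
  exact h2 (line_of_below (h1 ⟨1, j, σ, le_rfl, hj, by omega, hσ⟩ (by simp only; omega) rfl rfl)
    fun y _ _ hy => by have := y.one_le; simp only at hy; omega)

theorem line_iterate_row {A : Antichains (Cell c two)} {l : ℕ} (h : Line A l) (t : ℕ)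
    (ht : t < l) : Line (row^[t] A) (l - t) := by
  induction t with
  | zero => exact h
  | succ t ih =>
    rw [iterate_row_succ]
    refine line_row_of_line (by omega) ?_
    rw [show l - (t + 1) + 1 = l - t by omega]
    exact ih (by omega)

/-- A line at the right end of `x` would arrive next to the left end of `x` at time `rank x - 1`,
when `x` is still in the ideal, and would keep it there one step longer. -/
theorem not_line_of_mem_rvac {A : Antichains (Cell c two)} {x : Cell c two} (hx : x ∈ (rvac A).1)
    (hxc : x.j < c) : ¬ Line A x.j := by
  intro hline
  rw [mem_rvac isRanked, rank_eq] at hx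
  have hx1 := x.one_le
  have hx2 := x.le_j
  by_cases h0 : x.j - x.i = 0
  · rw [h0] at hx
    refine hx.1 ?_
    rcases hline with ⟨y, hy, hyi⟩ | ⟨y, hy, hyj, hyl⟩ | ⟨h, -⟩
    · have := y.le_j
      exact ⟨y, hy, by rw [le_def]; exact ⟨by omega, by omega, by omega⟩⟩
    · have := y.sum_le
      exact ⟨y, hy, by rw [le_def]; exact ⟨by omega, by omega, by omega⟩⟩
    · omega
  · obtain ⟨k, hk⟩ : ∃ k, x.j - x.i = k + 1 := ⟨x.j - x.i - 1, by omega⟩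
    have h1 := hx.2 h0
    rw [hk, Nat.add_sub_cancel] at h1
    have h2 := hx.1
    rw [hk, iterate_row_succ] at h2
    refine h2 (below_row_of_line hxc h1 ?_)
    have := line_iterate_row hline k (by omega)
    rwa [show x.j - k = x.i + 1 by omega] at this

/-- Undoing one rowmotion keeps everything strictly below the ideal, in particular the interval
shortened by one on the left. -/
theorem below_iterate_shift {A : Antichains (Cell c two)} {t n : ℕ} {x y : Cell c two}
    (hx : Below (row^[t + n] A) x) (hi : y.i = x.i + n) (hj : y.j = x.j) (hs : y.s = x.s) :
    Below (row^[t] A) y := by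
  induction n generalizing x with
  | zero =>
    rw [Cell.ext hi hj hs]
    exact hx
  | succ n ih =>
    rw [← add_assoc, iterate_row_succ] at hx
    have hy2 := y.le_j
    have hy3 := y.sum_le
    refine ih (x := ⟨x.i + 1, x.j, x.s, by omega, by omega, by omega, x.sign⟩)
      (below_of_below_row_of_lt hx (lt_of_le_of_ne ?_ fun h => ?_)) (by simp only; omega) hj hs
    · rw [le_def]
      exact ⟨by simp, le_rfl, fun _ _ => rfl⟩
    · have := congrArg Cell.i h
      simp at this

/-- A line at the centre allows an interval of `rvac A` ending there only through the other copy.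
That copy is then in the ideal too long for short intervals of the opposite sign to enter, and
already out of it at the left end of `x`. -/
theorem eq_sign_of_line {A : Antichains (Cell c two)} {x : Cell c two} (hx : x ∈ (rvac A).1)
    (hxc : x.j = c) (hline : Line A c) : two = true ∧
      ∀ y ∈ (rvac A).1, y.j = c → y.i ≥ x.i → y.s = x.s := by
  have hx1 := x.one_le
  have hx2 := x.le_j
  have htwo : ∀ y : Cell c two, y.s ≠ x.s → two = true := by
    intro y h
    by_cases hxs : x.s = true
    · exact (x.sign hxs).2
    · refine (y.sign ?_).2
      revert hxs h
      cases x.s <;> cases y.s <;> simp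
  have heq : ∀ y z : Cell c two, y.s ≠ x.s → z.s ≠ x.s → y.s = z.s := by
    intro y z
    cases x.s <;> cases y.s <;> cases z.s <;> simp
  rw [mem_rvac isRanked, rank_eq] at hx
  by_cases h0 : x.i = c
  · rw [show x.j - x.i = 0 by omega] at hx
    have hxb : ¬ Below A x := hx.1
    have hex : ∃ y ∈ A.1, y.i = c ∧ y.j = c ∧ y.s ≠ x.s := by
      rcases hline with ⟨y, hy, hyi⟩ | ⟨y, hy, hyj, hyl⟩ | ⟨-, k, hk, hkc, h1, -⟩
      · have hy2 := y.le_j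
        have hy3 := y.sum_le
        refine ⟨y, hy, hyi, by omega, fun hs => hxb ?_⟩
        rw [Cell.ext (x := x) (y := y) (by omega) (by omega) hs.symm]
        exact below_of_mem hy
      · omega
      · refine absurd ((h1 ⟨k, c, x.s, hk, by omega, by omega, fun h => ⟨rfl, (x.sign h).2⟩⟩
          rfl rfl).mono ?_) hxb
        rw [le_def]
        exact ⟨by simp only; omega, by simp only; omega, fun _ _ => rfl⟩
    obtain ⟨y, hy, hyi, hyj, hys⟩ := hex
    refine ⟨htwo y hys, fun z hz hzc hzi => ?_⟩
    by_contra hzs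
    have hz2 := z.le_j
    rw [Cell.ext (x := z) (y := y) (by omega) (by omega) (heq z y hzs hys), mem_rvac isRanked,
      rank_eq, show y.j - y.i = 0 by omega] at hz
    exact hz.1 (below_of_mem hy)
  · obtain ⟨k, hk⟩ : ∃ k, x.j - x.i = k + 1 := ⟨x.j - x.i - 1, by omega⟩
    have h1 := hx.2 (by omega)
    rw [hk, Nat.add_sub_cancel] at h1
    have h2 := hx.1
    rw [hk, iterate_row_succ] at h2
    have hl := line_iterate_row hline k (by omega)
    rw [show c - k = x.i + 1 by omega] at hl
    obtain ⟨⟨y, hyi, hyj, hys, hyb⟩, hno⟩ := exists_other_sign hxc (by omega) h1 h2 hl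
    refine ⟨htwo y hys, fun z hz hzc hzi => ?_⟩
    by_contra hzs
    rw [mem_rvac isRanked, rank_eq] at hz
    have hz2 := z.le_j
    by_cases hzx : z.i = x.i
    · have := hz.2 (by omega)
      rw [show z.j - z.i - 1 = k by omega] at this
      exact hno z hzx hzc hzs this
    · refine hz.1 (below_iterate_shift (x := y) (n := z.i - y.i) ?_ (by omega) (by omega)
        (heq z y hzs hys))
      rwa [show z.j - z.i + (z.i - y.i) = k by omega]

theorem eq_of_mem_rvac_of_line {A : Antichains (Cell c two)} {x y : Cell c two}
    (hx : x ∈ (rvac A).1) (hy : y ∈ (rvac A).1) (hxc : x.j = c) (hyc : y.j = c)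
    (hline : Line A c) : x = y := by
  rcases le_total x.i y.i with h | h
  · exact (eq_of_mem_of_le hy hx (by
      rw [le_def]
      exact ⟨h, by omega, fun _ _ => (eq_sign_of_line hx hxc hline).2 y hy hyc h⟩)).symm
  · exact eq_of_mem_of_le hx hy (by
      rw [le_def]
      exact ⟨h, by omega, fun _ _ => (eq_sign_of_line hy hyc hline).2 x hx hxc h⟩)

/-! ### Counting -/

/-- The number of intervals of `A` left of the centre. -/
def lo (A : Antichains (Cell c two)) : ℕ := (A.1.filter fun x => x.j < c).card

/-- The number of intervals of `A` reaching beyond the centre. -/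
def up (A : Antichains (Cell c two)) : ℕ := (A.1.filter fun x => c < x.j).card

/-- The number of intervals of `A` ending at the centre. -/
def mid (A : Antichains (Cell c two)) : ℕ := (A.1.filter fun x => x.j = c).card

/-- The number of symmetric intervals of `A` reaching beyond the centre. -/
def symUp (A : Antichains (Cell c two)) : ℕ := (A.1.filter fun x => c < x.j ∧ x.i + x.j = 2 * c).card

/-- The number of intervals of `A` that consist of the centre. -/
def centre (A : Antichains (Cell c two)) : ℕ := (A.1.filter fun x => x.j = c ∧ x.i = c).card

/-- The number of left ends of the intervals of `A` that end at the centre and are longer than the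
centre. -/
def midLeft (A : Antichains (Cell c two)) : ℕ :=
  ((A.1.filter fun x => x.j = c ∧ x.i < c).image Cell.i).card

theorem card_eq_lo_mid_up (A : Antichains (Cell c two)) : A.1.card = lo A + mid A + up A := by
  have h1 := Finset.card_filter_add_card_filter_not (s := A.1) (fun x => x.j < c)
  have h2 := Finset.card_filter_add_card_filter_not (s := A.1.filter fun x => ¬ x.j < c)
    (fun x => x.j = c)
  rw [Finset.filter_filter, Finset.filter_filter] at h2
  have h3 : (A.1.filter fun x => ¬ x.j < c ∧ x.j = c) = A.1.filter fun x => x.j = c :=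
    Finset.filter_congr fun x _ => by omega
  have h4 : (A.1.filter fun x => ¬ x.j < c ∧ ¬ x.j = c) = A.1.filter fun x => c < x.j :=
    Finset.filter_congr fun x _ => by omega
  rw [h3, h4] at h2
  rw [lo, mid, up]
  omega

theorem eq_of_mem_of_i_eq {A : Antichains (Cell c two)} {x y : Cell c two} (hx : x ∈ A.1)
    (hy : y ∈ A.1) (h : x.i = y.i) (hs : x.j = c → y.j = c → x.s = y.s) : x = y := by
  rcases le_total x.j y.j with hj | hj
  · exact eq_of_mem_of_le hx hy (by rw [le_def]; exact ⟨h.ge, hj, hs⟩)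
  · exact (eq_of_mem_of_le hy hx (by
      rw [le_def]; exact ⟨h.le, hj, fun h1 h2 => (hs h2 h1).symm⟩)).symm

theorem eq_of_mem_of_j_eq {A : Antichains (Cell c two)} {x y : Cell c two} (hx : x ∈ A.1)
    (hy : y ∈ A.1) (h : x.j = y.j) (hs : x.j = c → y.j = c → x.s = y.s) : x = y := by
  rcases le_total y.i x.i with hj | hj
  · exact eq_of_mem_of_le hx hy (by rw [le_def]; exact ⟨hj, h.le, hs⟩)
  · exact (eq_of_mem_of_le hy hx (by
      rw [le_def]; exact ⟨hj, h.ge, fun h1 h2 => (hs h2 h1).symm⟩)).symm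

/-- Left of the centre, the right ends of `rvac A` are distinct and fill exactly the positions
without a line. -/
theorem lo_rvac_add (A : Antichains (Cell c two)) :
    lo (rvac A) + ((Finset.Icc 1 (c - 1)).filter (Line A)).card = c - 1 := by
  have h1 := Finset.card_filter_add_card_filter_not (s := Finset.Icc 1 (c - 1)) (Line A)
  rw [Nat.card_Icc] at h1
  have h2 : ((Finset.Icc 1 (c - 1)).filter fun l => ¬ Line A l) =
      ((rvac A).1.filter fun x => x.j < c).image Cell.j := by
    ext l
    simp only [Finset.mem_filter, Finset.mem_Icc, Finset.mem_image]
    constructor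
    · rintro ⟨hl, hline⟩
      obtain ⟨x, hx, hxj, -⟩ := exists_mem_rvac_of_not_line (σ := false) hl.1 (by omega)
        (by simp) hline
      exact ⟨x, ⟨hx, by omega⟩, hxj⟩
    · rintro ⟨x, ⟨hx, hxj⟩, rfl⟩
      have := x.one_le
      have := x.le_j
      exact ⟨⟨by omega, by omega⟩, not_line_of_mem_rvac hx hxj⟩
  rw [h2, Finset.card_image_of_injOn] at h1
  · rw [lo]; omega
  · intro x hx y hy hxy
    simp only [Finset.coe_filter, Set.mem_ofPred_eq] at hx hy
    exact eq_of_mem_of_j_eq hx.1 hy.1 hxy (by omega)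

/-- Lines left of the centre are left ends or mirrored right ends. The two lists overlap only in
symmetric intervals, and the two copies at the centre may share a left end, whence `midLeft`. -/
theorem card_line (A : Antichains (Cell c two)) :
    ((Finset.Icc 1 (c - 1)).filter (Line A)).card + symUp A = lo A + 2 * up A + midLeft A := by
  set S₁ := (A.1.filter fun x => x.j ≠ c ∧ x.i < c).image Cell.i with hS₁
  set S₂ := (A.1.filter fun x => x.j = c ∧ x.i < c).image Cell.i with hS₂
  set S₃ := (A.1.filter fun x => c < x.j).image (fun x => 2 * c - x.j) with hS₃
  have hfil : (Finset.Icc 1 (c - 1)).filter (Line A) = (S₁ ∪ S₂) ∪ S₃ := by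
    ext l
    simp only [hS₁, hS₂, hS₃, Finset.mem_filter, Finset.mem_Icc, Finset.mem_union,
      Finset.mem_image]
    constructor
    · rintro ⟨hl, ⟨x, hx, rfl⟩ | ⟨x, hx, hxj, hxl⟩ | ⟨h, -⟩⟩
      · by_cases hxj : x.j = c
        · exact Or.inl (Or.inr ⟨x, ⟨hx, hxj, by omega⟩, rfl⟩)
        · exact Or.inl (Or.inl ⟨x, ⟨hx, hxj, by omega⟩, rfl⟩)
      · exact Or.inr ⟨x, ⟨hx, hxj⟩, by omega⟩
      · omega
    · rintro ((⟨x, ⟨hx, -, hxi⟩, rfl⟩ | ⟨x, ⟨hx, -, hxi⟩, rfl⟩) | ⟨x, ⟨hx, hxj⟩, rfl⟩)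
      · exact ⟨⟨x.one_le, by omega⟩, Or.inl ⟨x, hx, rfl⟩⟩
      · exact ⟨⟨x.one_le, by omega⟩, Or.inl ⟨x, hx, rfl⟩⟩
      · have := x.one_le
        have := x.sum_le
        exact ⟨⟨by omega, by omega⟩, Or.inr (Or.inl ⟨x, hx, hxj, by omega⟩)⟩
  have hdisj : Disjoint S₁ S₂ := by
    rw [Finset.disjoint_left]
    simp only [hS₁, hS₂, Finset.mem_image, Finset.mem_filter]
    rintro l ⟨x, ⟨hx, hxj, hxi⟩, rfl⟩ ⟨y, ⟨hy, hyj, -⟩, hyi⟩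
    have := eq_of_mem_of_i_eq hx hy hyi.symm (by omega)
    rw [this] at hxj
    exact hxj hyj
  have hcard₁ : S₁.card = lo A + up A := by
    rw [hS₁, Finset.card_image_of_injOn, lo, up, ← Finset.card_union_of_disjoint]
    · congr 1
      ext x
      have := x.le_j
      have := x.sum_le
      simp only [Finset.mem_filter, Finset.mem_union, ← and_or_left]
      refine and_congr_right fun _ => ⟨fun h => by omega, fun h => by omega⟩
    · rw [Finset.disjoint_left]
      simp only [Finset.mem_filter]
      intro x h1 h2
      omega
    · intro x hx y hy hxy
      simp only [Finset.coe_filter, Set.mem_ofPred_eq] at hx hy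
      exact eq_of_mem_of_i_eq hx.1 hy.1 hxy (by omega)
  have hcard₃ : S₃.card = up A := by
    rw [hS₃, Finset.card_image_of_injOn, up]
    intro x hx y hy hxy
    simp only [Finset.coe_filter, Set.mem_ofPred_eq] at hx hy hxy
    have := x.sum_le
    have := y.sum_le
    exact eq_of_mem_of_j_eq hx.1 hy.1 (by omega) (by omega)
  have hinter : (S₁ ∪ S₂) ∩ S₃ =
      (A.1.filter fun x => c < x.j ∧ x.i + x.j = 2 * c).image Cell.i := by
    ext l
    simp only [hS₁, hS₂, hS₃, Finset.mem_inter, Finset.mem_union, Finset.mem_image,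
      Finset.mem_filter]
    constructor
    · rintro ⟨h, y, ⟨hy, hyj⟩, hyl⟩
      have hx : ∃ x ∈ A.1, x.i = l := by
        rcases h with ⟨x, hx, hxi⟩ | ⟨x, hx, hxi⟩
        · exact ⟨x, hx.1, hxi⟩
        · exact ⟨x, hx.1, hxi⟩
      obtain ⟨x, hx, hxl⟩ := hx
      have := x.sum_le
      have := y.sum_le
      -- If the left end of `x` is the mirror of the right end of `y`, the bounds on the sums put
      -- `x` below `y`.
      have hxy : x = y := eq_of_mem_of_le hx hy (by rw [le_def]; exact ⟨by omega, by omega, by omega⟩)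
      subst hxy
      exact ⟨x, ⟨hx, hyj, by omega⟩, hxl⟩
    · rintro ⟨x, ⟨hx, hxj, hxd⟩, rfl⟩
      exact ⟨Or.inl ⟨x, ⟨hx, by omega, by omega⟩, rfl⟩, x, ⟨hx, hxj⟩, by omega⟩
  have hcard₄ : ((A.1.filter fun x => c < x.j ∧ x.i + x.j = 2 * c).image Cell.i).card = symUp A := by
    rw [Finset.card_image_of_injOn, symUp]
    intro x hx y hy hxy
    simp only [Finset.coe_filter, Set.mem_ofPred_eq] at hx hy
    exact eq_of_mem_of_i_eq hx.1 hy.1 hxy (by omega)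
  have hU := Finset.card_union_add_card_inter (S₁ ∪ S₂) S₃
  rw [hinter, hcard₄, hcard₃, Finset.card_union_of_disjoint hdisj, hcard₁, ← hfil] at hU
  rw [midLeft, ← hS₂]
  omega

/-- Comparing this identity for `A` and for `rvac A` relates `2 * up + midLeft - symUp` on both
sides, the source of all parity arguments below. -/
theorem lo_add_lo_rvac (A : Antichains (Cell c two)) :
    lo A + lo (rvac A) + 2 * up A + midLeft A = c - 1 + symUp A := by
  have h1 := lo_rvac_add A
  have h2 := card_line A
  omega

theorem symUp_le_one (A : Antichains (Cell c two)) : symUp A ≤ 1 := by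
  rw [symUp, Finset.card_le_one]
  intro x hx y hy
  simp only [Finset.mem_filter] at hx hy
  rcases le_total x.i y.i with h | h
  · exact (eq_of_mem_of_le hy.1 hx.1 (by rw [le_def]; exact ⟨h, by omega, by omega⟩)).symm
  · exact eq_of_mem_of_le hx.1 hy.1 (by rw [le_def]; exact ⟨h, by omega, by omega⟩)

theorem symUp_le_up (A : Antichains (Cell c two)) : symUp A ≤ up A :=
  Finset.card_le_card fun x hx => by
    simp only [Finset.mem_filter] at hx ⊢
    exact ⟨hx.1, hx.2.1⟩

theorem up_eq_zero_of_centre {A : Antichains (Cell c two)} (h : centre A ≠ 0) : up A = 0 := by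
  rw [centre, Finset.card_ne_zero] at h
  obtain ⟨x, hx⟩ := h
  simp only [Finset.mem_filter] at hx
  rw [up, Finset.card_eq_zero, Finset.filter_eq_empty_iff]
  intro y hy hyj
  have := y.sum_le
  have := eq_of_mem_of_le hx.1 hy (by rw [le_def]; exact ⟨by omega, by omega, by omega⟩)
  rw [this] at hx
  omega

end Cell

/-! ### Intervals ending at the centre, and the total counts -/

namespace Cell

variable {c : ℕ} {two : Bool}

/-- In the third clause of `Line` the members above the copies of `[k, c]` cannot pass the centre,
as `[k, c + 1]` is outside the ideal; so every copy contributes one. -/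
theorem exists_mid_of_line {A : Antichains (Cell c two)} (h : Line A c) :
    (∃ x ∈ A.1, x.i = c ∧ x.j = c) ∨
      ∀ s, (s = true → two = true) → ∃ x ∈ A.1, x.j = c ∧ x.s = s := by
  rcases h with ⟨x, hx, hxi⟩ | ⟨x, hx, hxj, hxl⟩ | ⟨-, k, hk, hkc, h1, h2⟩
  · have := x.le_j
    have := x.sum_le
    exact Or.inl ⟨x, hx, hxi, by omega⟩
  · omega
  · refine Or.inr fun s hs => ?_
    obtain ⟨a, ha, hle⟩ := h1 ⟨k, c, s, hk, by omega, by omega, fun h => ⟨rfl, hs h⟩⟩ rfl rfl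
    rw [le_def] at hle
    simp only at hle
    have haj : a.j = c := by
      by_contra hne
      refine h2 ⟨k, c + 1, false, hk, by omega, by omega, by simp⟩ rfl rfl ⟨a, ha, ?_⟩
      rw [le_def]
      exact ⟨hle.1, by simp only; omega, by simp only; omega⟩
    exact ⟨a, ha, haj, (hle.2.2 trivial haj).symm⟩

theorem line_of_mem_mid {A : Antichains (Cell c two)} {x : Cell c two} (hx : x ∈ A.1)
    (hxj : x.j = c) (h : ∀ y : Cell c two, y.i = x.i → y.j = c → Below A y) : Line A c := by
  have hx2 := x.le_j
  by_cases hxi : x.i = c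
  · exact Or.inl ⟨x, hx, hxi⟩
  · refine Or.inr (Or.inr ⟨rfl, x.i, x.one_le, by omega, h, fun y hyi hyj => ?_⟩)
    refine not_below_of_mem_of_lt hx (lt_of_le_of_ne ?_ (by rintro rfl; omega))
    rw [le_def]
    exact ⟨hyi.le, by omega, by omega⟩

theorem mid_pos_iff {A : Antichains (Cell c two)} : 0 < mid A ↔ ∃ x ∈ A.1, x.j = c := by
  rw [mid, Finset.card_pos]
  constructor
  · rintro ⟨x, hx⟩
    exact ⟨x, (Finset.mem_filter.1 hx).1, (Finset.mem_filter.1 hx).2⟩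
  · rintro ⟨x, hx⟩
    exact ⟨x, Finset.mem_filter.2 hx⟩

theorem midLeft_add_centre {A : Antichains (Cell c two)}
    (h : ∀ x ∈ A.1, ∀ y ∈ A.1, x.j = c → y.j = c → x.i = y.i → x = y) :
    midLeft A + centre A = mid A := by
  have h1 := Finset.card_filter_add_card_filter_not (s := A.1.filter fun x => x.j = c)
    (fun x => x.i < c)
  rw [Finset.filter_filter, Finset.filter_filter] at h1
  have h2 : (A.1.filter fun x => x.j = c ∧ ¬ x.i < c) = A.1.filter fun x => x.j = c ∧ x.i = c :=
    Finset.filter_congr fun x _ => by have := x.le_j; omega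
  rw [h2] at h1
  rw [midLeft, Finset.card_image_of_injOn, centre, mid]
  · exact h1
  · intro x hx y hy hxy
    simp only [Finset.coe_filter, Set.mem_ofPred_eq] at hx hy
    exact h x hx.1 y hy.1 hx.2.1 hy.2.1 hxy

theorem mid_rvac_le_one {A : Antichains (Cell c two)} (h : Line A c) : mid (rvac A) ≤ 1 := by
  rw [mid, Finset.card_le_one]
  intro x hx y hy
  rw [Finset.mem_filter] at hx hy
  exact eq_of_mem_rvac_of_line hx.1 hy.1 hx.2 hy.2 h

/-! ### The single case -/

theorem s_eq_false' (x : Cell c false) : x.s = false := by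
  by_contra h
  simpa using (x.sign (by simpa using h)).2

theorem mid_le_one (A : Antichains (Cell c false)) : mid A ≤ 1 := by
  rw [mid, Finset.card_le_one]
  intro x hx y hy
  rw [Finset.mem_filter] at hx hy
  exact eq_of_mem_of_j_eq hx.1 hy.1 (hx.2.trans hy.2.symm)
    fun _ _ => by rw [s_eq_false', s_eq_false']

theorem mid_add_mid_rvac (hc : 1 ≤ c) (A : Antichains (Cell c false)) :
    mid A + mid (rvac A) = 1 := by
  have h1 := mid_le_one A
  have h2 := mid_le_one (rvac A)
  by_cases hl : Line A c
  · have h3 : 0 < mid A := by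
      rw [mid_pos_iff]
      rcases exists_mid_of_line hl with ⟨x, hx, -, hxj⟩ | h
      · exact ⟨x, hx, hxj⟩
      · obtain ⟨x, hx, hxj, -⟩ := h false (by simp)
        exact ⟨x, hx, hxj⟩
    have h4 : ¬ 0 < mid (rvac A) := by
      rw [mid_pos_iff]
      rintro ⟨x, hx, hxj⟩
      exact absurd (eq_sign_of_line hx hxj hl).1 (by simp)
    omega
  · have h3 : 0 < mid (rvac A) := by
      rw [mid_pos_iff]
      obtain ⟨x, hx, hxj, -⟩ := exists_mem_rvac_of_not_line (σ := false) hc le_rfl (by simp) hl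
      exact ⟨x, hx, hxj⟩
    have h4 : ¬ 0 < mid A := by
      rw [mid_pos_iff]
      rintro ⟨x, hx, hxj⟩
      refine hl (line_of_mem_mid hx hxj fun y hyi hyj => ?_)
      rw [Cell.ext (x := y) (y := x) hyi (by omega) (by rw [s_eq_false', s_eq_false'])]
      exact below_of_mem hx
    omega

/-- Exactly one of `A` and `rvac A` has an interval ending at the centre. Parity in `lo_add_lo_rvac`
then makes exactly one of the two have a symmetric interval: either that interval is the centre
itself, or `midLeft` is odd and so is the total of `symUp`. The cardinalities follow linearly. -/
theorem card_single (hc : 1 ≤ c) (A : Antichains (Cell c false)) :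
    A.1.card + (rvac A).1.card = c ∧
      symUp A + centre A + (symUp (rvac A) + centre (rvac A)) = 1 := by
  have hinj : ∀ B : Antichains (Cell c false), midLeft B + centre B = mid B := fun B =>
    midLeft_add_centre fun x hx y hy hxj hyj hi =>
      Cell.ext hi (hxj.trans hyj.symm) (by rw [s_eq_false', s_eq_false'])
  have h1 := lo_add_lo_rvac A
  have h2 := lo_add_lo_rvac (rvac A)
  rw [rvac_involutive isRanked A] at h2
  have h3 := mid_add_mid_rvac hc A
  have h4 := hinj A
  have h5 := hinj (rvac A)
  have h6 := symUp_le_one A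
  have h7 := symUp_le_one (rvac A)
  have h8 := symUp_le_up A
  have h9 := symUp_le_up (rvac A)
  have h10 := @up_eq_zero_of_centre _ _ A
  have h11 := @up_eq_zero_of_centre _ _ (rvac A)
  rw [card_eq_lo_mid_up, card_eq_lo_mid_up]
  omega

/-! ### The doubled case -/

/-- The automorphism interchanging the two copies of the intervals ending at the centre. -/
def swap : Cell c true ≃o Cell c true where
  toFun x := ⟨x.i, x.j, if x.j = c then !x.s else x.s, x.one_le, x.le_j, x.sum_le, fun h => by
    by_cases hj : x.j = c
    · exact ⟨hj, rfl⟩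
    · rw [if_neg hj] at h
      exact x.sign h⟩
  invFun x := ⟨x.i, x.j, if x.j = c then !x.s else x.s, x.one_le, x.le_j, x.sum_le, fun h => by
    by_cases hj : x.j = c
    · exact ⟨hj, rfl⟩
    · rw [if_neg hj] at h
      exact x.sign h⟩
  left_inv x := by
    ext <;> simp only
    split_ifs <;> simp
  right_inv x := by
    ext <;> simp only
    split_ifs <;> simp
  map_rel_iff' := by
    intro x y
    simp only [le_def, Equiv.coe_fn_mk]
    refine and_congr_right fun _ => and_congr_right fun _ => forall_congr' fun h1 =>
      forall_congr' fun h2 => ?_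
    simp [h1, h2]

theorem swap_i (x : Cell c true) : (swap x).i = x.i := rfl

theorem swap_s {x : Cell c true} (h : x.j = c) : (swap x).s = !x.s := if_pos h

theorem swap_eq_self {x : Cell c true} (h : x.j ≠ c) : swap x = x := ext_of_ne rfl rfl h

/-- Invariance under the automorphism `swap`. -/
def SwapInvariant (A : Antichains (Cell c true)) : Prop := ∀ x, swap x ∈ A.1 ↔ x ∈ A.1

/-- Rowvacuation commutes with poset automorphisms. -/
theorem SwapInvariant.rvac {A : Antichains (Cell c true)} (h : SwapInvariant A) :
    SwapInvariant (rvac A) := fun x =>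
  mem_rvac_orderEmbedding swap.toOrderEmbedding
    (fun _ y _ => ⟨swap.symm y, swap.apply_symm_apply y⟩)
    (fun _ y _ => ⟨swap.symm y, swap.apply_symm_apply y⟩) h x

theorem swapInvariant_rvac_iff {A : Antichains (Cell c true)} :
    SwapInvariant (Rowvacuation.rvac A) ↔ SwapInvariant A := by
  refine ⟨fun h => ?_, SwapInvariant.rvac⟩
  rw [← rvac_involutive isRanked A]
  exact h.rvac

theorem eq_swap_of_ne {x y : Cell c true} (hi : y.i = x.i) (hxj : x.j = c) (hyj : y.j = c)
    (h : y ≠ x) : y = swap x := by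
  refine Cell.ext hi (hyj.trans hxj.symm) ?_
  rw [swap_s hxj]
  have : y.s ≠ x.s := fun hs => h (Cell.ext hi (hyj.trans hxj.symm) hs)
  revert this
  cases x.s <;> cases y.s <;> simp

theorem not_sign_eq {x y z : Cell c true} (h : y.s ≠ x.s) (hz : z.s ≠ x.s) : z.s = y.s := by
  revert h hz
  cases x.s <;> cases y.s <;> cases z.s <;> simp

theorem mid_eq_one {A : Antichains (Cell c true)} {x : Cell c true} (hx : x ∈ A.1) (hxj : x.j = c)
    (h : ∀ y ∈ A.1, y.j = c → y.s = x.s) :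
    (A.1.filter fun y => y.j = c) = {x} := by
  ext y
  simp only [Finset.mem_filter, Finset.mem_singleton]
  constructor
  · rintro ⟨hy, hyj⟩
    exact eq_of_mem_of_j_eq hy hx (hyj.trans hxj.symm) fun _ _ => h y hy hyj
  · rintro rfl
    exact ⟨hx, hxj⟩

theorem mid_eq_two {A : Antichains (Cell c true)} {x y : Cell c true} (hx : x ∈ A.1) (hxj : x.j = c)
    (hy : y ∈ A.1) (hyj : y.j = c) (h : y.s ≠ x.s) :
    (A.1.filter fun y => y.j = c) = {x, y} := by
  ext z
  simp only [Finset.mem_filter, Finset.mem_singleton, Finset.mem_insert]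
  constructor
  · rintro ⟨hz, hzj⟩
    by_cases hs : z.s = x.s
    · exact Or.inl (eq_of_mem_of_j_eq hz hx (hzj.trans hxj.symm) fun _ _ => hs)
    · exact Or.inr (eq_of_mem_of_j_eq hz hy (hzj.trans hyj.symm) fun _ _ => not_sign_eq h hs)
  · rintro (rfl | rfl)
    · exact ⟨hx, hxj⟩
    · exact ⟨hy, hyj⟩

theorem card_mid_eq_two {A : Antichains (Cell c true)} {x y : Cell c true} (hx : x ∈ A.1)
    (hxj : x.j = c) (hy : y ∈ A.1) (hyj : y.j = c) (h : y.s ≠ x.s) : mid A = 2 := by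
  rw [mid, mid_eq_two hx hxj hy hyj h, Finset.card_pair (by rintro rfl; exact h rfl)]

/-- The intervals ending at the centre in a swap invariant antichain. -/
theorem SwapInvariant.mid_cases {A : Antichains (Cell c true)} (h : SwapInvariant A) :
    (mid A = 0 ∧ midLeft A = 0 ∧ centre A = 0 ∨
      mid A = 2 ∧ midLeft A = 1 ∧ centre A = 0 ∨ mid A = 2 ∧ midLeft A = 0 ∧ centre A = 2) ∧
    (Line A c ↔ mid A = 2) := by
  by_cases hex : ∃ x ∈ A.1, x.j = c
  · obtain ⟨x, hx, hxj⟩ := hex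
    have hsx : swap x ∈ A.1 := (h x).2 hx
    have hs : (swap x).s ≠ x.s := by rw [swap_s hxj]; cases x.s <;> simp
    have hmid : mid A = 2 := card_mid_eq_two hx hxj hsx hxj hs
    have hset := mid_eq_two hx hxj hsx hxj hs
    have hline : Line A c := line_of_mem_mid hx hxj fun y hyi hyj => by
      by_cases hyx : y = x
      · rw [hyx]; exact below_of_mem hx
      · rw [eq_swap_of_ne hyi hxj hyj hyx]; exact below_of_mem hsx
    refine ⟨Or.inr ?_, by simp [hline, hmid]⟩
    have hne : x ≠ swap x := by
      intro h'
      exact hs (congrArg Cell.s h').symm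
    have hx2 := x.le_j
    have hml : midLeft A = if x.i < c then 1 else 0 := by
      rw [midLeft, ← Finset.filter_filter, hset, Finset.filter_insert, Finset.filter_singleton,
        swap_i]
      split_ifs <;> simp [swap_i]
    have hce : centre A = if x.i < c then 0 else 2 := by
      rw [centre, ← Finset.filter_filter, hset, Finset.filter_insert, Finset.filter_singleton,
        swap_i]
      by_cases hi : x.i < c
      · rw [if_pos hi, if_neg (by omega), if_neg (by omega)]; simp
      · rw [if_neg hi, if_pos (by omega), if_pos (by omega), Finset.card_pair hne]
    rw [hml, hce, hmid]
    split_ifs <;> simp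
  · have hmid : mid A = 0 := by
      by_contra h0
      exact hex (mid_pos_iff.1 (by omega))
    refine ⟨Or.inl ⟨hmid, ?_, ?_⟩, ?_⟩
    · rw [midLeft, Finset.card_eq_zero, Finset.image_eq_empty, Finset.filter_eq_empty_iff]
      exact fun x hx hxj => hex ⟨x, hx, hxj.1⟩
    · rw [centre, Finset.card_eq_zero, Finset.filter_eq_empty_iff]
      exact fun x hx hxj => hex ⟨x, hx, hxj.1⟩
    · refine iff_of_false (fun hl => ?_) (by omega)
      rcases exists_mid_of_line hl with ⟨x, hx, -, hxj⟩ | h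
      · exact hex ⟨x, hx, hxj⟩
      · obtain ⟨x, hx, hxj, -⟩ := h false (by simp)
        exact hex ⟨x, hx, hxj⟩

/-- The intervals ending at the centre in an antichain that is not swap invariant. -/
theorem mid_cases_of_not_swapInvariant {A : Antichains (Cell c true)} (h : ¬ SwapInvariant A) :
    midLeft A + centre A = mid A ∧ centre A ≤ 1 ∧ 1 ≤ mid A ∧ mid A ≤ 2 ∧
      (Line A c ↔ mid A = 2 ∨ centre A = 1) := by
  have hex : ∃ x ∈ A.1, x.j = c ∧ swap x ∉ A.1 := by
    by_contra hcon
    push Not at hcon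
    refine h fun x => ?_
    by_cases hxj : x.j = c
    · refine ⟨fun hx => ?_, fun hx => hcon x hx hxj⟩
      have := hcon _ hx hxj
      rwa [show swap (swap x) = x from swap.left_inv x] at this
    · rw [swap_eq_self hxj]
  obtain ⟨x, hx, hxj, hsx⟩ := hex
  have hx2 := x.le_j
  -- Two intervals ending at the centre with equal left ends would be exchanged by `swap`. Each copy
  -- has at most one such interval in `A`, so one of the two would be `x`, and then `swap x` would
  -- be in `A`.
  have hinj : ∀ y ∈ A.1, ∀ z ∈ A.1, y.j = c → z.j = c → y.i = z.i → y = z := by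
    intro y hy z hz hyj hzj hi
    by_contra hne
    have hyz := eq_swap_of_ne hi hzj hyj hne
    have hsy : swap z ∈ A.1 := hyz ▸ hy
    by_cases hs : z.s = x.s
    · rw [eq_of_mem_of_j_eq hz hx (hzj.trans hxj.symm) fun _ _ => hs] at hsy
      exact hsx hsy
    · have hs' : (swap z).s = x.s := by
        rw [swap_s hzj]
        revert hs
        cases z.s <;> cases x.s <;> simp
      have := eq_of_mem_of_j_eq hsy hx (hzj.trans hxj.symm) fun _ _ => hs'
      apply hsx
      rw [← this, show swap (swap z) = z from swap.left_inv z]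
      exact hz
  refine ⟨midLeft_add_centre hinj, ?_, mid_pos_iff.2 ⟨x, hx, hxj⟩, ?_⟩
  · rw [centre, Finset.card_le_one]
    intro y hy z hz
    rw [Finset.mem_filter] at hy hz
    exact hinj y hy.1 z hz.1 hy.2.1 hz.2.1 (hy.2.2.trans hz.2.2.symm)
  · by_cases hy : ∃ y ∈ A.1, y.j = c ∧ y.s ≠ x.s
    · obtain ⟨y, hy, hyj, hys⟩ := hy
      have hmid := card_mid_eq_two hx hxj hy hyj hys
      refine ⟨hmid.le, iff_of_true ?_ (Or.inl hmid)⟩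
      -- With both copies present, the shorter interval `z` serves: the same interval in the other
      -- copy lies below the longer member `w`.
      have key : ∀ z ∈ A.1, z.j = c → ∀ w ∈ A.1, w.j = c → w.s ≠ z.s → w.i ≤ z.i → Line A c := by
        intro z hz hzj w hw hwj hwz hi
        refine line_of_mem_mid hz hzj fun v hvi hvj => ?_
        by_cases hvs : v.s = z.s
        · rw [Cell.ext (x := v) (y := z) hvi (hvj.trans hzj.symm) hvs]
          exact below_of_mem hz
        · exact ⟨w, hw, by
            rw [le_def]
            exact ⟨by omega, by omega, fun _ _ => not_sign_eq hwz hvs⟩⟩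
      rcases le_total x.i y.i with hi | hi
      · exact key y hy hyj x hx hxj hys.symm hi
      · exact key x hx hxj y hy hyj hys hi
    · push Not at hy
      have hset := mid_eq_one hx hxj hy
      have hmid : mid A = 1 := by rw [mid, hset]; simp
      refine ⟨by omega, ?_⟩
      constructor
      · intro hl
        right
        rcases exists_mid_of_line hl with ⟨z, hz, hzi, hzj⟩ | h
        · rw [centre, Finset.card_eq_one]
          refine ⟨z, ?_⟩
          ext w
          simp only [Finset.mem_filter, Finset.mem_singleton]
          constructor
          · rintro ⟨hw, hwj, hwi⟩
            exact hinj w hw z hz hwj hzj (hwi.trans hzi.symm)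
          · rintro rfl
            exact ⟨hz, hzj, hzi⟩
        · obtain ⟨z, hz, hzj, hzs⟩ := h (!x.s) (by simp)
          have := hy z hz hzj
          rw [hzs] at this
          simp at this
      · rintro (h | h)
        · omega
        · obtain ⟨z, hz⟩ := Finset.card_pos.1 (by rw [centre] at h; omega :
            0 < (A.1.filter fun x => x.j = c ∧ x.i = c).card)
          rw [Finset.mem_filter] at hz
          exact Or.inl ⟨z, hz.1, hz.2.2⟩

theorem mid_rvac_of_not_line (hc : 1 ≤ c) {A : Antichains (Cell c true)} (h : ¬ Line A c) :
    mid (rvac A) = 2 := by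
  obtain ⟨x, hx, hxj, hxs⟩ := exists_mem_rvac_of_not_line (σ := false) hc le_rfl (by simp) h
  obtain ⟨y, hy, hyj, hys⟩ := exists_mem_rvac_of_not_line (σ := true) hc le_rfl (by simp) h
  exact card_mid_eq_two hx hxj hy hyj (by rw [hxs, hys]; simp)

/-- Swap invariance is shared by `A` and `rvac A`, so each case can use the same description of the
centre on both sides. A line at `c` bounds `mid (rvac A)` by 1, and its absence makes it 2; the rest
is the parity of `lo_add_lo_rvac`. -/
theorem card_double (hc : 1 ≤ c) (A : Antichains (Cell c true)) :
    A.1.card + (rvac A).1.card = c + 1 := by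
  have h1 := lo_add_lo_rvac A
  have h2 := lo_add_lo_rvac (rvac A)
  rw [rvac_involutive isRanked A] at h2
  have h3 := @mid_rvac_le_one _ _ A
  have h4 := @mid_rvac_of_not_line _ hc A
  have h6 := symUp_le_one A
  have h7 := symUp_le_one (rvac A)
  have h8 := symUp_le_up A
  have h9 := symUp_le_up (rvac A)
  have h10 := @up_eq_zero_of_centre _ _ A
  have h11 := @up_eq_zero_of_centre _ _ (rvac A)
  rw [card_eq_lo_mid_up, card_eq_lo_mid_up]
  by_cases hA : SwapInvariant A
  · obtain ⟨h12, h13⟩ := hA.mid_cases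
    obtain ⟨h14, -⟩ := hA.rvac.mid_cases
    by_cases hl : Line A c
    · have := h3 hl
      have := h13.1 hl
      omega
    · have := h4 hl
      have : mid A ≠ 2 := fun h => hl (h13.2 h)
      omega
  · obtain ⟨h12, h13, h14, h15, h16⟩ := mid_cases_of_not_swapInvariant hA
    obtain ⟨h17, h18, h19, h20, h21⟩ := mid_cases_of_not_swapInvariant
      (mt swapInvariant_rvac_iff.1 hA)
    have h22 := @mid_rvac_le_one _ _ (rvac A)
    have h23 := @mid_rvac_of_not_line _ hc (rvac A)
    rw [rvac_involutive isRanked A] at h22 h23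
    by_cases hl : Line A c
    · have := h3 hl
      have := h16.1 hl
      by_cases hl' : Line (rvac A) c
      · have := h22 hl'
        have := h21.1 hl'
        omega
      · have := h23 hl'
        have : ¬ (mid (rvac A) = 2 ∨ centre (rvac A) = 1) := fun h => hl' (h21.2 h)
        omega
    · have := h4 hl
      have : ¬ (mid A = 2 ∨ centre A = 1) := fun h => hl (h16.2 h)
      omega

end Cell

/-! ### Coefficients and heights of positive roots -/

section Cone

variable {ι M N : Type*} [AddCommGroup M] [Module ℝ M] [AddCommGroup N] [Module ℝ N]
  {P : RootPairing ι ℝ M N} [P.IsRootSystem] {b : P.Base}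

theorem mem_simpleCone_iff {J : Finset b.support} {x : M} :
    x ∈ simpleCone b J ↔
      ∃ f : b.support → ℕ, (∀ i ∉ J, f i = 0) ∧ ∀ i, b.toWeightBasis.repr x i = f i := by
  constructor
  · intro hx
    induction hx using AddSubmonoid.closure_induction with
    | mem y hy =>
      obtain ⟨i, hi, rfl⟩ := hy
      refine ⟨Pi.single i 1, fun j hj => ?_, fun j => ?_⟩
      · rw [Pi.single_eq_of_ne]
        rintro rfl
        exact hj hi
      · simp only [RootPairing.Base.toWeightBasis_repr_root, Finsupp.single_apply, Pi.single_apply,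
          eq_comm (a := i)]
        split_ifs <;> simp
    | zero => exact ⟨0, by simp, by simp⟩
    | add y z _ _ hy hz =>
      obtain ⟨f, hf, hf'⟩ := hy
      obtain ⟨g, hg, hg'⟩ := hz
      exact ⟨f + g, fun i hi => by simp [hf i hi, hg i hi], fun i => by simp [hf' i, hg' i]⟩
  · rintro ⟨f, hf, hf'⟩
    rw [← b.toWeightBasis.sum_repr x]
    refine sum_mem fun i _ => ?_
    rw [hf' i, Nat.cast_smul_eq_nsmul, RootPairing.Base.toWeightBasis_apply]
    by_cases hi : i ∈ J
    · exact nsmul_mem (AddSubmonoid.subset_closure (Set.mem_image_of_mem _ hi)) _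
    · simp [hf i hi]

theorem simpleCone_mono {J J' : Finset b.support} (h : J' ⊆ J) :
    simpleCone b J' ≤ simpleCone b J :=
  AddSubmonoid.closure_mono (Set.image_mono (by simpa using h))

theorem simple_mem_simpleCone {J : Finset b.support} {i : b.support} (hi : i ∈ J) :
    P.root i ∈ simpleCone b J :=
  AddSubmonoid.subset_closure ⟨i, hi, rfl⟩

theorem mem_simpleCone_univ_or_neg_mem (i : ι) :
    P.root i ∈ simpleCone b Finset.univ ∨ -P.root i ∈ simpleCone b Finset.univ := by
  have : ((fun i : b.support => P.root i) '' ((Finset.univ : Finset b.support) : Set b.support)) =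
      P.root '' b.support := by
    ext y
    simp
  simpa only [simpleCone, this] using b.root_mem_or_neg_mem i

/-- The coefficients of a positive root with respect to the simple roots. -/
def coeff (b : P.Base) (k : ι) (i : b.support) : ℕ := ⌊b.toWeightBasis.repr (P.root k) i⌋₊

theorem repr_root {J : Finset b.support} {k : ι} (hk : P.root k ∈ simpleCone b J)
    (i : b.support) : b.toWeightBasis.repr (P.root k) i = coeff b k i := by
  obtain ⟨f, -, hf⟩ := mem_simpleCone_iff.1 hk
  simp [coeff, hf]

theorem coeff_eq_zero {J : Finset b.support} {k : ι} (hk : P.root k ∈ simpleCone b J)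
    {i : b.support} (hi : i ∉ J) : coeff b k i = 0 := by
  obtain ⟨f, hf, hf'⟩ := mem_simpleCone_iff.1 hk
  simp [coeff, hf', hf i hi]

theorem mem_simpleCone_of_coeff {J J' : Finset b.support} {k : ι}
    (hk : P.root k ∈ simpleCone b J) (h : ∀ i ∉ J', coeff b k i = 0) :
    P.root k ∈ simpleCone b J' :=
  mem_simpleCone_iff.2 ⟨coeff b k, h, repr_root hk⟩

theorem coeff_simple (i j : b.support) : coeff b i j = if i = j then 1 else 0 := by
  simp only [coeff, RootPairing.Base.toWeightBasis_repr_root, Finsupp.single_apply]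
  split_ifs <;> simp

theorem sub_mem_simpleCone_iff {J : Finset b.support} {k m : ι}
    (hk : P.root k ∈ simpleCone b J) (hm : P.root m ∈ simpleCone b J) :
    P.root m - P.root k ∈ simpleCone b J ↔ ∀ i, coeff b k i ≤ coeff b m i := by
  rw [mem_simpleCone_iff]
  constructor
  · rintro ⟨f, -, hf⟩ i
    have := hf i
    rw [map_sub, Finsupp.sub_apply, repr_root hk, repr_root hm] at this
    have : (coeff b m i : ℝ) = f i + coeff b k i := by linarith
    have : coeff b m i = f i + coeff b k i := by exact_mod_cast this
    omega
  · intro h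
    refine ⟨fun i => coeff b m i - coeff b k i, fun i hi => ?_, fun i => ?_⟩
    · simp [coeff_eq_zero hm hi]
    · rw [map_sub, Finsupp.sub_apply, repr_root hk, repr_root hm, Nat.cast_sub (h i)]

theorem PosRoot.le_iff {J : Finset b.support} {x y : PosRoot b J} :
    x ≤ y ↔ ∀ i, coeff b x.1 i ≤ coeff b y.1 i :=
  sub_mem_simpleCone_iff x.2 y.2

/-- The element of the root poset given by a positive root. -/
def PosRoot.of {J : Finset b.support} (k : ι) (hk : P.root k ∈ simpleCone b J) : PosRoot b J :=
  ⟨k, hk⟩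

/-- The height of a positive root. -/
def height (b : P.Base) (k : ι) : ℕ := ∑ i, coeff b k i

theorem height_simple (i : b.support) : height b i = 1 := by
  simp [height, coeff_simple]

theorem coeff_add {J : Finset b.support} {k m : ι} {i : b.support}
    (hk : P.root k ∈ simpleCone b J) (hm : P.root m ∈ simpleCone b J)
    (h : P.root m = P.root k + P.root i) (j : b.support) :
    coeff b m j = coeff b k j + if i = j then 1 else 0 := by
  have := congrArg (fun x => b.toWeightBasis.repr x j) h
  simp only [map_add, Finsupp.add_apply, repr_root hk, repr_root hm,
    RootPairing.Base.toWeightBasis_repr_root, Finsupp.single_apply] at this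
  split_ifs with hij <;> simp only [hij, if_true, if_false] at this <;> exact_mod_cast this

theorem height_add {J : Finset b.support} {k m : ι} {i : b.support}
    (hk : P.root k ∈ simpleCone b J) (hm : P.root m ∈ simpleCone b J)
    (h : P.root m = P.root k + P.root i) : height b m = height b k + 1 := by
  simp [height, coeff_add hk hm h, Finset.sum_add_distrib]

/-- Subtracting a simple root from another positive root yields a positive root, if it yields a
root. -/
theorem mem_simpleCone_of_eq_add {J : Finset b.support} {k m : ι} {i : b.support} (hi : i ∈ J)
    (hm : P.root m ∈ simpleCone b J) (hne : m ≠ i) (h : P.root m = P.root k + P.root i) :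
    P.root k ∈ simpleCone b J := by
  have hrep : ∀ j, b.toWeightBasis.repr (P.root k) j =
      coeff b m j - if i = j then (1 : ℝ) else 0 := fun j => by
    rw [← repr_root hm, h]
    simp [Finsupp.single_apply]
  rcases mem_simpleCone_univ_or_neg_mem (b := b) k with hk | hk
  · refine mem_simpleCone_of_coeff hk fun j hj => ?_
    have h1 := hrep j
    have hij : i ≠ j := fun h => hj (h ▸ hi)
    rw [repr_root hk, coeff_eq_zero hm hj, if_neg hij] at h1
    simpa using h1
  · exfalso
    obtain ⟨f, -, hf⟩ := mem_simpleCone_iff.1 hk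
    have h1 : ∀ j, i ≠ j → coeff b m j = 0 := fun j hj => by
      have h1 := hrep j
      have h2 := hf j
      rw [map_neg, Finsupp.neg_apply, h1, if_neg hj] at h2
      have : ((coeff b m j + f j : ℕ) : ℝ) = 0 := by push_cast; linarith
      have : coeff b m j + f j = 0 := by exact_mod_cast this
      omega
    have h2 : coeff b m i ≤ 1 := by
      have h2 := hf i
      rw [map_neg, Finsupp.neg_apply, hrep i, if_pos rfl] at h2
      have : ((coeff b m i + f i : ℕ) : ℝ) = 1 := by push_cast; linarith
      have : coeff b m i + f i = 1 := by exact_mod_cast this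
      omega
    have hroot : P.root m = coeff b m i • P.root i := by
      rw [← b.toWeightBasis.sum_repr (P.root m), Finset.sum_eq_single i]
      · rw [repr_root hm, RootPairing.Base.toWeightBasis_apply, Nat.cast_smul_eq_nsmul]
      · intro j _ hj
        rw [repr_root hm, h1 j hj.symm]
        simp
      · simp
    rcases Nat.le_one_iff_eq_zero_or_eq_one.1 h2 with h0 | h0
    · rw [h0, zero_smul] at hroot
      exact P.ne_zero m hroot
    · rw [h0, one_smul] at hroot
      exact hne (P.root.injective hroot)

end Cone

/-! ### Root posets are ranked by height -/

section Ranked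

variable {ι M N : Type*} [Fintype ι] [AddCommGroup M] [Module ℝ M] [AddCommGroup N] [Module ℝ N]
  {P : RootPairing ι ℝ M N} [P.IsRootSystem] [P.IsCrystallographic] {b : P.Base}

/-- Expanding the positive number `(x, x)` in the simple roots, some summand is positive. -/
theorem exists_rootForm_pos {J : Finset b.support} {x : M} (hx : x ∈ simpleCone b J)
    (h0 : x ≠ 0) : ∃ i ∈ J, 0 < b.toWeightBasis.repr x i ∧ 0 < P.RootForm x (P.root i) := by
  obtain ⟨f, hf, hf'⟩ := mem_simpleCone_iff.1 hx
  have hpos : 0 < P.RootForm x x := P.rootForm_pos_of_ne_zero (by simp) h0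
  have hsum : P.RootForm x x = ∑ i, (f i : ℝ) * P.RootForm x (P.root i) := by
    conv_lhs => rw [← b.toWeightBasis.sum_repr x]
    rw [b.toWeightBasis.sum_repr x]
    nth_rewrite 2 [← b.toWeightBasis.sum_repr x]
    simp [hf']
  rw [hsum] at hpos
  obtain ⟨i, -, hi⟩ := Finset.exists_lt_of_sum_lt (f := fun _ => (0 : ℝ)) (by simpa using hpos)
  have hfi : f i ≠ 0 := by
    intro h
    simp [h] at hi
  refine ⟨i, by_contra fun h => hfi (hf i h), ?_, ?_⟩
  · rw [hf']
    exact_mod_cast Nat.pos_of_ne_zero hfi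
  · exact pos_of_mul_pos_right hi (by positivity)

theorem rootForm_root_pos (i : ι) : 0 < P.RootForm (P.root i) (P.root i) :=
  P.rootForm_pos_of_ne_zero (by simp) (P.ne_zero i)

theorem two_mul_rootForm (i j : ι) : 2 * P.RootForm (P.root i) (P.root j) =
    P.pairingIn ℤ i j * P.RootForm (P.root j) (P.root j) := by
  have h := P.toInvariantForm.two_mul_apply_root_root i j
  rw [← P.algebraMap_pairingIn ℤ i j] at h
  exact h

theorem pairingIn_pos_of_rootForm_pos {i j : ι} (h : 0 < P.RootForm (P.root i) (P.root j)) :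
    0 < P.pairingIn ℤ i j := by
  have h1 := two_mul_rootForm (P := P) i j
  have h2 := rootForm_root_pos (P := P) j
  have h3 : (0 : ℝ) < P.pairingIn ℤ i j * P.RootForm (P.root j) (P.root j) := by linarith
  have := pos_of_mul_pos_left h3 h2.le
  exact_mod_cast this

theorem pairingIn_neg_of_rootForm_neg {i j : ι} (h : P.RootForm (P.root i) (P.root j) < 0) :
    P.pairingIn ℤ i j < 0 := by
  have h1 := two_mul_rootForm (P := P) i j
  have h2 := rootForm_root_pos (P := P) j
  by_contra! hc
  have : (0 : ℝ) ≤ P.pairingIn ℤ i j * P.RootForm (P.root j) (P.root j) :=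
    mul_nonneg (by exact_mod_cast hc) h2.le
  linarith

theorem exists_eq_add_of_rootForm_pos {J : Finset b.support} {m : ι} {i : b.support} (hi : i ∈ J)
    (hm : P.root m ∈ simpleCone b J) (hne : m ≠ i) (h : 0 < P.RootForm (P.root m) (P.root i)) :
    ∃ k, P.root k ∈ simpleCone b J ∧ P.root m = P.root k + P.root i := by
  obtain ⟨k, hk⟩ := P.root_sub_root_mem_of_pairingIn_pos (pairingIn_pos_of_rootForm_pos h) hne
  have : P.root m = P.root k + P.root i := by rw [hk]; abel
  exact ⟨k, mem_simpleCone_of_eq_add hi hm hne this, this⟩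

/-- Every positive root is simple or the sum of a positive root and a simple root. -/
theorem exists_eq_simple_or_eq_add {J : Finset b.support} {m : ι}
    (hm : P.root m ∈ simpleCone b J) :
    (∃ i ∈ J, m = (i : b.support)) ∨
      ∃ k, ∃ i ∈ J, P.root k ∈ simpleCone b J ∧ P.root m = P.root k + P.root (i : b.support) := by
  obtain ⟨i, hi, -, h⟩ := exists_rootForm_pos hm (P.ne_zero m)
  by_cases hne : m = i
  · exact Or.inl ⟨i, hi, hne⟩
  · obtain ⟨k, hk, h⟩ := exists_eq_add_of_rootForm_pos hi hm hne h
    exact Or.inr ⟨k, i, hi, hk, h⟩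

theorem height_pos {J : Finset b.support} {m : ι} (hm : P.root m ∈ simpleCone b J) :
    0 < height b m := by
  rcases exists_eq_simple_or_eq_add hm with ⟨i, -, rfl⟩ | ⟨k, i, -, hk, h⟩
  · simp [height_simple]
  · simp [height_add hk hm h]

/-- Induction on positive roots, adding one simple root at a time. -/
theorem posRoot_induction {J : Finset b.support} {p : ι → Prop} (h_simple : ∀ i ∈ J, p i)
    (h_add : ∀ k m (i : b.support), i ∈ J → P.root k ∈ simpleCone b J →
      P.root m = P.root k + P.root i → p k → p m) {m : ι} (hm : P.root m ∈ simpleCone b J) :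
    p m := by
  induction hn : height b m using Nat.strong_induction_on generalizing m with
  | _ n ih =>
    rcases exists_eq_simple_or_eq_add hm with ⟨i, hi, rfl⟩ | ⟨k, i, hi, hk, h⟩
    · exact h_simple i hi
    · exact h_add k m i hi hk h (ih _ (by rw [← hn, height_add hk hm h]; omega) hk rfl)

namespace PosRoot

variable {J : Finset b.support}

theorem strictMono_height : StrictMono fun x : PosRoot b J => height b x.1 - 1 := by
  intro x y hxy
  have hx := height_pos x.2
  have : height b x.1 < height b y.1 := by
    refine Finset.sum_lt_sum (fun i _ => le_iff.1 hxy.le i) ?_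
    by_contra! h
    exact hxy.not_ge (le_iff.2 fun i => h i (Finset.mem_univ i))
  change height b x.1 - 1 < height b y.1 - 1
  omega

theorem lt_of_eq_add {x y : PosRoot b J} {i : b.support}
    (h : P.root y.1 = P.root x.1 + P.root i) : x < y := by
  refine lt_of_le_of_ne (le_iff.2 fun j => ?_) ?_
  · rw [coeff_add x.2 y.2 h]
    omega
  · rintro rfl
    exact P.ne_zero i (by simpa using h)

theorem exists_lt_height (x : PosRoot b J) (hx : height b x.1 - 1 ≠ 0) :
    ∃ y < x, height b y.1 - 1 + 1 = height b x.1 - 1 := by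
  rcases exists_eq_simple_or_eq_add x.2 with ⟨i, -, h⟩ | ⟨k, i, -, hk, h⟩
  · rw [h, height_simple] at hx
    simp at hx
  · refine ⟨.of k hk, lt_of_eq_add h, ?_⟩
    have h1 := height_pos hk
    have h2 := height_add hk x.2 h
    change height b k - 1 + 1 = _
    omega

/-- Some simple root in the support of `y - x` has positive product with `y - x`, hence negative
product with `x` or positive product with `y`. So it can be added to `x` or subtracted from `y`,
giving a root in the interval between them, and the covering relation identifies it with an end. -/
theorem height_of_covBy {x y : PosRoot b J} (h : x ⋖ y) :
    height b y.1 - 1 = height b x.1 - 1 + 1 := by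
  have hx := height_pos x.2
  have hle : P.root y.1 - P.root x.1 ∈ simpleCone b J := h.le
  have h0 : P.root y.1 - P.root x.1 ≠ 0 := fun h0 =>
    h.ne (Subtype.ext (P.root.injective (sub_eq_zero.1 h0).symm))
  obtain ⟨i, hi, hpos, hform⟩ := exists_rootForm_pos hle h0
  have hlt : coeff b x.1 i < coeff b y.1 i := by
    rw [map_sub, Finsupp.sub_apply, repr_root x.2, repr_root y.2] at hpos
    exact_mod_cast sub_pos.1 hpos
  have hcle := le_iff.1 h.le
  rw [map_sub, LinearMap.sub_apply, sub_pos] at hform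
  rcases le_or_gt (P.RootForm (P.root y.1) (P.root i)) 0 with hy | hy
  · have hneg := pairingIn_neg_of_rootForm_neg (hform.trans_le hy)
    have hne : P.root x.1 ≠ -P.root i := fun hc => by
      have h1 := simpleCone_eq_zero b J x.2 (by rw [hc, neg_neg]; exact simple_mem_simpleCone hi)
      exact P.ne_zero _ h1
    obtain ⟨m, hm⟩ := P.root_add_root_mem_of_pairingIn_neg hneg hne
    have hmem : P.root m ∈ simpleCone b J := by
      rw [hm]
      exact add_mem x.2 (simple_mem_simpleCone hi)
    have hm' : PosRoot.of m hmem ≤ y := le_iff.2 fun j => by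
      change coeff b m j ≤ _
      rw [coeff_add x.2 hmem hm]
      have := hcle j
      split_ifs with hij
      · subst hij; omega
      · omega
    rcases hm'.eq_or_lt with he | he
    · have := height_add x.2 hmem hm
      rw [← he]
      change height b m - 1 = _
      omega
    · exact absurd he (h.2 (lt_of_eq_add (y := .of m hmem) hm))
  · have hne : y.1 ≠ i := by
      intro hc
      have h1 : ∀ j, coeff b x.1 j = 0 := fun j => by
        have h1 := hcle j
        have h2 := hlt
        rw [hc, coeff_simple] at h1 h2
        split_ifs at h1 with hij
        · subst hij
          simp at h2
          exact h2
        · omega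
      simp [height, h1] at hx
    obtain ⟨k, hk, hk'⟩ := exists_eq_add_of_rootForm_pos hi y.2 hne hy
    have hm' : x ≤ PosRoot.of k hk := le_iff.2 fun j => by
      have := hcle j
      have h2 := coeff_add hk y.2 hk' j
      change _ ≤ coeff b k j
      split_ifs at h2 with hij
      · subst hij; omega
      · omega
    rcases hm'.eq_or_lt with he | he
    · have := height_add hk y.2 hk'
      rw [he]
      change _ = height b k - 1 + 1
      have := height_pos hk
      omega
    · exact absurd (lt_of_eq_add (x := .of k hk) hk') (h.2 he)

theorem isRanked : IsRanked (PosRoot b J) :=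
  isRanked_of_strictMono strictMono_height exists_lt_height fun _ _ => height_of_covBy

end PosRoot

end Ranked

/-! ### Pulling antichains back and pushing them forward -/

section Antichain

variable {Q Q' : Type*} [PartialOrder Q'] [PartialOrder Q]

/-- The preimage of an antichain under an order embedding. -/
def Antichains.comap [Fintype Q'] (f : Q' ↪o Q) (A : Antichains Q) : Antichains Q' :=
  ⟨Finset.univ.filter fun x => f x ∈ A.1, fun x hx y hy hne hle => A.2 (by simpa using hx)
    (by simpa using hy) (f.injective.ne hne) (f.le_iff_le.2 hle)⟩

theorem Antichains.mem_comap [Fintype Q'] (f : Q' ↪o Q) (A : Antichains Q) (x : Q') :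
    f x ∈ A.1 ↔ x ∈ (comap f A).1 := by
  simp [comap]

/-- The image of an antichain under an order embedding. -/
def Antichains.map (f : Q' ↪o Q) (A : Antichains Q') : Antichains Q :=
  ⟨A.1.map f.toEmbedding, by
    rintro _ hx _ hy hne hle
    obtain ⟨x, hx', rfl⟩ := Finset.mem_map.1 hx
    obtain ⟨y, hy', rfl⟩ := Finset.mem_map.1 hy
    exact A.2 hx' hy' (fun h => hne (by rw [h])) (f.le_iff_le.1 hle)⟩

theorem Antichains.mem_map (f : Q' ↪o Q) (A : Antichains Q') (y : Q) :
    y ∈ (map f A).1 ↔ ∃ x ∈ A.1, f x = y := by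
  simp [map]

end Antichain

/-! ### Orthogonal unions and maximal parabolic subsystems -/

section Parabolic

variable {ι M N : Type*} [Fintype ι] [AddCommGroup M] [Module ℝ M] [AddCommGroup N] [Module ℝ N]
  {P : RootPairing ι ℝ M N} [P.IsRootSystem] [P.IsCrystallographic] {b : P.Base}

theorem NN.mem_roots {J : Finset b.support} {A : NN b J} {i : ι} :
    i ∈ NN.roots A ↔ ∃ x ∈ A.1, x.1 = i := by
  exact Finset.mem_map

theorem NN.val_mem_roots {J : Finset b.support} {A : NN b J} {x : PosRoot b J} :
    x.1 ∈ NN.roots A ↔ x ∈ A.1 := by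
  rw [NN.mem_roots]
  constructor
  · rintro ⟨y, hy, h⟩
    rwa [← Subtype.ext h]
  · exact fun h => ⟨x, h, rfl⟩

/-- The inclusion of the root poset of a parabolic subsystem. -/
def PosRoot.incl {J J' : Finset b.support} (h : J' ⊆ J) : PosRoot b J' ↪o PosRoot b J where
  toFun x := .of x.1 (simpleCone_mono h x.2)
  inj' x y hxy := Subtype.ext (congrArg (fun z : PosRoot b J => z.1) hxy)
  map_rel_iff' {x y} := by
    rw [PosRoot.le_iff, PosRoot.le_iff]
    rfl

theorem PosRoot.val_incl {J J' : Finset b.support} (h : J' ⊆ J) (x : PosRoot b J') :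
    (PosRoot.incl h x).1 = x.1 := rfl

theorem PosRoot.exists_incl_eq_iff {J J' : Finset b.support} (h : J' ⊆ J) (y : PosRoot b J) :
    (∃ x, PosRoot.incl h x = y) ↔ P.root y.1 ∈ simpleCone b J' := by
  constructor
  · rintro ⟨x, rfl⟩
    exact x.2
  · exact fun hy => ⟨.of y.1 hy, rfl⟩

theorem PosRoot.exists_incl_eq_of_le {J J' : Finset b.support} (h : J' ⊆ J) (x : PosRoot b J')
    (y : PosRoot b J) (hyx : y ≤ PosRoot.incl h x) : ∃ z, PosRoot.incl h z = y := by
  rw [PosRoot.exists_incl_eq_iff]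
  refine mem_simpleCone_of_coeff y.2 fun i hi => ?_
  have h1 := PosRoot.le_iff.1 hyx i
  rw [PosRoot.val_incl, coeff_eq_zero x.2 hi] at h1
  omega

theorem rootForm_eq_zero_of_mem {J : Finset b.support} {i : b.support}
    (h : ∀ j ∈ J, P.pairing j i = 0) {x : M} (hx : x ∈ simpleCone b J) :
    P.RootForm x (P.root i) = 0 := by
  induction hx using AddSubmonoid.closure_induction with
  | mem y hy =>
    obtain ⟨j, hj, rfl⟩ := hy
    exact (P.toInvariantForm.apply_root_root_zero_iff j i).2 (h j hj)
  | zero => simp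
  | add y z _ _ hy hz => rw [map_add, LinearMap.add_apply, hy, hz, add_zero]

/-- The sum of a positive root and a simple root orthogonal to its support is not a root. -/
theorem root_ne_add_of_orthogonal {J : Finset b.support} {k m : ι} {i : b.support}
    (hk : P.root k ∈ simpleCone b J) (hi : i ∉ J) (h : ∀ j ∈ J, P.pairing j i = 0) :
    P.root m ≠ P.root k + P.root i := by
  intro hm
  have hform : P.RootForm (P.root m) (P.root i) = P.RootForm (P.root i) (P.root i) := by
    rw [hm, map_add, LinearMap.add_apply, rootForm_eq_zero_of_mem h hk, zero_add]
  have hpair : P.pairing m i = 2 := by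
    have h1 := P.toInvariantForm.two_mul_apply_root_root m i
    change 2 * P.RootForm _ _ = _ * P.RootForm _ _ at h1
    rw [hform] at h1
    exact (mul_right_cancel₀ (rootForm_root_pos (P := P) (i : ι)).ne' h1).symm
  -- The reflection of the supposed sum is `k` minus the simple root, whose coefficients have both
  -- signs.
  have hq : P.root (P.reflectionPerm i m) = P.root k - P.root i := by
    rw [P.root_reflectionPerm, P.reflection_apply_root, hpair, hm, two_smul]
    abel
  have hk' := simpleCone_mono (Finset.subset_univ J) hk
  have hi' : P.root i ∈ simpleCone b Finset.univ := simple_mem_simpleCone (Finset.mem_univ i)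
  rcases mem_simpleCone_univ_or_neg_mem (b := b) (P.reflectionPerm i m) with h1 | h1
  · rw [hq, sub_mem_simpleCone_iff hi' hk'] at h1
    have h2 := h1 i
    rw [coeff_simple, if_pos rfl, coeff_eq_zero hk hi] at h2
    omega
  · rw [hq, neg_sub, sub_mem_simpleCone_iff hk' hi'] at h1
    have h2 := height_pos hk
    have h3 : ∀ j, coeff b k j = 0 := fun j => by
      by_cases hj : j = i
      · rw [hj, coeff_eq_zero hk hi]
      · have := h1 j
        rw [coeff_simple, if_neg (Ne.symm hj)] at this
        omega
    simp [height, h3] at h2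

/-- A positive root is supported in one of two orthogonal sets of simple roots. -/
theorem mem_simpleCone_or_mem_of_orthogonal {J J' J'' : Finset b.support}
    (hd : Disjoint J' J'') (hJ : J' ∪ J'' = J) (h : ∀ i ∈ J', ∀ j ∈ J'', P.pairing i j = 0)
    {k : ι} (hk : P.root k ∈ simpleCone b J) :
    P.root k ∈ simpleCone b J' ∨ P.root k ∈ simpleCone b J'' := by
  refine posRoot_induction (b := b) (J := J)
    (p := fun k => P.root k ∈ simpleCone b J' ∨ P.root k ∈ simpleCone b J'')
    (fun i hi => ?_) (fun k m i hi hk hm hp => ?_) hk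
  · rw [← hJ, Finset.mem_union] at hi
    exact hi.imp simple_mem_simpleCone simple_mem_simpleCone
  · have h' : ∀ i ∈ J'', ∀ j ∈ J', P.pairing i j = 0 := fun i hi j hj =>
      P.pairing_eq_zero_iff.1 (h j hj i hi)
    have hd' := Finset.disjoint_left.1 hd
    rw [← hJ, Finset.mem_union] at hi
    rcases hp with hp | hp
    · rcases hi with hi | hi
      · exact Or.inl (hm ▸ add_mem hp (simple_mem_simpleCone hi))
      · exact absurd hm (root_ne_add_of_orthogonal hp (fun hc => hd' hc hi) fun j hj => h j hj i hi)
    · rcases hi with hi | hi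
      · exact absurd hm (root_ne_add_of_orthogonal hp (hd' hi) fun j hj => h' j hj i hi)
      · exact Or.inr (hm ▸ add_mem hp (simple_mem_simpleCone hi))

theorem not_mem_simpleCone_of_disjoint {J' J'' : Finset b.support} (hd : Disjoint J' J'') {k : ι}
    (h' : P.root k ∈ simpleCone b J') : P.root k ∉ simpleCone b J'' := by
  intro h''
  have h2 := height_pos h'
  have h3 : ∀ j, coeff b k j = 0 := fun j => by
    by_cases hj : j ∈ J'
    · exact coeff_eq_zero h'' (Finset.disjoint_left.1 hd hj)
    · exact coeff_eq_zero h' hj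
  simp [height, h3] at h2

theorem mem_roots_rvac_of_orthogonal {J J' J'' : Finset b.support} (hd : Disjoint J' J'')
    (hJ : J' ∪ J'' = J) (h : ∀ i ∈ J', ∀ j ∈ J'', P.pairing i j = 0) (A : NN b J)
    (hs : J' ⊆ J) (x : PosRoot b J') :
    PosRoot.incl hs x ∈ (rvac A).1 ↔ x ∈ (rvac (Antichains.comap (PosRoot.incl hs) A)).1 := by
  refine mem_rvac_orderEmbedding _ (PosRoot.exists_incl_eq_of_le hs) (fun x y hxy => ?_)
    (fun x => Antichains.mem_comap _ A x) x
  rw [PosRoot.exists_incl_eq_iff]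
  refine (mem_simpleCone_or_mem_of_orthogonal hd hJ h y.2).resolve_right fun hy => ?_
  refine not_mem_simpleCone_of_disjoint hd x.2 (mem_simpleCone_of_coeff x.2 fun i hi => ?_)
  have h1 := PosRoot.le_iff.1 hxy i
  rw [coeff_eq_zero hy hi] at h1
  exact Nat.le_zero.1 h1

theorem mem_roots_comap {J J' : Finset b.support} (hs : J' ⊆ J) (A : NN b J) (i : ι) :
    i ∈ NN.roots (Antichains.comap (PosRoot.incl hs) A) ↔
      i ∈ NN.roots A ∧ P.root i ∈ simpleCone b J' := by
  constructor
  · intro hi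
    obtain ⟨x, hx, rfl⟩ := NN.mem_roots.1 hi
    exact ⟨NN.mem_roots.2 ⟨_, (Antichains.mem_comap _ A x).2 hx, rfl⟩, x.2⟩
  · rintro ⟨hi, hi'⟩
    obtain ⟨x, hx, rfl⟩ := NN.mem_roots.1 hi
    exact NN.mem_roots.2 ⟨.of x.1 hi', (Antichains.mem_comap (PosRoot.incl hs) A _).1 hx, rfl⟩

/-- Rowvacuation is compatible with orthogonal decompositions. -/
theorem roots_rvac_of_orthogonal {J J' J'' : Finset b.support} (hd : Disjoint J' J'')
    (hJ : J' ∪ J'' = J) (h : ∀ i ∈ J', ∀ j ∈ J'', P.pairing i j = 0) (A : NN b J) :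
    ∃ (A' : NN b J') (A'' : NN b J''),
      (∀ i, i ∈ NN.roots A' ↔ i ∈ NN.roots A ∧ P.root i ∈ simpleCone b J') ∧
      (∀ i, i ∈ NN.roots A'' ↔ i ∈ NN.roots A ∧ P.root i ∈ simpleCone b J'') ∧
      NN.roots (rvac A) = NN.roots (rvac A') ∪ NN.roots (rvac A'') := by
  have hs' : J' ⊆ J := hJ ▸ Finset.subset_union_left
  have hs'' : J'' ⊆ J := hJ ▸ Finset.subset_union_right
  have h' : ∀ i ∈ J'', ∀ j ∈ J', P.pairing i j = 0 := fun i hi j hj =>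
    P.pairing_eq_zero_iff.1 (h j hj i hi)
  have key' := mem_roots_rvac_of_orthogonal hd hJ h A hs'
  have key'' := mem_roots_rvac_of_orthogonal hd.symm (by rw [Finset.union_comm, hJ]) h' A hs''
  refine ⟨_, _, mem_roots_comap hs' A, mem_roots_comap hs'' A, ?_⟩
  ext i
  rw [Finset.mem_union]
  constructor
  · intro hi
    obtain ⟨x, hx, rfl⟩ := NN.mem_roots.1 hi
    rcases mem_simpleCone_or_mem_of_orthogonal hd hJ h x.2 with h1 | h1
    · exact Or.inl (NN.mem_roots.2 ⟨.of x.1 h1, (key' (.of x.1 h1)).1 hx, rfl⟩)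
    · exact Or.inr (NN.mem_roots.2 ⟨.of x.1 h1, (key'' (.of x.1 h1)).1 hx, rfl⟩)
  · rintro (hi | hi)
    · obtain ⟨x, hx, rfl⟩ := NN.mem_roots.1 hi
      exact NN.mem_roots.2 ⟨_, (key' x).2 hx, rfl⟩
    · obtain ⟨x, hx, rfl⟩ := NN.mem_roots.1 hi
      exact NN.mem_roots.2 ⟨_, (key'' x).2 hx, rfl⟩

/-- A simple root as an element of the root poset. -/
def PosRoot.simple (α : b.support) : PosRoot b Finset.univ :=
  .of α (simple_mem_simpleCone (Finset.mem_univ α))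

theorem PosRoot.simple_le_iff {α : b.support} {y : PosRoot b Finset.univ} :
    PosRoot.simple α ≤ y ↔ coeff b y.1 α ≠ 0 := by
  rw [PosRoot.le_iff]
  change (∀ i, coeff b α i ≤ _) ↔ _
  constructor
  · intro h
    have := h α
    rw [coeff_simple, if_pos rfl] at this
    omega
  · intro h i
    rw [coeff_simple]
    split_ifs with hi
    · subst hi
      omega
    · omega

theorem PosRoot.eq_simple_of_le {α : b.support} {y : PosRoot b Finset.univ}
    (h : y ≤ PosRoot.simple α) : y = PosRoot.simple α := by
  by_contra hne
  have h1 := PosRoot.strictMono_height (lt_of_le_of_ne h hne)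
  change height b y.1 - 1 < height b α - 1 at h1
  rw [height_simple] at h1
  omega

theorem mem_simpleCone_erase_iff {α : b.support} {y : PosRoot b Finset.univ} :
    P.root y.1 ∈ simpleCone b (Finset.univ.erase α) ↔ ¬ PosRoot.simple α ≤ y := by
  rw [PosRoot.simple_le_iff, not_not]
  constructor
  · exact fun h => coeff_eq_zero h (by simp)
  · intro h
    refine mem_simpleCone_of_coeff y.2 fun i hi => ?_
    simp only [Finset.mem_erase, Finset.mem_univ, and_true, not_not] at hi
    rwa [hi]

theorem mem_rvac_of_not_le {α : b.support} {A : NN b Finset.univ}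
    {A' : NN b (Finset.univ.erase α)}
    (hmem : ∀ x, PosRoot.incl (Finset.erase_subset _ _) x ∈ A.1 ↔ x ∈ A'.1)
    (hA : ∀ a ∈ A.1, ¬ PosRoot.simple α ≤ a) (y : PosRoot b Finset.univ) :
    y ∈ (rvac A).1 ↔ y = PosRoot.simple α ∨
      ∃ x ∈ (rvac A').1, PosRoot.incl (Finset.erase_subset _ _) x = y :=
  mem_rvac_iff_of_minimal (PosRoot.incl (Finset.erase_subset _ _))
    (fun _ h => PosRoot.eq_simple_of_le h)
    (fun y => by rw [PosRoot.exists_incl_eq_iff, mem_simpleCone_erase_iff]) hmem hA y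

/-- Rowvacuation of an antichain in a maximal parabolic subsystem. -/
theorem roots_rvac_of_subset_erase (A : NN b Finset.univ) (α : b.support)
    (hA : ∀ i ∈ NN.roots A, P.root i ∈ simpleCone b (Finset.univ.erase α)) :
    ∃ A' : NN b (Finset.univ.erase α), NN.roots A' = NN.roots A ∧
      NN.roots (rvac A) = insert (α : ι) (NN.roots (rvac A')) := by
  refine ⟨Antichains.comap (PosRoot.incl (Finset.erase_subset _ _)) A, ?_, ?_⟩
  · ext i
    rw [mem_roots_comap]
    exact ⟨And.left, fun h => ⟨h, hA i h⟩⟩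
  · have key := mem_rvac_of_not_le (fun x => Antichains.mem_comap _ A x)
      (fun a ha => mem_simpleCone_erase_iff.1 (hA a.1 (NN.val_mem_roots.2 ha)))
    ext i
    rw [Finset.mem_insert]
    constructor
    · intro hi
      obtain ⟨x, hx, rfl⟩ := NN.mem_roots.1 hi
      rcases (key x).1 hx with rfl | ⟨z, hz, rfl⟩
      · exact Or.inl rfl
      · exact Or.inr (NN.mem_roots.2 ⟨z, hz, rfl⟩)
    · rintro (rfl | hi)
      · exact NN.mem_roots.2 ⟨PosRoot.simple α, (key _).2 (Or.inl rfl), rfl⟩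
      · obtain ⟨z, hz, rfl⟩ := NN.mem_roots.1 hi
        exact NN.mem_roots.2 ⟨_, (key _).2 (Or.inr ⟨z, hz, rfl⟩), rfl⟩

/-- Rowvacuation of an antichain containing a simple root. -/
theorem roots_rvac_of_simple_mem (A : NN b Finset.univ) (α : b.support)
    (hA : (α : ι) ∈ NN.roots A) :
    ∃ A' : NN b (Finset.univ.erase α), NN.roots A' = (NN.roots A).erase α ∧
      NN.roots (rvac A) = NN.roots (rvac A') := by
  have hα : PosRoot.simple α ∈ A.1 := NN.val_mem_roots.1 hA
  have hnot : ∀ a ∈ A.1, a ≠ PosRoot.simple α → ¬ PosRoot.simple α ≤ a := fun a ha hne hle =>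
    A.2 hα ha hne.symm hle
  let f := PosRoot.incl (b := b) (Finset.erase_subset α Finset.univ)
  let A' := Antichains.comap f A
  have hf : ∀ x, ¬ PosRoot.simple α ≤ f x := fun x => mem_simpleCone_erase_iff.1 x.2
  have hrvac : rvac A = Antichains.map f (rvac A') := by
    -- The antichain `rvac A'` lies in the parabolic subsystem, so its rowvacuation adds `α` to
    -- `rvac (rvac A') = A'`, giving back `A`. Applying the involution finishes.
    have h1 : rvac (Antichains.map f (rvac A')) = A := by
      refine antichain_ext fun y => ?_
      rw [mem_rvac_of_not_le (A' := rvac A') (fun x => ?_) (fun a ha => ?_),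
        rvac_involutive PosRoot.isRanked A']
      · constructor
        · rintro (rfl | ⟨x, hx, rfl⟩)
          · exact hα
          · exact (Antichains.mem_comap f A x).2 hx
        · intro hy
          by_cases hne : y = PosRoot.simple α
          · exact Or.inl hne
          · obtain ⟨x, rfl⟩ := (PosRoot.exists_incl_eq_iff (Finset.erase_subset α Finset.univ) y).2
              (mem_simpleCone_erase_iff.2 (hnot y hy hne))
            exact Or.inr ⟨x, (Antichains.mem_comap f A x).1 hy, rfl⟩
      · rw [Antichains.mem_map]
        exact ⟨fun ⟨z, hz, h⟩ => f.injective h ▸ hz, fun h => ⟨x, h, rfl⟩⟩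
      · obtain ⟨x, -, rfl⟩ := (Antichains.mem_map f _ a).1 ha
        exact hf x
    conv_lhs => rw [← h1]
    exact rvac_involutive PosRoot.isRanked _
  refine ⟨A', ?_, ?_⟩
  · ext i
    rw [mem_roots_comap, Finset.mem_erase]
    constructor
    · rintro ⟨hi, hi'⟩
      refine ⟨?_, hi⟩
      rintro rfl
      exact mem_simpleCone_erase_iff (y := PosRoot.simple α).1 hi' le_rfl
    · rintro ⟨hne, hi⟩
      obtain ⟨x, hx, rfl⟩ := NN.mem_roots.1 hi
      refine ⟨hi, mem_simpleCone_erase_iff.2 (hnot x hx ?_)⟩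
      rintro rfl
      exact hne rfl
  · ext i
    rw [hrvac, NN.mem_roots, NN.mem_roots]
    constructor
    · rintro ⟨x, hx, rfl⟩
      obtain ⟨z, hz, rfl⟩ := (Antichains.mem_map f _ x).1 hx
      exact ⟨z, hz, rfl⟩
    · rintro ⟨z, hz, rfl⟩
      exact ⟨f z, (Antichains.mem_map f _ _).2 ⟨z, hz, rfl⟩, rfl⟩

end Parabolic

/-! ### Letters, and simple reflections as signed permutations -/

/-- The signed permutation exchanging the letters `x` and `y` among the letters `1, …, N`, where
`N + 1 - t` is the negative of `t`. -/
def letterSwap (N x y t : ℕ) : ℕ :=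
  if t = x then y else if t = y then x
  else if t + y = N + 1 then N + 1 - x else if t + x = N + 1 then N + 1 - y else t

/-- The pairing of the letter `t` with the coroot of the difference of the letters `x` and `y`. -/
def letterPairing (N x y t : ℕ) : ℤ :=
  if t = x then 1 else if t = y then -1
  else if t + y = N + 1 then 1 else if t + x = N + 1 then -1 else 0

theorem letterPairing_mirror {N x y t : ℕ} (hxy : x ≠ y) (hx : 2 * x ≠ N + 1)
    (hy : 2 * y ≠ N + 1) (hxN : x ≤ N) (hyN : y ≤ N) (ht : t ≤ N) :
    letterPairing N x y (N + 1 - t) = -letterPairing N x y t := by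
  unfold letterPairing
  split_ifs <;> omega

theorem letterSwap_mem {N x y t : ℕ} (hx : 1 ≤ x) (hy : 1 ≤ y) (hxN : x ≤ N) (hyN : y ≤ N)
    (h1 : 1 ≤ t) (ht : t ≤ N) : 1 ≤ letterSwap N x y t ∧ letterSwap N x y t ≤ N := by
  unfold letterSwap
  split_ifs <;> omega

theorem letterSwap_ne {N x y t t' : ℕ} (hxy : x ≠ y) (hx : 2 * x ≠ N + 1)
    (hy : 2 * y ≠ N + 1) (hxN : x ≤ N) (hyN : y ≤ N) (h : t ≠ t') :
    letterSwap N x y t ≠ letterSwap N x y t' := by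
  unfold letterSwap
  split_ifs <;> omega

theorem letterSwap_add_ne {N x y t t' : ℕ} (hx : 2 * x ≠ N + 1)
    (hy : 2 * y ≠ N + 1) (hxN : x ≤ N) (hyN : y ≤ N) (h : t + t' ≠ N + 1) :
    letterSwap N x y t + letterSwap N x y t' ≠ N + 1 := by
  unfold letterSwap
  split_ifs <;> omega

section Letters

variable {ι M N' : Type*} [Fintype ι] [AddCommGroup M] [Module ℝ M] [AddCommGroup N']
  [Module ℝ N'] {P : RootPairing ι ℝ M N'} [P.IsRootSystem] [P.IsCrystallographic]
  {b : P.Base}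

/-- The simple coroots form a basis of a space in perfect duality with `M`. This produces the
letters without any coordinates. -/
theorem exists_coroot'_eq (b : P.Base) (g : b.support → ℝ) :
    ∃ x : M, ∀ i : b.support, P.coroot' i x = g i := by
  refine ⟨P.toLinearMap.toPerfPair.symm (b.toCoweightBasis.constr ℝ g), fun i => ?_⟩
  change P.toLinearMap _ (P.coroot i) = _
  rw [LinearMap.apply_symm_toPerfPair_self, ← b.toCoweightBasis_apply,
    Module.Basis.constr_basis]

theorem eq_of_coroot'_eq {x y : M} (h : ∀ i : b.support, P.coroot' i x = P.coroot' i y) :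
    x = y := by
  apply P.toLinearMap.toPerfPair.injective
  refine b.toCoweightBasis.ext fun i => ?_
  rw [b.toCoweightBasis_apply]
  exact h i

/-- Vectors `L 1, …, L N`, with `L (N + 1 - t) = - L t`, such that the reflection at the `k`-th
simple root exchanges `L (x k)` and `L (y k)`. -/
structure LetterSystem (b : P.Base) (n N : ℕ) (x y v : ℕ → ℕ) where
  /-- The numbering of the simple roots. -/
  lab : b.support → ℕ
  one_le_lab : ∀ i, 1 ≤ lab i
  lab_le : ∀ i, lab i ≤ n
  lab_injective : Function.Injective lab
  lab_surj : ∀ k, 1 ≤ k → k ≤ n → ∃ i, lab i = k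
  /-- The letters. -/
  L : ℕ → M
  L_mirror : ∀ t, 1 ≤ t → t ≤ N → L (N + 1 - t) = -L t
  reflection_L : ∀ (i : b.support) t, 1 ≤ t → t ≤ N →
    P.reflection i (L t) = L (letterSwap N (x (lab i)) (y (lab i)) t)
  smul_root : ∀ i, (v (lab i) : ℝ) • P.root i = L (x (lab i)) - L (y (lab i))

/-- A letter is defined by its pairings with the simple coroots. The hypothesis on the Cartan matrix
says that multiples of simple roots and differences of letters have the same pairings, so they
agree; the reflection formula follows. The multiplier `v` is needed in type `B`, where twice the
last simple root is such a difference. -/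
theorem exists_letterSystem {n N : ℕ} {x y v : ℕ → ℕ} (e : b.support ≃ Fin n)
    (hx : ∀ k, 1 ≤ k → k ≤ n → 1 ≤ x k ∧ x k < y k ∧ y k ≤ N ∧ 2 * x k ≠ N + 1 ∧ 2 * y k ≠ N + 1)
    (hc : ∀ i j, (v (e i + 1) : ℤ) * b.cartanMatrix i j = v (e j + 1) *
      (letterPairing N (x (e j + 1)) (y (e j + 1)) (x (e i + 1)) -
        letterPairing N (x (e j + 1)) (y (e j + 1)) (y (e i + 1)))) :
    Nonempty (LetterSystem b n N x y v) := by
  choose L hL using fun t => exists_coroot'_eq b fun i =>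
    ((v (e i + 1) * letterPairing N (x (e i + 1)) (y (e i + 1)) t : ℤ) : ℝ)
  have hx' := fun i => hx (e i + 1) (by omega) (by omega)
  have hmirror : ∀ t, 1 ≤ t → t ≤ N → L (N + 1 - t) = -L t := fun t h1 h2 => by
    refine eq_of_coroot'_eq (b := b) fun i => ?_
    obtain ⟨ha, hb, hc, hd, he⟩ := hx' i
    rw [map_neg, hL, hL, letterPairing_mirror hb.ne hd he (by omega) hc h2]
    push_cast
    ring
  have hroot : ∀ i : b.support, (v (e i + 1) : ℝ) • P.root i =
      L (x (e i + 1)) - L (y (e i + 1)) := fun i => by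
    refine eq_of_coroot'_eq (b := b) fun j => ?_
    have h1 : P.coroot' j (P.root i) = (b.cartanMatrix i j : ℝ) := by
      rw [P.root_coroot'_eq_pairing]
      exact (P.algebraMap_pairingIn ℤ i j).symm
    rw [map_smul, map_sub, hL, hL, h1, smul_eq_mul, ← Int.cast_sub, ← mul_sub, ← hc]
    push_cast
    rfl
  refine ⟨⟨fun i => e i + 1, fun i => by omega, fun i => by omega, fun i j h => ?_,
    fun k h1 h2 => ⟨e.symm ⟨k - 1, by omega⟩, ?_⟩, L, hmirror, fun i t h1 h2 => ?_, hroot⟩⟩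
  · exact e.injective (Fin.ext (by simpa using h))
  · simp only [Equiv.apply_symm_apply]
    omega
  · obtain ⟨ha, hb, hc, hd, he⟩ := hx' i
    have hmx := hmirror (x (e i + 1)) ha (by omega)
    have hmy := hmirror (y (e i + 1)) (by omega) hc
    rw [P.reflection_apply, hL, Int.cast_mul, mul_comm, mul_smul, Int.cast_natCast, hroot i]
    unfold letterPairing letterSwap
    split_ifs with h3 h4 h5 h6
    · rw [h3]
      simp
    · rw [h4]
      simp
    · rw [show t = N + 1 - y (e i + 1) by omega, hmx, hmy]
      simp only [Int.cast_one, one_smul]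
      abel
    · rw [show t = N + 1 - x (e i + 1) by omega, hmx, hmy]
      simp only [Int.cast_one, Int.cast_neg, one_smul, neg_smul]
      abel
    · simp

namespace LetterSystem

variable {n N : ℕ} {x y v : ℕ → ℕ} (S : LetterSystem b n N x y v)

/-- The difference of two letters is a root of squared length `l`. -/
def IsRootOfLength (l : ℝ) (s t : ℕ) : Prop :=
  S.L s - S.L t ∈ Set.range P.root ∧ P.RootForm (S.L s - S.L t) (S.L s - S.L t) = l

theorem IsRootOfLength.swap {S : LetterSystem b n N x y v} {l : ℝ} {s t : ℕ}
    (h : S.IsRootOfLength l s t) {k : ℕ} (h1 : 1 ≤ k) (hk : k ≤ n) (hs : 1 ≤ s ∧ s ≤ N)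
    (ht : 1 ≤ t ∧ t ≤ N) {s' t' : ℕ} (hs' : letterSwap N (x k) (y k) s = s')
    (ht' : letterSwap N (x k) (y k) t = t') : S.IsRootOfLength l s' t' := by
  obtain ⟨i, rfl⟩ := S.lab_surj k h1 hk
  obtain ⟨⟨m, hm⟩, hl⟩ := h
  have key : S.L s' - S.L t' = P.reflection i (S.L s - S.L t) := by
    rw [map_sub, S.reflection_L i s hs.1 hs.2, S.reflection_L i t ht.1 ht.2, hs', ht']
  rw [IsRootOfLength, key, P.rootForm_reflection_reflection_apply]
  exact ⟨⟨P.reflectionPerm i m, by rw [P.root_reflectionPerm, hm]⟩, hl⟩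

theorem exists_isRootOfLength {k : ℕ} (h1 : 1 ≤ k) (hk : k ≤ n) {s t : ℕ}
    (h : ∀ i, S.lab i = k → P.root i = S.L s - S.L t) :
    ∃ i, S.lab i = k ∧
      S.IsRootOfLength (P.RootForm (P.root i) (P.root i)) s t := by
  obtain ⟨i, hi⟩ := S.lab_surj k h1 hk
  exact ⟨i, hi, by rw [IsRootOfLength, ← h i hi]; exact ⟨⟨i, rfl⟩, rfl⟩⟩

/-- A set of differences of letters that is closed under negation and simple reflections and
contains the simple roots contains all roots. -/
theorem exists_root_eq [P.IsReduced] {p : ℕ → ℕ → Prop} (hp : ∀ s t, p s t → p t s)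
    (hN : ∀ s t, p s t → 1 ≤ s ∧ s ≤ N)
    (hswap : ∀ k, 1 ≤ k → k ≤ n → ∀ s t, p s t →
      p (letterSwap N (x k) (y k) s) (letterSwap N (x k) (y k) t))
    (hsimple : ∀ i : b.support, ∃ s t, p s t ∧ P.root i = S.L s - S.L t) (m : ι) :
    ∃ s t, p s t ∧ P.root m = S.L s - S.L t := by
  refine b.induction_reflect m (p := fun m => ∃ s t, p s t ∧ P.root m = S.L s - S.L t) ?_ ?_ ?_
  · rintro i ⟨s, t, hst, h⟩
    refine ⟨t, s, hp _ _ hst, ?_⟩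
    rw [P.root_reflectionPerm, P.reflection_apply_self, h, neg_sub]
  · exact fun i hi => hsimple ⟨i, hi⟩
  · rintro i j ⟨s, t, hst, h⟩ hj
    refine ⟨_, _, hswap _ (S.one_le_lab ⟨j, hj⟩) (S.lab_le ⟨j, hj⟩) _ _ hst, ?_⟩
    rw [P.root_reflectionPerm, h, map_sub]
    rw [S.reflection_L ⟨j, hj⟩ s (hN _ _ hst).1 (hN _ _ hst).2,
      S.reflection_L ⟨j, hj⟩ t (hN _ _ (hp _ _ hst)).1 (hN _ _ (hp _ _ hst)).2]

/-- The coordinates of a letter with respect to the simple roots. -/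
def coord (i : b.support) (t : ℕ) : ℝ := b.toWeightBasis.repr (S.L t) i

theorem coord_mirror (i : b.support) {t : ℕ} (h1 : 1 ≤ t) (ht : t ≤ N) :
    S.coord i (N + 1 - t) = -S.coord i t := by
  simp [coord, S.L_mirror t h1 ht]

theorem coord_sub_coord (i : b.support) {k : ℕ} (h1 : 1 ≤ k) (hk : k ≤ n) :
    S.coord i (x k) - S.coord i (y k) = if S.lab i = k then (v k : ℝ) else 0 := by
  obtain ⟨j, rfl⟩ := S.lab_surj k h1 hk
  have := congrArg (fun z => b.toWeightBasis.repr z i) (S.smul_root j)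
  simp only [map_smul, map_sub, Finsupp.smul_apply, Finsupp.sub_apply,
    RootPairing.Base.toWeightBasis_repr_root, Finsupp.single_apply] at this
  rw [coord, coord, ← this]
  by_cases h : i = j
  · simp [h]
  · simp [Ne.symm h, S.lab_injective.ne h]

end LetterSystem

/-- A description of the roots and their coordinates yields a description of the root poset. -/
theorem exists_orderIso_posRoot {Q : Type*} [PartialOrder Q] (f : Q → M) (g : Q → b.support → ℕ)
    (hg : ∀ q i, b.toWeightBasis.repr (f q) i = g q i)
    (hle : ∀ q q', q ≤ q' ↔ ∀ i, g q i ≤ g q' i) (hroot : ∀ q, f q ∈ Set.range P.root)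
    (hsurj : ∀ m, (∃ q, P.root m = f q) ∨ ∃ q, P.root m = -f q) :
    ∃ F : PosRoot b Finset.univ ≃o Q, ∀ z q, P.root z.1 = f q ↔ F z = q := by
  have hcone : ∀ q, f q ∈ simpleCone b Finset.univ := fun q =>
    mem_simpleCone_iff.2 ⟨g q, by simp, hg q⟩
  choose r hr using hroot
  let G : Q → PosRoot b Finset.univ := fun q => .of (r q) (by rw [hr]; exact hcone q)
  have hcoeff : ∀ q i, coeff b (r q) i = g q i := fun q i => by
    simp [coeff, hr, hg]
  have hG : ∀ q q', G q ≤ G q' ↔ q ≤ q' := fun q q' => by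
    rw [PosRoot.le_iff, hle]
    change (∀ i, coeff b (r q) i ≤ coeff b (r q') i) ↔ _
    simp only [hcoeff]
  have hinj : Function.Injective G := fun q q' h =>
    le_antisymm ((hG _ _).1 h.le) ((hG _ _).1 h.ge)
  have hsur : Function.Surjective G := fun z => by
    rcases hsurj z.1 with ⟨q, hq⟩ | ⟨q, hq⟩
    · exact ⟨q, Subtype.ext (P.root.injective ((hr q).trans hq.symm))⟩
    · exact absurd (simpleCone_eq_zero b _ z.2 (by rw [hq, neg_neg]; exact hcone q))
        (P.ne_zero z.1)
  let E : Q ≃o PosRoot b Finset.univ := ⟨Equiv.ofBijective G ⟨hinj, hsur⟩, fun {q q'} => hG q q'⟩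
  refine ⟨E.symm, fun z q => ?_⟩
  rw [E.symm_apply_eq, ← hr q]
  exact ⟨fun h => Subtype.ext (P.root.injective h), fun h => by rw [h]; rfl⟩

end Letters

/-! ### From the interval model to the root poset -/

section Transfer

variable {ι M N : Type*} [Fintype ι] [AddCommGroup M] [Module ℝ M] [AddCommGroup N] [Module ℝ N]
  {P : RootPairing ι ℝ M N} [P.IsRootSystem] [P.IsCrystallographic] {b : P.Base}
  {Q : Type*} [PartialOrder Q]

/-- The embedding of the root poset into the index set of the roots. -/
def PosRoot.valEmbedding (J : Finset b.support) : PosRoot b J ↪ ι :=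
  ⟨fun z => z.1, fun _ _ h => Subtype.ext h⟩

theorem NN.roots_eq_map {J : Finset b.support} (A : NN b J) :
    NN.roots A = A.1.map (PosRoot.valEmbedding J) := rfl

theorem NN.card_filter_roots {J : Finset b.support} (A : NN b J) (g : PosRoot b J ↪o Q)
    {p : ι → Prop} {q : Q → Prop} (h : ∀ z : PosRoot b J, p z.1 ↔ q (g z)) :
    ((NN.roots A).filter p).card = ((Antichains.map g A).1.filter q).card := by
  rw [NN.roots_eq_map, Antichains.map, Finset.filter_map, Finset.filter_map, Finset.card_map,
    Finset.card_map]
  exact congrArg Finset.card (Finset.filter_congr fun z _ => h z)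

theorem NN.card_roots {J : Finset b.support} (A : NN b J) (g : PosRoot b J ↪o Q) :
    (NN.roots A).card = (Antichains.map g A).1.card := by
  rw [NN.roots_eq_map, Antichains.map, Finset.card_map, Finset.card_map]

theorem rvac_map_orderIso {Q' : Type*} [PartialOrder Q'] [Fintype Q'] [Fintype Q] (F : Q' ≃o Q)
    (A : Antichains Q') :
    rvac (Antichains.map F.toOrderEmbedding A) =
      Antichains.map F.toOrderEmbedding (rvac A) := by
  refine antichain_ext fun y => ?_
  obtain ⟨z, rfl⟩ := F.surjective y
  have h : ∀ (B : Antichains Q') z, F z ∈ (Antichains.map F.toOrderEmbedding B).1 ↔ z ∈ B.1 := by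
    intro B z
    rw [Antichains.mem_map]
    exact ⟨fun ⟨w, hw, h⟩ => F.injective h ▸ hw, fun h => ⟨z, h, rfl⟩⟩
  rw [h]
  exact mem_rvac_orderEmbedding F.toOrderEmbedding (fun x y _ => F.surjective y)
    (fun x y _ => F.surjective y) (fun z => h A z) z

theorem rank_orderIso {Q' : Type*} [PartialOrder Q'] [Fintype Q'] [Fintype Q] (F : Q' ≃o Q)
    (z : Q') : rank (F z) = rank z :=
  rank_orderEmbedding F.toOrderEmbedding (fun _ y _ => F.surjective y) z

variable (b) in
/-- The facts about the root poset that determine the cardinalities, the root lengths and the rank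
levels. -/
structure RootPosetFacts (h : ℕ) where
  /-- The highest root. -/
  top : PosRoot b Finset.univ
  le_top : ∀ z, z ≤ top
  -- The highest root has height `h - 1`, and ranks are heights minus one.
  rank_top : rank top + 2 = h
  card_add : ∀ A : NN b Finset.univ,
    (NN.roots A).card + (NN.roots (rvac A)).card = b.support.card
  /-- The roots of the second length. -/
  special : ι → Prop
  /-- The two squared lengths. -/
  len : Bool → ℝ
  rootForm_eq : ∀ z : PosRoot b Finset.univ,
    P.RootForm (P.root z.1) (P.root z.1) = len (decide (special z.1))
  card_special_add : ∀ A : NN b Finset.univ,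
    ((NN.roots A).filter special).card + ((NN.roots (rvac A)).filter special).card =
      (b.support.filter special).card

/-- The two values are allowed to coincide, so both contributions are added rather than
distinguished by cases. -/
theorem card_filter_eq_of_two_values {α : Type*} (s : Finset α) {f : α → ℝ} {p : α → Prop}
    {len : Bool → ℝ} (h : ∀ a ∈ s, f a = len (decide (p a))) (c : ℝ) :
    (s.filter fun a => f a = c).card =
      (if len false = c then s.card - (s.filter p).card else 0) +
        if len true = c then (s.filter p).card else 0 := by
  have h1 : s.filter (fun a => f a = c) =
      (s.filter p).filter (fun _ => len true = c) ∪
        (s.filter fun a => ¬ p a).filter (fun _ => len false = c) := by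
    ext a
    simp only [Finset.mem_filter, Finset.mem_union]
    by_cases ha : a ∈ s
    · by_cases hp : p a <;> simp [ha, h a ha, hp]
    · simp [ha]
  have h2 := Finset.card_filter_add_card_filter_not (s := s) p
  rw [h1, Finset.card_union_of_disjoint, Finset.filter_const, Finset.filter_const]
  · split_ifs <;> (try rw [Finset.card_empty]) <;> omega
  · refine Finset.disjoint_left.2 fun a ha hb => ?_
    simp only [Finset.mem_filter] at ha hb
    exact hb.1.2 ha.1.2

theorem RootPosetFacts.card_length_add {h : ℕ} (T : RootPosetFacts b h) (A : NN b Finset.univ)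
    (c : ℝ) :
    ((NN.roots A).filter fun i => P.RootForm (P.root i) (P.root i) = c).card +
      ((NN.roots (rvac A)).filter fun i => P.RootForm (P.root i) (P.root i) = c).card =
      (b.support.filter fun i => P.RootForm (P.root i) (P.root i) = c).card := by
  have hA : ∀ A : NN b Finset.univ, ∀ i ∈ NN.roots A,
      P.RootForm (P.root i) (P.root i) = T.len (decide (T.special i)) := fun A i hi => by
    obtain ⟨z, -, rfl⟩ := NN.mem_roots.1 hi
    exact T.rootForm_eq z
  rw [card_filter_eq_of_two_values _ (hA A) c, card_filter_eq_of_two_values _ (hA (rvac A)) c,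
    card_filter_eq_of_two_values b.support
      (fun i hi => T.rootForm_eq (PosRoot.simple ⟨i, hi⟩)) c]
  have h1 := T.card_add A
  have h2 := T.card_special_add A
  have h3 := Finset.card_filter_le (NN.roots A) T.special
  have h4 := Finset.card_filter_le (NN.roots (rvac A)) T.special
  split_ifs <;> omega

theorem nonempty_rootPosetFacts {c : ℕ} {two : Bool} (hc : 2 ≤ c)
    (F : PosRoot b Finset.univ ≃o Cell c two) (q : Cell c two → Prop) (len : Bool → ℝ)
    (hlen : ∀ z : PosRoot b Finset.univ,
      P.RootForm (P.root z.1) (P.root z.1) = len (decide (q (F z))))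
    (hcard : ∀ A : Antichains (Cell c two), A.1.card + (rvac A).1.card = b.support.card)
    (hq : ∀ A : Antichains (Cell c two), (A.1.filter q).card + ((rvac A).1.filter q).card =
      (Finset.univ.filter fun i : b.support => q (F (PosRoot.simple i))).card) :
    Nonempty (RootPosetFacts b (2 * c)) := by
  obtain ⟨p, hp⟩ : ∃ p : ι → Prop, ∀ z : PosRoot b Finset.univ, p z.1 ↔ q (F z) :=
    ⟨fun i => ∃ z : PosRoot b Finset.univ, z.1 = i ∧ q (F z), fun z =>
      ⟨fun ⟨w, hw, h⟩ => Subtype.ext (p := fun i => P.root i ∈ simpleCone b Finset.univ) hw ▸ h,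
        fun h => ⟨z, rfl, h⟩⟩⟩
  -- The full interval `[1, 2c - 1]`; for `c ≥ 2` it does not end at the centre, so copies play no
  -- role in comparisons with it.
  let t : Cell c two := ⟨1, 2 * c - 1, false, le_rfl, by omega, by omega, by simp⟩
  refine ⟨⟨F.symm t, fun z => ?_, ?_, fun A => ?_, p, len, fun z => ?_, fun A => ?_⟩⟩
  · rw [F.le_symm_apply, Cell.le_def]
    have h1 := (F z).one_le
    have h2 := (F z).sum_le
    refine ⟨h1, ?_, fun _ h => absurd h ?_⟩
    · change _ ≤ 2 * c - 1
      omega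
    · change ¬ 2 * c - 1 = c
      omega
  · rw [← rank_orderIso F, F.apply_symm_apply, Cell.rank_eq]
    change 2 * c - 1 - 1 + 2 = _
    omega
  · rw [NN.card_roots A F.toOrderEmbedding, NN.card_roots (rvac A) F.toOrderEmbedding,
      ← rvac_map_orderIso]
    exact hcard _
  · rw [hlen z]
    simp only [hp]
  · rw [NN.card_filter_roots A F.toOrderEmbedding hp,
      NN.card_filter_roots (rvac A) F.toOrderEmbedding hp, ← rvac_map_orderIso, hq]
    refine Finset.card_bij (fun i _ => i.1) (fun i hi => ?_) (fun i _ j _ h => Subtype.ext h)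
      fun i hi => ?_
    · exact Finset.mem_filter.2 ⟨i.2, (hp (PosRoot.simple i)).2 (by simpa using hi)⟩
    · obtain ⟨h1, h2⟩ := Finset.mem_filter.1 hi
      exact ⟨⟨i, h1⟩, by simpa using (hp (PosRoot.simple ⟨i, h1⟩)).1 h2, rfl⟩

end Transfer

/-! ### Root coefficients determine the order of intervals -/

namespace Cell

/-- The coefficients of the positive roots in type `B`. -/
def coeffB {c : ℕ} (x : Cell c false) (k : ℕ) : ℕ :=
  (if x.i ≤ k ∧ k ≤ x.j then 1 else 0) + if 2 * c + 1 ≤ x.j + k then 1 else 0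

/-- The coefficients of the positive roots in type `C`. -/
def coeffC {c : ℕ} (x : Cell c false) (k : ℕ) : ℕ :=
  (if x.i ≤ k ∧ k ≤ x.j then 1 else 0) + if k < c ∧ 2 * c ≤ x.j + k then 1 else 0

/-- The coefficients of the positive roots in type `D`. -/
def coeffD {c : ℕ} (x : Cell c true) (k : ℕ) : ℕ :=
  if x.j < c then if x.i ≤ k ∧ k ≤ x.j then 1 else 0
  else if x.j = c then
    if x.s = true then if x.i ≤ k ∧ k ≠ c then 1 else 0 else if x.i ≤ k ∧ k ≤ c then 1 else 0
  else (if x.i ≤ k then 1 else 0) + if k < c ∧ 2 * c + 1 ≤ x.j + k then 1 else 0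

theorem le_iff_coeffB {c : ℕ} (x y : Cell c false) :
    x ≤ y ↔ ∀ k, 1 ≤ k → k ≤ c → coeffB x k ≤ coeffB y k := by
  rw [le_def, s_eq_false' x, s_eq_false' y]
  have hx1 := x.one_le
  have hx2 := x.le_j
  have hx3 := x.sum_le
  have hy1 := y.one_le
  have hy2 := y.le_j
  have hy3 := y.sum_le
  unfold coeffB
  constructor
  · rintro ⟨h1, h2, -⟩ k hk hk'
    split_ifs <;> omega
  · intro h
    have h1 := h x.i (by omega) (by omega)
    refine ⟨?_, ?_, fun _ _ => rfl⟩
    · split_ifs at h1 <;> omega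
    · by_cases hj : x.j ≤ c
      · have h2 := h x.j (by omega) hj
        split_ifs at h2 <;> omega
      -- The least index at which the coefficient of `x` is 2.
      · have h2 := h (2 * c + 1 - x.j) (by omega) (by omega)
        split_ifs at h2 <;> omega

theorem le_iff_coeffC {c : ℕ} (x y : Cell c false) :
    x ≤ y ↔ ∀ k, 1 ≤ k → k ≤ c → coeffC x k ≤ coeffC y k := by
  rw [le_def, s_eq_false' x, s_eq_false' y]
  have hx1 := x.one_le
  have hx2 := x.le_j
  have hx3 := x.sum_le
  have hy1 := y.one_le
  have hy2 := y.le_j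
  have hy3 := y.sum_le
  unfold coeffC
  constructor
  · rintro ⟨h1, h2, -⟩ k hk hk'
    split_ifs <;> omega
  · intro h
    have h1 := h x.i (by omega) (by omega)
    refine ⟨?_, ?_, fun _ _ => rfl⟩
    · split_ifs at h1 <;> omega
    · by_cases hj : x.j ≤ c
      · have h2 := h x.j (by omega) hj
        split_ifs at h2 <;> omega
      -- The least index with coefficient 2 in type `C`, where the last coefficient never exceeds 1.
      · have h2 := h (2 * c - x.j) (by omega) (by omega)
        split_ifs at h2 <;> omega

theorem coeffD_cases {c : ℕ} (x : Cell c true) :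
    (x.j < c ∧ ∀ k, coeffD x k = if x.i ≤ k ∧ k ≤ x.j then 1 else 0) ∨
    (x.j = c ∧ x.s = false ∧ ∀ k, coeffD x k = if x.i ≤ k ∧ k ≤ c then 1 else 0) ∨
    (x.j = c ∧ x.s = true ∧ ∀ k, coeffD x k = if x.i ≤ k ∧ k ≠ c then 1 else 0) ∨
    (c < x.j ∧ ∀ k, coeffD x k =
      (if x.i ≤ k then 1 else 0) + if k < c ∧ 2 * c + 1 ≤ x.j + k then 1 else 0) := by
  rcases lt_trichotomy x.j c with h | h | h
  · exact Or.inl ⟨h, fun k => by rw [coeffD, if_pos h]⟩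
  · cases hs : x.s
    · exact Or.inr (Or.inl ⟨h, rfl, fun k => by
        rw [coeffD, if_neg (by omega), if_pos h, if_neg (by simp [hs])]⟩)
    · exact Or.inr (Or.inr (Or.inl ⟨h, rfl, fun k => by
        rw [coeffD, if_neg (by omega), if_pos h, if_pos hs]⟩))
  · exact Or.inr (Or.inr (Or.inr ⟨h, fun k => by rw [coeffD, if_neg (by omega),
      if_neg (by omega)]⟩))

theorem coeffD_le_of_le {c : ℕ} {x y : Cell c true} (h : x ≤ y) (k : ℕ) (hk : k ≤ c + 1) :
    coeffD x k ≤ coeffD y k := by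
  rw [le_def] at h
  obtain ⟨h1, h2, h3⟩ := h
  have hx2 := x.le_j
  rcases coeffD_cases x with ⟨hx, h⟩ | ⟨hx, hs, h⟩ | ⟨hx, hs, h⟩ | ⟨hx, h⟩ <;>
    rcases coeffD_cases y with ⟨hy, h'⟩ | ⟨hy, hs', h'⟩ | ⟨hy, hs', h'⟩ | ⟨hy, h'⟩ <;>
    rw [h, h'] <;>
    first
    | (split_ifs <;> omega)
    | (have := h3 hx hy; simp_all)

theorem le_of_coeffD_le {c : ℕ} {x y : Cell c true}
    (h : ∀ k, 1 ≤ k → k ≤ c + 1 → coeffD x k ≤ coeffD y k) : x ≤ y := by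
  rw [le_def]
  have hx1 := x.one_le
  have hx2 := x.le_j
  have hx3 := x.sum_le
  have hy1 := y.one_le
  have hy2 := y.le_j
  have hy3 := y.sum_le
  have h1 := h x.i (by omega) (by omega)
  -- The coefficients at `c` and `c + 1` tell the two copies of an interval ending at the centre
  -- apart.
  have h2 := h c (by omega) (by omega)
  have h3 := h (c + 1) (by omega) (by omega)
  rcases coeffD_cases x with ⟨hx, h'⟩ | ⟨hx, hs, h'⟩ | ⟨hx, hs, h'⟩ | ⟨hx, h'⟩
  · have h4 := h x.j (by omega) (by omega)
    rw [h'] at h1 h4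
    refine ⟨?_, ?_, fun h => absurd h (by omega)⟩ <;>
      rcases coeffD_cases y with ⟨hy, hc⟩ | ⟨hy, hs', hc⟩ | ⟨hy, hs', hc⟩ | ⟨hy, hc⟩ <;>
      rw [hc] at h1 h4 <;> split_ifs at h1 h4 <;> omega
  · rw [h'] at h1 h2
    rcases coeffD_cases y with ⟨hy, hc⟩ | ⟨hy, hs', hc⟩ | ⟨hy, hs', hc⟩ | ⟨hy, hc⟩ <;>
      rw [hc] at h1 h2
    · exfalso
      split_ifs at h2 <;> omega
    · refine ⟨?_, by omega, fun _ _ => by rw [hs, hs']⟩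
      split_ifs at h1 <;> omega
    · exfalso
      split_ifs at h2 <;> omega
    · refine ⟨?_, by omega, fun _ h => absurd h (by omega)⟩
      split_ifs at h1 <;> omega
  · rw [h'] at h1 h3
    rcases coeffD_cases y with ⟨hy, hc⟩ | ⟨hy, hs', hc⟩ | ⟨hy, hs', hc⟩ | ⟨hy, hc⟩ <;>
      rw [hc] at h1 h3
    · exfalso
      split_ifs at h3 <;> omega
    · exfalso
      split_ifs at h3 <;> omega
    · refine ⟨?_, by omega, fun _ _ => by rw [hs, hs']⟩
      split_ifs at h1 <;> omega
    · refine ⟨?_, by omega, fun _ h => absurd h (by omega)⟩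
      split_ifs at h1 <;> omega
  · have h4 := h (2 * c + 1 - x.j) (by omega) (by omega)
    rw [h'] at h1 h2 h3 h4
    rcases coeffD_cases y with ⟨hy, hc⟩ | ⟨hy, hs', hc⟩ | ⟨hy, hs', hc⟩ | ⟨hy, hc⟩ <;>
      rw [hc] at h1 h2 h3 h4
    · exfalso
      split_ifs at h2 <;> omega
    · exfalso
      split_ifs at h3 <;> omega
    · exfalso
      split_ifs at h2 <;> omega
    · refine ⟨?_, ?_, fun h => absurd h (by omega)⟩
      · split_ifs at h1 <;> omega
      · split_ifs at h4 <;> omega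

theorem le_iff_coeffD {c : ℕ} (x y : Cell c true) :
    x ≤ y ↔ ∀ k, 1 ≤ k → k ≤ c + 1 → coeffD x k ≤ coeffD y k :=
  ⟨fun h k _ hk => coeffD_le_of_le h k hk, le_of_coeffD_le⟩

theorem le_iff_interval {c : ℕ} (x y : Cell c false) (hx : x.j < c) :
    x ≤ y ↔ ∀ k, 1 ≤ k → k < c →
      (if x.i ≤ k ∧ k ≤ x.j then 1 else 0) ≤ if y.i ≤ k ∧ k ≤ y.j then 1 else 0 := by
  rw [le_def, s_eq_false' x, s_eq_false' y]
  have hx1 := x.one_le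
  have hx2 := x.le_j
  constructor
  · rintro ⟨h1, h2, -⟩ k hk hk'
    split_ifs <;> omega
  · intro h
    have h1 := h x.i (by omega) (by omega)
    have h2 := h x.j (by omega) (by omega)
    refine ⟨?_, ?_, fun _ _ => rfl⟩ <;> split_ifs at h1 h2 <;> omega

end Cell

/-! ### Chains of consecutive letters: lengths and coordinates -/

section Letters

variable {ι M N' : Type*} [Fintype ι] [AddCommGroup M] [Module ℝ M] [AddCommGroup N']
  [Module ℝ N'] {P : RootPairing ι ℝ M N'} [P.IsRootSystem] [P.IsCrystallographic]
  {b : P.Base}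

namespace LetterSystem

variable {n N m : ℕ} {x y v : ℕ → ℕ} {S : LetterSystem b n N x y v}

/-- The first simple roots are the differences of consecutive letters. -/
def IsChain (n N m : ℕ) (x y v : ℕ → ℕ) : Prop :=
  m ≤ n + 1 ∧ 2 * m ≤ N ∧ ∀ k, 1 ≤ k → k < m → x k = k ∧ y k = k + 1 ∧ v k = 1

theorem IsChain.root_eq (hS : IsChain n N m x y v) (i : b.support) (hi : S.lab i < m) :
    P.root i = S.L (S.lab i) - S.L (S.lab i + 1) := by
  obtain ⟨hx, hy, hv⟩ := hS.2.2 _ (S.one_le_lab i) hi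
  have h := S.smul_root i
  rwa [hx, hy, hv, Nat.cast_one, one_smul] at h

theorem IsChain.swap (hS : IsChain n N m x y v) {l : ℝ} {s t : ℕ}
    (h : S.IsRootOfLength l s t) {k : ℕ} (h1 : 1 ≤ k) (hk : k < m) (hs : 1 ≤ s ∧ s ≤ N)
    (ht : 1 ≤ t ∧ t ≤ N) {s' t' : ℕ} (hs' : letterSwap N k (k + 1) s = s')
    (ht' : letterSwap N k (k + 1) t = t') : S.IsRootOfLength l s' t' := by
  obtain ⟨hx, hy, -⟩ := hS.2.2 k h1 hk
  refine h.swap h1 (by have := hS.1; omega) hs ht ?_ ?_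
  · rwa [hx, hy]
  · rwa [hx, hy]

theorem IsChain.isRootOfLength (hS : IsChain n N m x y v) {l : ℝ}
    (h : S.IsRootOfLength l 1 2) {s t : ℕ} (hs : 1 ≤ s) (hst : s < t) (ht : t ≤ m) :
    S.IsRootOfLength l s t := by
  have hN := hS.2.1
  have h1 : ∀ t, 2 ≤ t → t ≤ m → S.IsRootOfLength l 1 t := by
    intro t ht
    induction t, ht using Nat.le_induction with
    | base => exact fun _ => h
    | succ t ht ih =>
      intro htm
      refine hS.swap (ih (by omega)) (k := t) (by omega) (by omega) (by omega) (by omega) ?_ ?_ <;>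
        unfold letterSwap <;> split_ifs <;> omega
  induction s, hs using Nat.le_induction with
  | base => exact h1 t hst ht
  | succ s hs ih =>
    refine hS.swap (ih (by omega)) (k := s) (by omega) (by omega) (by omega) (by omega) ?_ ?_ <;>
      unfold letterSwap <;> split_ifs <;> omega

/-- The reflection numbered `N - t` exchanges the mirror images of `N - t` and `N - t + 1`, which
moves `t` to `t + 1` when `N` is the sum of `t` and that number; `s` is too small to be affected. -/
theorem IsChain.isRootOfLength_of_le (hS : IsChain n N m x y v) {l : ℝ} {t₀ : ℕ} (h₀ : m < t₀)
    (hN : N < m + t₀) (h : ∀ s, 1 ≤ s → s + t₀ ≤ N → S.IsRootOfLength l s t₀) {s t : ℕ}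
    (hs : 1 ≤ s) (ht : t₀ ≤ t) (hst : s + t ≤ N) : S.IsRootOfLength l s t := by
  have hN := hS.2.1
  induction t, ht using Nat.le_induction with
  | base => exact h s hs hst
  | succ t ht ih =>
    refine hS.swap (ih (by omega)) (k := N - t) (by omega) (by omega) (by omega) (by omega)
      ?_ ?_ <;> unfold letterSwap <;> split_ifs <;> omega

theorem IsChain.exists_isRootOfLength (hS : IsChain n N m x y v) (hm : 2 ≤ m) :
    ∃ i, S.lab i = 1 ∧ S.IsRootOfLength (P.RootForm (P.root i) (P.root i)) 1 2 := by
  refine S.exists_isRootOfLength le_rfl (by have := hS.1; omega) fun i hi => ?_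
  have := hS.root_eq (S := S) i (by omega)
  rwa [hi] at this

theorem IsChain.coord_eq (hS : IsChain n N m x y v) (i : b.support) {t : ℕ} (h1 : 1 ≤ t)
    (ht : t ≤ m) :
    S.coord i t = S.coord i m + if t ≤ S.lab i ∧ S.lab i < m then 1 else 0 := by
  induction h : m - t generalizing t with
  | zero =>
    obtain rfl : t = m := by omega
    rw [if_neg (by omega), add_zero]
  | succ d ih =>
    have h2 := ih (t := t + 1) (by omega) (by omega) (by omega)
    have h3 := S.coord_sub_coord i (k := t) h1 (by have := hS.1; omega)
    obtain ⟨hx, hy, hv⟩ := hS.2.2 t h1 (by omega)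
    rw [hx, hy, hv, h2] at h3
    split_ifs at h3 ⊢ <;> first | omega | (push_cast at h3; linarith)

theorem repr_sub (i : b.support) (s t : ℕ) :
    b.toWeightBasis.repr (S.L s - S.L t) i = S.coord i s - S.coord i t := by
  simp [coord]

theorem forall_lab {p : ℕ → Prop} : (∀ i, p (S.lab i)) ↔ ∀ k, 1 ≤ k → k ≤ n → p k := by
  constructor
  · intro h k h1 h2
    obtain ⟨i, rfl⟩ := S.lab_surj k h1 h2
    exact h i
  · exact fun h i => h _ (S.one_le_lab i) (S.lab_le i)

end LetterSystem

end Letters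

/-! ### Type C -/

section TypeC

variable {ι M N' : Type*} [Fintype ι] [AddCommGroup M] [Module ℝ M] [AddCommGroup N']
  [Module ℝ N'] {P : RootPairing ι ℝ M N'} [P.IsRootSystem] [P.IsCrystallographic]
  {b : P.Base} {n : ℕ}

theorem LetterSystem.card_support {n N : ℕ} {x y v : ℕ → ℕ} (S : LetterSystem b n N x y v) :
    b.support.card = n := by
  have h : Function.Bijective fun i : b.support =>
      (⟨S.lab i - 1, by have := S.one_le_lab i; have := S.lab_le i; omega⟩ : Fin n) := by
    refine ⟨fun i j hij => S.lab_injective ?_, fun k => ?_⟩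
    · have h1 := S.one_le_lab i
      have h2 := S.one_le_lab j
      simp only [Fin.mk.injEq] at hij
      omega
    · obtain ⟨i, hi⟩ := S.lab_surj (k + 1) (by omega) (by omega)
      exact ⟨i, Fin.ext (by simp [hi])⟩
  simpa using Fintype.card_of_bijective h

theorem LetterSystem.card_filter_lab {n N : ℕ} {x y v : ℕ → ℕ} (S : LetterSystem b n N x y v)
    {k : ℕ} (h1 : 1 ≤ k) (hk : k ≤ n) : (Finset.univ.filter fun i => S.lab i = k).card = 1 := by
  obtain ⟨i, hi⟩ := S.lab_surj k h1 hk
  refine Finset.card_eq_one.2 ⟨i, ?_⟩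
  ext j
  simp [← hi, S.lab_injective.eq_iff]

/-- The letters in type `C n`. -/
abbrev LettersC (b : P.Base) (n : ℕ) : Type _ :=
  LetterSystem b n (2 * n) (fun k => k) (fun k => k + 1) fun _ => 1

theorem nonempty_lettersC (h : HasType b (.C n)) : Nonempty (LettersC b n) := by
  obtain ⟨e, he⟩ : ∃ e : b.support ≃ Fin n, ∀ i j,
    b.cartanMatrix i j = CartanMatrix.C n (e i) (e j) := h
  refine exists_letterSystem e (fun k h1 h2 => by omega) fun i j => ?_
  rw [he i j, CartanMatrix.C, Matrix.of_apply]
  simp only [Fin.ext_iff]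
  have hi := (e i).isLt
  have hj := (e j).isLt
  generalize (e i : ℕ) = k at *
  generalize (e j : ℕ) = k' at *
  unfold letterPairing
  split_ifs <;> omega

namespace LettersC

variable (S : LettersC b n)

theorem isChain (n : ℕ) :
    LetterSystem.IsChain n (2 * n) n (fun k => k) (fun k => k + 1) fun _ => 1 :=
  ⟨by omega, by omega, fun _ _ _ => ⟨rfl, rfl, rfl⟩⟩

theorem root_eq (i : b.support) : P.root i = S.L (S.lab i) - S.L (S.lab i + 1) := by
  simpa using S.smul_root i

/-- The last simple root is the difference of the letter `n` and its negative, hence twice that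
letter. -/
theorem coord_last (hn : 1 ≤ n) (i : b.support) :
    S.coord i n = if S.lab i = n then 1 / 2 else 0 := by
  have h1 := S.coord_sub_coord i hn le_rfl
  have h2 := S.coord_mirror i hn (by omega)
  rw [show 2 * n + 1 - n = n + 1 by omega] at h2
  rw [h2] at h1
  split_ifs at h1 ⊢ <;> push_cast at h1 <;> linarith

theorem repr_eq (x : Cell n false) (i : b.support) :
    b.toWeightBasis.repr (S.L x.i - S.L (x.j + 1)) i = Cell.coeffC x (S.lab i) := by
  have hx1 := x.one_le
  have hx2 := x.le_j
  have hx3 := x.sum_le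
  have hl1 := S.one_le_lab i
  have hl2 := S.lab_le i
  rw [LetterSystem.repr_sub, (isChain n).coord_eq i hx1 (by omega), coord_last S (by omega)]
  unfold Cell.coeffC
  by_cases hj : x.j + 1 ≤ n
  · rw [(isChain n).coord_eq i (by omega) hj, coord_last S (by omega)]
    split_ifs <;> first | omega | (push_cast; ring)
  · have h2 := S.coord_mirror i (t := 2 * n - x.j) (by omega) (by omega)
    rw [show 2 * n + 1 - (2 * n - x.j) = x.j + 1 by omega] at h2
    rw [h2, (isChain n).coord_eq i (by omega) (by omega), coord_last S (by omega)]
    split_ifs <;> first | omega | (push_cast; ring)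

theorem exists_isRootOfLength (hn : 2 ≤ n) : ∃ len : Bool → ℝ, ∀ x : Cell n false,
    S.IsRootOfLength (len (decide (x.i + x.j = 2 * n))) x.i (x.j + 1) := by
  obtain ⟨i, -, h⟩ := (isChain n).exists_isRootOfLength (S := S) hn
  obtain ⟨i', -, h'⟩ := LetterSystem.exists_isRootOfLength S (k := n) (by omega) le_rfl
    (fun i hi => by simpa [hi] using S.root_eq i)
  refine ⟨fun t => if t then P.RootForm (P.root i') (P.root i') else
    P.RootForm (P.root i) (P.root i), fun x => ?_⟩
  have hx1 := x.one_le
  have hx2 := x.le_j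
  have hx3 := x.sum_le
  by_cases hx : x.i + x.j = 2 * n
  · simp only [hx, decide_true, if_true]
    -- Starting from the last simple root, consecutive transpositions move both letters outwards and
    -- keep them mirror images.
    have key : ∀ d, d < n → S.IsRootOfLength (P.RootForm (P.root i') (P.root i')) (n - d)
        (n + 1 + d) := by
      intro d
      induction d with
      | zero => exact fun _ => h'
      | succ d ih =>
        intro hd
        refine (ih (by omega)).swap (k := n - (d + 1)) (by omega) (by omega) (by omega) (by omega)
          ?_ ?_ <;> unfold letterSwap <;> split_ifs <;> omega
    have h2 := key (n - x.i) (by omega)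
    rwa [show n - (n - x.i) = x.i by omega, show n + 1 + (n - x.i) = x.j + 1 by omega] at h2
  · simp only [hx, decide_false, Bool.false_eq_true, if_false]
    by_cases hj : x.j + 1 ≤ n
    · exact (isChain n).isRootOfLength h hx1 (by omega) hj
    · refine (isChain n).isRootOfLength_of_le (t₀ := n + 1) (by omega) (by omega) (fun s h1 h2 => ?_)
        hx1 (by omega) (by omega)
      refine ((isChain n).isRootOfLength h h1 (t := n) (by omega) le_rfl).swap (k := n) (by omega)
        le_rfl (by omega) (by omega) ?_ ?_ <;> unfold letterSwap <;> split_ifs <;> omega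

theorem exists_root_eq_or_eq_neg [P.IsReduced] (m : ι) :
    (∃ x : Cell n false, P.root m = S.L x.i - S.L (x.j + 1)) ∨
      ∃ x : Cell n false, P.root m = -(S.L x.i - S.L (x.j + 1)) := by
  -- A pair of letters with too large a sum is replaced by its mirror image in reversed order, which
  -- has the same difference.
  have key : ∀ s t, 1 ≤ s → s < t → t ≤ 2 * n →
      ∃ x : Cell n false, S.L s - S.L t = S.L x.i - S.L (x.j + 1) := by
    intro s t hs hst ht
    by_cases h : s + t ≤ 2 * n + 1
    · exact ⟨⟨s, t - 1, false, hs, by omega, by omega, by simp⟩, by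
        rw [show t - 1 + 1 = t by omega]⟩
    · refine ⟨⟨2 * n + 1 - t, 2 * n - s, false, by omega, by omega, by omega, by simp⟩, ?_⟩
      change _ = S.L (2 * n + 1 - t) - S.L (2 * n - s + 1)
      rw [show 2 * n - s + 1 = 2 * n + 1 - s by omega, S.L_mirror t (by omega) ht,
        S.L_mirror s hs (by omega)]
      abel
  obtain ⟨s, t, ⟨h1, h2, h3, h4, h5⟩, hm⟩ := S.exists_root_eq
    (p := fun s t => 1 ≤ s ∧ s ≤ 2 * n ∧ 1 ≤ t ∧ t ≤ 2 * n ∧ s ≠ t)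
    (fun s t h => ⟨h.2.2.1, h.2.2.2.1, h.1, h.2.1, h.2.2.2.2.symm⟩) (fun s t h => ⟨h.1, h.2.1⟩)
    (fun k h1 hk s t ⟨hs, hs', ht, ht', hne⟩ =>
      have h := letterSwap_mem (N := 2 * n) (x := k) (y := k + 1) h1 (by omega) (by omega)
        (by omega) hs hs'
      have h' := letterSwap_mem (N := 2 * n) (x := k) (y := k + 1) h1 (by omega) (by omega)
        (by omega) ht ht'
      ⟨h.1, h.2, h'.1, h'.2, letterSwap_ne (by omega) (by omega) (by omega) (by omega)
        (by omega) hne⟩)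
    (fun i => ⟨S.lab i, S.lab i + 1, by have := S.one_le_lab i; have := S.lab_le i; omega,
      S.root_eq i⟩) m
  rcases lt_or_gt_of_ne h5 with h | h
  · obtain ⟨x, hx⟩ := key s t h1 h h4
    exact Or.inl ⟨x, hm.trans hx⟩
  · obtain ⟨x, hx⟩ := key t s h3 h h2
    exact Or.inr ⟨x, by rw [hm, ← hx, neg_sub]⟩

theorem nonempty_facts [P.IsReduced] (hn : 2 ≤ n) (S : LettersC b n) :
    Nonempty (RootPosetFacts b (2 * n)) := by
  obtain ⟨len, hlen⟩ := S.exists_isRootOfLength hn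
  obtain ⟨F, hF⟩ := exists_orderIso_posRoot (b := b) (fun x : Cell n false => S.L x.i - S.L (x.j + 1))
    (fun x i => Cell.coeffC x (S.lab i)) S.repr_eq
    (fun x y => by
      rw [Cell.le_iff_coeffC]
      exact (LetterSystem.forall_lab (S := S)
        (p := fun k => Cell.coeffC x k ≤ Cell.coeffC y k)).symm)
    (fun x => (hlen x).1) S.exists_root_eq_or_eq_neg
  refine nonempty_rootPosetFacts hn F (fun x => x.i + x.j = 2 * n) len (fun z => ?_) (fun A => ?_)
    fun A => ?_
  · rw [(hF z (F z)).2 rfl]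
    convert (hlen (F z)).2
  · rw [S.card_support]
    exact (Cell.card_single (by omega) A).1
  · have hsimple : ∀ i, (F (PosRoot.simple i)).i + (F (PosRoot.simple i)).j = 2 * n ↔
        S.lab i = n := fun i => by
      have h1 := S.one_le_lab i
      have h2 := S.lab_le i
      rw [(hF (PosRoot.simple i) ⟨S.lab i, S.lab i, false, h1, le_rfl, by omega, by simp⟩).1
        (S.root_eq i)]
      change S.lab i + S.lab i = 2 * n ↔ _
      omega
    have hsplit : ∀ B : Antichains (Cell n false),
        (B.1.filter fun x => x.i + x.j = 2 * n).card = Cell.symUp B + Cell.centre B := fun B => by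
      rw [Cell.symUp, Cell.centre, ← Finset.card_union_of_disjoint]
      · congr 1
        ext x
        have := x.le_j
        simp only [Finset.mem_filter, Finset.mem_union, ← and_or_left]
        refine and_congr_right fun _ => ?_
        omega
      · refine Finset.disjoint_left.2 fun x hx hx' => ?_
        simp only [Finset.mem_filter] at hx hx'
        omega
    simp only [hsimple]
    rw [S.card_filter_lab (by omega) le_rfl]
    have h := (Cell.card_single (by omega) A).2
    rw [← hsplit, ← hsplit] at h
    convert h

end LettersC

end TypeC

/-! ### Type B -/

section TypeB

variable {ι M N' : Type*} [Fintype ι] [AddCommGroup M] [Module ℝ M] [AddCommGroup N']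
  [Module ℝ N'] {P : RootPairing ι ℝ M N'} [P.IsRootSystem] [P.IsCrystallographic]
  {b : P.Base} {n : ℕ}

theorem letterPairing_of_add_le {N x y t : ℕ} (hx : t + x ≤ N) (hy : t + y ≤ N) :
    letterPairing N x y t = if t = x then 1 else if t = y then -1 else 0 := by
  rw [letterPairing, if_neg (c := t + y = N + 1) (by omega),
    if_neg (c := t + x = N + 1) (by omega)]

/-- The letters in type `B n`. -/
abbrev LettersB (b : P.Base) (n : ℕ) : Type _ :=
  LetterSystem b n (2 * n + 1) (fun k => k) (fun k => if k = n then n + 2 else k + 1)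
    fun k => if k = n then 2 else 1

theorem nonempty_lettersB (h : HasType b (.B n)) : Nonempty (LettersB b n) := by
  obtain ⟨e, he⟩ : ∃ e : b.support ≃ Fin n, ∀ i j,
    b.cartanMatrix i j = CartanMatrix.B n (e i) (e j) := h
  refine exists_letterSystem e (fun k h1 h2 => by split_ifs <;> omega) fun i j => ?_
  rw [he i j, CartanMatrix.B, Matrix.of_apply]
  simp only [Fin.ext_iff]
  have hi := (e i).isLt
  have hj := (e j).isLt
  generalize (e i : ℕ) = k at *
  generalize (e j : ℕ) = k' at *
  by_cases h1 : k + 1 = n <;> by_cases h2 : k' + 1 = n <;>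
    simp only [h1, h2, if_true, if_false]
  · rw [if_pos (by omega)]
    unfold letterPairing
    split_ifs <;> omega
  · rw [letterPairing_of_add_le (by omega) (by omega)]
    unfold letterPairing
    split_ifs <;> omega
  · rw [letterPairing_of_add_le (by omega) (by omega)]
    unfold letterPairing
    split_ifs <;> omega
  · rw [letterPairing_of_add_le (by omega) (by omega),
      letterPairing_of_add_le (by omega) (by omega)]
    split_ifs <;> omega

namespace LettersB

variable (S : LettersB b n)

theorem isChain (n : ℕ) :
    LetterSystem.IsChain n (2 * n + 1) n (fun k => k) (fun k => if k = n then n + 2 else k + 1)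
      fun k => if k = n then 2 else 1 :=
  ⟨by omega, by omega, fun k _ h => ⟨rfl, if_neg h.ne, if_neg h.ne⟩⟩

theorem L_middle : S.L (n + 1) = 0 := by
  have h := S.L_mirror (n + 1) (by omega) (by omega)
  rw [show 2 * n + 1 + 1 - (n + 1) = n + 1 by omega] at h
  have h2 : (2 : ℝ) • S.L (n + 1) = 0 := by
    rw [two_smul, add_eq_zero_iff_eq_neg]
    exact h
  exact (smul_eq_zero.1 h2).resolve_left two_ne_zero

/-- The middle letter is zero, so the last simple root, half of `L n - L (n + 2)`, is also a
difference of consecutive letters. -/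
theorem root_eq (i : b.support) : P.root i = S.L (S.lab i) - S.L (S.lab i + 1) := by
  by_cases hi : S.lab i = n
  · have h := S.smul_root i
    have h1 := S.L_mirror n (by have := S.one_le_lab i; omega) (by omega)
    rw [show 2 * n + 1 + 1 - n = n + 2 by omega] at h1
    simp only [hi, if_true] at h
    rw [h1, sub_neg_eq_add, ← two_smul ℝ] at h
    rw [hi, L_middle, sub_zero]
    exact smul_right_injective M (two_ne_zero' ℝ) (by simpa using h)
  · exact (isChain n).root_eq i (by have := S.lab_le i; omega)

theorem coord_middle (i : b.support) : S.coord i (n + 1) = 0 := by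
  simp [LetterSystem.coord, L_middle]

theorem coord_last (hn : 1 ≤ n) (i : b.support) :
    S.coord i n = if S.lab i = n then 1 else 0 := by
  have h1 := S.coord_sub_coord i hn le_rfl
  have h2 := S.coord_mirror i hn (by omega)
  rw [show 2 * n + 1 + 1 - n = n + 2 by omega] at h2
  simp only [if_true] at h1
  rw [h2] at h1
  split_ifs at h1 ⊢ <;> push_cast at h1 <;> linarith

theorem repr_eq (x : Cell n false) (i : b.support) :
    b.toWeightBasis.repr (S.L x.i - S.L (x.j + 1)) i = Cell.coeffB x (S.lab i) := by
  have hx1 := x.one_le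
  have hx2 := x.le_j
  have hx3 := x.sum_le
  have hl1 := S.one_le_lab i
  have hl2 := S.lab_le i
  rw [LetterSystem.repr_sub, (isChain n).coord_eq i hx1 (by omega), coord_last S (by omega)]
  unfold Cell.coeffB
  rcases lt_trichotomy x.j n with hj | hj | hj
  · rw [(isChain n).coord_eq i (by omega) hj, coord_last S (by omega)]
    split_ifs <;> first | omega | (push_cast; ring)
  · rw [hj, coord_middle]
    split_ifs <;> first | omega | (push_cast; ring)
  · have h2 := S.coord_mirror i (t := 2 * n + 1 - x.j) (by omega) (by omega)
    rw [show 2 * n + 1 + 1 - (2 * n + 1 - x.j) = x.j + 1 by omega] at h2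
    rw [h2, (isChain n).coord_eq i (by omega) (by omega), coord_last S (by omega)]
    split_ifs <;> first | omega | (push_cast; ring)

theorem exists_isRootOfLength (hn : 2 ≤ n) : ∃ len : Bool → ℝ, ∀ x : Cell n false,
    S.IsRootOfLength (len (decide (x.j = n))) x.i (x.j + 1) := by
  obtain ⟨i, -, h⟩ := (isChain n).exists_isRootOfLength (S := S) hn
  obtain ⟨i', -, h'⟩ := LetterSystem.exists_isRootOfLength S (k := n) (by omega) le_rfl
    (fun i hi => by simpa [hi] using S.root_eq i)
  refine ⟨fun t => if t then P.RootForm (P.root i') (P.root i') else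
    P.RootForm (P.root i) (P.root i), fun x => ?_⟩
  have hx1 := x.one_le
  have hx2 := x.le_j
  have hx3 := x.sum_le
  by_cases hx : x.j = n
  · simp only [hx, decide_true, if_true]
    have key : ∀ d, d < n → S.IsRootOfLength (P.RootForm (P.root i') (P.root i')) (n - d)
        (n + 1) := by
      intro d
      induction d with
      | zero => exact fun _ => h'
      | succ d ih =>
        intro hd
        refine (isChain n).swap (ih (by omega)) (k := n - (d + 1)) (by omega) (by omega) (by omega)
          (by omega) ?_ ?_ <;> unfold letterSwap <;> split_ifs <;> omega
    have h2 := key (n - x.i) (by omega)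
    rwa [show n - (n - x.i) = x.i by omega] at h2
  · simp only [hx, decide_false, Bool.false_eq_true, if_false]
    by_cases hj : x.j + 1 ≤ n
    · exact (isChain n).isRootOfLength h hx1 (by omega) hj
    · refine (isChain n).isRootOfLength_of_le (t₀ := n + 2) (by omega) (by omega) (fun s h1 h2 => ?_)
        hx1 (by omega) (by omega)
      refine ((isChain n).isRootOfLength h h1 (t := n) (by omega) le_rfl).swap (k := n) (by omega)
        le_rfl (by omega) (by omega) ?_ ?_ <;> rw [if_pos rfl] <;> unfold letterSwap <;>
        split_ifs <;> omega

theorem exists_root_eq_or_eq_neg [P.IsReduced] (m : ι) :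
    (∃ x : Cell n false, P.root m = S.L x.i - S.L (x.j + 1)) ∨
      ∃ x : Cell n false, P.root m = -(S.L x.i - S.L (x.j + 1)) := by
  have key : ∀ s t, 1 ≤ s → s < t → t ≤ 2 * n + 1 → s + t ≠ 2 * n + 1 + 1 →
      ∃ x : Cell n false, S.L s - S.L t = S.L x.i - S.L (x.j + 1) := by
    intro s t hs hst ht hne
    by_cases h : s + t ≤ 2 * n + 1
    · exact ⟨⟨s, t - 1, false, hs, by omega, by omega, by simp⟩, by
        rw [show t - 1 + 1 = t by omega]⟩
    · refine ⟨⟨2 * n + 1 + 1 - t, 2 * n + 1 - s, false, by omega, by omega, by omega, by simp⟩, ?_⟩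
      change _ = S.L (2 * n + 1 + 1 - t) - S.L (2 * n + 1 - s + 1)
      rw [show 2 * n + 1 - s + 1 = 2 * n + 1 + 1 - s by omega, S.L_mirror t (by omega) ht,
        S.L_mirror s hs (by omega)]
      abel
  obtain ⟨s, t, ⟨h1, h2, h3, h4, h5, h6⟩, hm⟩ := S.exists_root_eq
    (p := fun s t => 1 ≤ s ∧ s ≤ 2 * n + 1 ∧ 1 ≤ t ∧ t ≤ 2 * n + 1 ∧ s ≠ t ∧ s + t ≠ 2 * n + 1 + 1)
    (fun s t h => by omega) (fun s t h => ⟨h.1, h.2.1⟩)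
    (fun k h1 hk s t ⟨hs, hs', ht, ht', hne, hne'⟩ => by
      obtain ⟨y, hy, hy1, hy2, hy3⟩ : ∃ y, (if k = n then n + 2 else k + 1) = y ∧ k < y ∧
          y ≤ 2 * n + 1 ∧ 2 * y ≠ 2 * n + 1 + 1 := ⟨_, rfl, by split_ifs <;> omega⟩
      rw [hy]
      have h := letterSwap_mem (N := 2 * n + 1) (x := k) (y := y) h1 (by omega) (by omega)
        (by omega) hs hs'
      have h' := letterSwap_mem (N := 2 * n + 1) (x := k) (y := y) h1 (by omega) (by omega)
        (by omega) ht ht'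
      exact ⟨h.1, h.2, h'.1, h'.2, letterSwap_ne (by omega) (by omega) (by omega) (by omega)
        (by omega) hne, letterSwap_add_ne (by omega) (by omega) (by omega) (by omega) hne'⟩)
    (fun i => ⟨S.lab i, S.lab i + 1, by have := S.one_le_lab i; have := S.lab_le i; omega,
      S.root_eq i⟩) m
  rcases lt_or_gt_of_ne h5 with h | h
  · obtain ⟨x, hx⟩ := key s t h1 h h4 h6
    exact Or.inl ⟨x, hm.trans hx⟩
  · obtain ⟨x, hx⟩ := key t s h3 h h2 (by omega)
    exact Or.inr ⟨x, by rw [hm, ← hx, neg_sub]⟩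

theorem nonempty_facts [P.IsReduced] (hn : 2 ≤ n) (S : LettersB b n) :
    Nonempty (RootPosetFacts b (2 * n)) := by
  obtain ⟨len, hlen⟩ := S.exists_isRootOfLength hn
  obtain ⟨F, hF⟩ := exists_orderIso_posRoot (b := b)
    (fun x : Cell n false => S.L x.i - S.L (x.j + 1))
    (fun x i => Cell.coeffB x (S.lab i)) S.repr_eq
    (fun x y => by
      rw [Cell.le_iff_coeffB]
      exact (LetterSystem.forall_lab (S := S)
        (p := fun k => Cell.coeffB x k ≤ Cell.coeffB y k)).symm)
    (fun x => (hlen x).1) S.exists_root_eq_or_eq_neg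
  refine nonempty_rootPosetFacts hn F (fun x => x.j = n) len (fun z => ?_) (fun A => ?_)
    fun A => ?_
  · rw [(hF z (F z)).2 rfl]
    convert (hlen (F z)).2
  · rw [S.card_support]
    exact (Cell.card_single (by omega) A).1
  · have hsimple : ∀ i, (F (PosRoot.simple i)).j = n ↔ S.lab i = n := fun i => by
      have h1 := S.one_le_lab i
      have h2 := S.lab_le i
      rw [(hF (PosRoot.simple i) ⟨S.lab i, S.lab i, false, h1, le_rfl, by omega, by simp⟩).1
        (S.root_eq i)]
    simp only [hsimple]
    rw [S.card_filter_lab (by omega) le_rfl]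
    have h := Cell.mid_add_mid_rvac (by omega) A
    rw [Cell.mid, Cell.mid] at h
    convert h

end LettersB

end TypeB

/-! ### Type D -/

/-- The right letter of the positive root in type `D`. -/
def Cell.right {c : ℕ} (x : Cell c true) : ℕ :=
  if x.j < c then x.j + 1 else if x.j = c then if x.s = true then c + 2 else c + 1 else x.j + 2

theorem cartan_D_eq {c k k' : ℕ} (hk : k < c + 1) (hk' : k' < c + 1) :
    (if k = k' then 2
    else if k + 1 = k' ∧ k' + 2 < c + 1 then -1
    else if k' + 1 = k ∧ k + 2 < c + 1 then -1
    else if k + 3 = c + 1 ∧ (k' + 2 = c + 1 ∨ k' + 1 = c + 1) then -1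
    else if k' + 3 = c + 1 ∧ (k + 2 = c + 1 ∨ k + 1 = c + 1) then -1
    else 0) =
      letterPairing (2 * c + 2) (if k' + 1 = c + 1 then c else k' + 1) (k' + 1 + 1)
          (if k + 1 = c + 1 then c else k + 1) -
        letterPairing (2 * c + 2) (if k' + 1 = c + 1 then c else k' + 1) (k' + 1 + 1)
          (k + 1 + 1) := by
  by_cases h1 : k + 1 = c + 1
  · rw [if_pos h1]
    by_cases h2 : k' + 1 = c + 1
    · rw [if_pos h2, if_pos (by omega)]
      unfold letterPairing
      split_ifs <;> omega
    · rw [if_neg h2, letterPairing_of_add_le (by omega) (by omega)]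
      unfold letterPairing
      split_ifs <;> omega
  · rw [if_neg h1]
    by_cases h2 : k' + 1 = c + 1
    · rw [if_pos h2, letterPairing_of_add_le (by omega) (by omega)]
      unfold letterPairing
      split_ifs <;> omega
    · rw [if_neg h2, letterPairing_of_add_le (by omega) (by omega),
        letterPairing_of_add_le (by omega) (by omega)]
      split_ifs <;> omega

section TypeD

variable {ι M N' : Type*} [Fintype ι] [AddCommGroup M] [Module ℝ M] [AddCommGroup N']
  [Module ℝ N'] {P : RootPairing ι ℝ M N'} [P.IsRootSystem] [P.IsCrystallographic]
  {b : P.Base} {c : ℕ}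

/-- The letters in type `D (c + 1)`. -/
abbrev LettersD (b : P.Base) (c : ℕ) : Type _ :=
  LetterSystem b (c + 1) (2 * c + 2) (fun k => if k = c + 1 then c else k) (fun k => k + 1)
    fun _ => 1

theorem nonempty_lettersD (hc : 2 ≤ c) (h : HasType b (.D (c + 1))) :
    Nonempty (LettersD b c) := by
  obtain ⟨e, he⟩ : ∃ e : b.support ≃ Fin (c + 1), ∀ i j,
    b.cartanMatrix i j = CartanMatrix.D (c + 1) (e i) (e j) := h
  refine exists_letterSystem e (fun k h1 h2 => by split_ifs <;> omega) fun i j => ?_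
  rw [he i j, CartanMatrix.D, Matrix.of_apply, if_neg (c := c + 1 ≤ 2) (by omega)]
  simp only [Fin.ext_iff, Nat.cast_one, one_mul]
  exact cartan_D_eq (e i).isLt (e j).isLt

namespace LettersD

variable (S : LettersD b c)

theorem isChain (c : ℕ) :
    LetterSystem.IsChain (c + 1) (2 * c + 2) (c + 1) (fun k => if k = c + 1 then c else k)
      (fun k => k + 1) fun _ => 1 :=
  ⟨by omega, by omega, fun k _ h => ⟨if_neg h.ne, rfl, rfl⟩⟩

theorem root_eq_last (i : b.support) (hi : S.lab i = c + 1) :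
    P.root i = S.L c - S.L (c + 2) := by
  have h := S.smul_root i
  simpa [hi] using h

/-- The last two simple roots are the difference and the sum of the letters `c` and `c + 1`, so the
letter `c + 1` is half of their difference. -/
theorem coord_last (hc : 1 ≤ c) (i : b.support) :
    S.coord i (c + 1) =
      ((if S.lab i = c + 1 then 1 else 0) - if S.lab i = c then 1 else 0) / 2 := by
  have h1 := S.coord_sub_coord i (k := c + 1) (by omega) le_rfl
  have h2 := S.coord_mirror i (t := c + 1) (by omega) (by omega)
  have h3 := (isChain c).coord_eq (S := S) i hc (by omega)
  rw [show 2 * c + 2 + 1 - (c + 1) = c + 2 by omega] at h2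
  simp only [if_true] at h1
  rw [h2, h3] at h1
  split_ifs at h1 ⊢ <;> first | omega | (push_cast at h1; linarith)

theorem repr_eq (hc : 1 ≤ c) (x : Cell c true) (i : b.support) :
    b.toWeightBasis.repr (S.L x.i - S.L x.right) i = Cell.coeffD x (S.lab i) := by
  have hx1 := x.one_le
  have hx2 := x.le_j
  have hx3 := x.sum_le
  have hl1 := S.one_le_lab i
  have hl2 := S.lab_le i
  rw [LetterSystem.repr_sub, (isChain c).coord_eq i hx1 (by omega)]
  rcases Cell.coeffD_cases x with ⟨hx, h⟩ | ⟨hx, hs, h⟩ | ⟨hx, hs, h⟩ | ⟨hx, h⟩ <;> rw [h]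
  · have hr : x.right = x.j + 1 := by rw [Cell.right, if_pos hx]
    rw [hr, (isChain c).coord_eq i (t := x.j + 1) (by omega) (by omega)]
    split_ifs <;> first | omega | (push_cast; ring)
  · have hr : x.right = c + 1 := by
      rw [Cell.right, if_neg (by omega), if_pos hx, if_neg (by rw [hs]; simp)]
    rw [hr]
    split_ifs <;> first | omega | (push_cast; ring)
  · have hr : x.right = c + 2 := by rw [Cell.right, if_neg (by omega), if_pos hx, if_pos hs]
    have h2 := S.coord_mirror i (t := c + 1) (by omega) (by omega)
    rw [show 2 * c + 2 + 1 - (c + 1) = c + 2 by omega] at h2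
    rw [hr, h2, coord_last S hc]
    split_ifs <;> first | omega | (push_cast; ring)
  · have hr : x.right = x.j + 2 := by rw [Cell.right, if_neg (by omega), if_neg (by omega)]
    have h2 := S.coord_mirror i (t := 2 * c + 1 - x.j) (by omega) (by omega)
    rw [show 2 * c + 2 + 1 - (2 * c + 1 - x.j) = x.j + 2 by omega] at h2
    rw [hr, h2, (isChain c).coord_eq i (t := 2 * c + 1 - x.j) (by omega) (by omega),
      coord_last S hc]
    split_ifs <;> first | omega | (push_cast; ring)

theorem exists_isRootOfLength (hc : 2 ≤ c) :
    ∃ l : ℝ, ∀ x : Cell c true, S.IsRootOfLength l x.i x.right := by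
  obtain ⟨i, -, h⟩ := (isChain c).exists_isRootOfLength (S := S) (by omega)
  refine ⟨P.RootForm (P.root i) (P.root i), fun x => ?_⟩
  have hx1 := x.one_le
  have hx2 := x.le_j
  have hx3 := x.sum_le
  have hr : x.i < x.right ∧ x.i + x.right ≤ 2 * c + 2 := by
    unfold Cell.right
    split_ifs <;> omega
  by_cases hj : x.right ≤ c + 1
  · exact (isChain c).isRootOfLength h hx1 hr.1 hj
  -- The last reflection sends the letter `c` to `c + 2` and fixes letters `s < c`. The pair `(c, c
  -- + 2)` is reached afterwards by a transposition.
  · have key : ∀ s, 1 ≤ s → s < c →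
        S.IsRootOfLength (P.RootForm (P.root i) (P.root i)) s (c + 2) := fun s h1 h2 => by
      refine ((isChain c).isRootOfLength h h1 h2 (by omega)).swap (k := c + 1) (by omega)
        le_rfl (by omega) (by omega) ?_ ?_ <;> rw [if_pos rfl] <;> unfold letterSwap <;>
        split_ifs <;> omega
    refine (isChain c).isRootOfLength_of_le (t₀ := c + 2) (by omega) (by omega) (fun s h1 h2 => ?_)
      hx1 (by omega) (by omega)
    rcases (show s ≤ c by omega).lt_or_eq with hs | rfl
    · exact key s h1 hs
    · refine (isChain s).swap (key (s - 1) (by omega) (by omega)) (k := s - 1) (by omega)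
        (by omega) (by omega) (by omega) ?_ ?_ <;> unfold letterSwap <;> split_ifs <;> omega

theorem exists_cell {s t : ℕ} (hs : 1 ≤ s) (hst : s < t) (h : s + t ≤ 2 * c + 2) :
    ∃ x : Cell c true, x.i = s ∧ x.right = t := by
  rcases lt_trichotomy t (c + 2) with ht | ht | ht
  · refine ⟨⟨s, t - 1, false, hs, by omega, by omega, by simp⟩, rfl, ?_⟩
    simp only [Cell.right, Bool.false_eq_true, if_false]
    split_ifs <;> omega
  · refine ⟨⟨s, c, true, hs, by omega, by omega, by simp⟩, rfl, ?_⟩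
    simp [Cell.right, ht]
  · refine ⟨⟨s, t - 2, false, hs, by omega, by omega, by simp⟩, rfl, ?_⟩
    simp only [Cell.right]
    split_ifs <;> omega

theorem exists_root_eq_or_eq_neg [P.IsReduced] (hc : 1 ≤ c) (m : ι) :
    (∃ x : Cell c true, P.root m = S.L x.i - S.L x.right) ∨
      ∃ x : Cell c true, P.root m = -(S.L x.i - S.L x.right) := by
  have key : ∀ s t, 1 ≤ s → s < t → t ≤ 2 * c + 2 → s + t ≠ 2 * c + 2 + 1 →
      ∃ x : Cell c true, S.L s - S.L t = S.L x.i - S.L x.right := by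
    intro s t hs hst ht hne
    by_cases h : s + t ≤ 2 * c + 2
    · obtain ⟨x, rfl, rfl⟩ := exists_cell hs hst h
      exact ⟨x, rfl⟩
    · obtain ⟨x, hx, hx'⟩ := exists_cell (c := c) (s := 2 * c + 2 + 1 - t) (t := 2 * c + 2 + 1 - s)
        (by omega) (by omega) (by omega)
      refine ⟨x, ?_⟩
      rw [hx, hx', S.L_mirror t (by omega) ht, S.L_mirror s hs (by omega)]
      abel
  obtain ⟨s, t, ⟨h1, h2, h3, h4, h5, h6⟩, hm⟩ := S.exists_root_eq
    (p := fun s t => 1 ≤ s ∧ s ≤ 2 * c + 2 ∧ 1 ≤ t ∧ t ≤ 2 * c + 2 ∧ s ≠ t ∧ s + t ≠ 2 * c + 2 + 1)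
    (fun s t h => by omega) (fun s t h => ⟨h.1, h.2.1⟩)
    (fun k h1 hk s t ⟨hs, hs', ht, ht', hne, hne'⟩ => by
      obtain ⟨y, hy, hy1, hy2⟩ : ∃ y, (if k = c + 1 then c else k) = y ∧ 1 ≤ y ∧ y ≤ k :=
        ⟨_, rfl, by split_ifs <;> omega⟩
      rw [hy]
      have h := letterSwap_mem (N := 2 * c + 2) (x := y) (y := k + 1) hy1 (by omega) (by omega)
        (by omega) hs hs'
      have h' := letterSwap_mem (N := 2 * c + 2) (x := y) (y := k + 1) hy1 (by omega) (by omega)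
        (by omega) ht ht'
      exact ⟨h.1, h.2, h'.1, h'.2, letterSwap_ne (by omega) (by omega) (by omega) (by omega)
        (by omega) hne, letterSwap_add_ne (by omega) (by omega) (by omega) (by omega) hne'⟩)
    (fun i => by
      have h1 := S.one_le_lab i
      rcases (S.lab_le i).lt_or_eq with hi | hi
      · exact ⟨S.lab i, S.lab i + 1, by omega, (isChain c).root_eq i hi⟩
      · exact ⟨c, c + 2, by omega, S.root_eq_last i hi⟩) m
  rcases lt_or_gt_of_ne h5 with h | h
  · obtain ⟨x, hx⟩ := key s t h1 h h4 h6
    exact Or.inl ⟨x, hm.trans hx⟩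
  · obtain ⟨x, hx⟩ := key t s h3 h h2 (by omega)
    exact Or.inr ⟨x, by rw [hm, ← hx, neg_sub]⟩

theorem nonempty_facts [P.IsReduced] (hc : 2 ≤ c) (S : LettersD b c) :
    Nonempty (RootPosetFacts b (2 * c)) := by
  obtain ⟨l, hl⟩ := S.exists_isRootOfLength hc
  obtain ⟨F, hF⟩ := exists_orderIso_posRoot (b := b)
    (fun x : Cell c true => S.L x.i - S.L x.right)
    (fun x i => Cell.coeffD x (S.lab i)) (S.repr_eq (by omega))
    (fun x y => by
      rw [Cell.le_iff_coeffD]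
      exact (LetterSystem.forall_lab (S := S)
        (p := fun k => Cell.coeffD x k ≤ Cell.coeffD y k)).symm)
    (fun x => (hl x).1) (S.exists_root_eq_or_eq_neg (by omega))
  refine nonempty_rootPosetFacts hc F (fun _ => False) (fun _ => l) (fun z => ?_) (fun A => ?_)
    fun A => by simp
  · rw [(hF z (F z)).2 rfl]
    exact (hl (F z)).2
  · rw [S.card_support]
    exact Cell.card_double (by omega) A

end LettersD

end TypeD

/-! ### Type A, inside the interval model of one larger size -/

section TypeA

variable {ι M N' : Type*} [Fintype ι] [AddCommGroup M] [Module ℝ M] [AddCommGroup N']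
  [Module ℝ N'] {P : RootPairing ι ℝ M N'} [P.IsRootSystem] [P.IsCrystallographic]
  {b : P.Base} {n : ℕ}

/-- The letters in type `A n`. -/
abbrev LettersA (b : P.Base) (n : ℕ) : Type _ :=
  LetterSystem b n (2 * n + 2) (fun k => k) (fun k => k + 1) fun _ => 1

/-- The intervals in `1, …, n`. -/
abbrev IntervalCell (n : ℕ) : Type := {x : Cell (n + 1) false // x.j < n + 1}

theorem nonempty_lettersA (h : HasType b (.A n)) : Nonempty (LettersA b n) := by
  obtain ⟨e, he⟩ : ∃ e : b.support ≃ Fin n, ∀ i j,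
    b.cartanMatrix i j = CartanMatrix.A n (e i) (e j) := h
  refine exists_letterSystem e (fun k h1 h2 => by omega) fun i j => ?_
  rw [he i j, CartanMatrix.A, Matrix.of_apply]
  simp only [Fin.ext_iff]
  have hi := (e i).isLt
  have hj := (e j).isLt
  generalize (e i : ℕ) = k at *
  generalize (e j : ℕ) = k' at *
  rw [letterPairing_of_add_le (by omega) (by omega),
    letterPairing_of_add_le (by omega) (by omega)]
  split_ifs <;> omega

namespace LettersA

variable (S : LettersA b n)

theorem isChain (n : ℕ) :
    LetterSystem.IsChain n (2 * n + 2) (n + 1) (fun k => k) (fun k => k + 1) fun _ => 1 :=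
  ⟨le_rfl, by omega, fun _ _ _ => ⟨rfl, rfl, rfl⟩⟩

theorem repr_eq (x : IntervalCell n) (i : b.support) :
    b.toWeightBasis.repr (S.L x.1.i - S.L (x.1.j + 1)) i =
      ((if x.1.i ≤ S.lab i ∧ S.lab i ≤ x.1.j then 1 else 0 : ℕ) : ℝ) := by
  have hx1 := x.1.one_le
  have hx2 := x.1.le_j
  have hx3 := x.2
  have hl1 := S.one_le_lab i
  have hl2 := S.lab_le i
  rw [LetterSystem.repr_sub, (isChain n).coord_eq i (t := x.1.i) hx1 (by omega),
    (isChain n).coord_eq i (t := x.1.j + 1) (by omega) (by omega)]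
  split_ifs <;> first | omega | (push_cast; ring)

theorem exists_root_eq_or_eq_neg [P.IsReduced] (m : ι) :
    (∃ x : IntervalCell n, P.root m = S.L x.1.i - S.L (x.1.j + 1)) ∨
      ∃ x : IntervalCell n, P.root m = -(S.L x.1.i - S.L (x.1.j + 1)) := by
  have key : ∀ s t, 1 ≤ s → s < t → t ≤ n + 1 →
      ∃ x : IntervalCell n, S.L s - S.L t = S.L x.1.i - S.L (x.1.j + 1) := by
    intro s t hs hst ht
    refine ⟨⟨⟨s, t - 1, false, hs, by omega, by omega, by simp⟩, ?_⟩, ?_⟩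
    · change t - 1 < n + 1
      omega
    · rw [show t - 1 + 1 = t by omega]
  -- Only the letters `1, …, n + 1` occur; their negatives merely complete the common framework.
  obtain ⟨s, t, ⟨h1, h2, h3, h4, h5⟩, hm⟩ := S.exists_root_eq
    (p := fun s t => 1 ≤ s ∧ s ≤ n + 1 ∧ 1 ≤ t ∧ t ≤ n + 1 ∧ s ≠ t)
    (fun s t h => by omega) (fun s t h => by omega)
    (fun k h1 hk s t h => by
      unfold letterSwap
      split_ifs <;> omega)
    (fun i => ⟨S.lab i, S.lab i + 1, by have := S.one_le_lab i; have := S.lab_le i; omega,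
      (isChain n).root_eq i (by have := S.lab_le i; omega)⟩) m
  rcases lt_or_gt_of_ne h5 with h | h
  · obtain ⟨x, hx⟩ := key s t h1 h h4
    exact Or.inl ⟨x, hm.trans hx⟩
  · obtain ⟨x, hx⟩ := key t s h3 h h2
    exact Or.inr ⟨x, by rw [hm, ← hx, neg_sub]⟩

theorem nonempty_facts [P.IsReduced] (hn : 1 ≤ n) (S : LettersA b n) :
    Nonempty (RootPosetFacts b (n + 1)) := by
  obtain ⟨i, -, h⟩ := (isChain n).exists_isRootOfLength (S := S) (by omega)
  have hl : ∀ x : IntervalCell n,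
      S.IsRootOfLength (P.RootForm (P.root i) (P.root i)) x.1.i (x.1.j + 1) := fun x =>
    (isChain n).isRootOfLength h x.1.one_le (Nat.lt_succ_of_le x.1.le_j) x.2
  obtain ⟨F, hF⟩ := exists_orderIso_posRoot (b := b)
    (fun x : IntervalCell n => S.L x.1.i - S.L (x.1.j + 1)) _ S.repr_eq
    (fun x y => by
      rw [← Subtype.coe_le_coe, Cell.le_iff_interval x.1 y.1 x.2]
      refine Iff.trans ?_ (LetterSystem.forall_lab (S := S) (p := fun k =>
        (if x.1.i ≤ k ∧ k ≤ x.1.j then 1 else 0) ≤ if y.1.i ≤ k ∧ k ≤ y.1.j then 1 else 0)).symm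
      simp only [Nat.lt_succ_iff])
    (fun x => (hl x).1) S.exists_root_eq_or_eq_neg
  let g : PosRoot b Finset.univ ↪o Cell (n + 1) false :=
    F.toOrderEmbedding.trans (OrderEmbedding.subtype _)
  have hg : ∀ y, (∃ z, g z = y) ↔ y.j < n + 1 := fun y =>
    ⟨fun ⟨z, hz⟩ => hz ▸ (F z).2, fun hy => ⟨F.symm ⟨y, hy⟩, congrArg Subtype.val (F.apply_symm_apply ⟨y, hy⟩)⟩⟩
  let α : Cell (n + 1) false := ⟨n + 1, n + 1, false, by omega, le_rfl, by omega, by simp⟩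
  let t : Cell (n + 1) false := ⟨1, n, false, le_rfl, hn, by omega, by simp⟩
  obtain ⟨top, htop⟩ := (hg t).2 (Nat.lt_succ_self n)
  have hα : ∀ y : Cell (n + 1) false, y.j < n + 1 ↔ ¬ α ≤ y := fun y => by
    rw [Cell.le_def, y.s_eq_false']
    have h1 := y.le_j
    have h2 := y.sum_le
    change _ ↔ ¬ (y.i ≤ n + 1 ∧ n + 1 ≤ y.j ∧ (_ → _ → false = false))
    simp only [implies_true, and_true]
    omega
  refine ⟨⟨top, fun z => ?_, ?_, fun A => ?_, fun _ => False,
    fun _ => P.RootForm (P.root i) (P.root i), fun z => ?_, fun A => by simp⟩⟩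
  · rw [← g.le_iff_le, htop, Cell.le_def]
    exact ⟨(g z).one_le, Nat.le_of_lt_succ (F z).2, fun _ _ => (g z).s_eq_false'⟩
  · rw [← rank_orderEmbedding g (fun x y hy => (hg y).2 (lt_of_le_of_lt hy.2.1 (F x).2)), htop,
      Cell.rank_eq]
    change n - 1 + 2 = _
    omega
  -- The intervals not containing `n + 1` form the complement of the filter of the minimal interval
  -- `α`. Rowvacuation in the larger model therefore adds just `α`, and the total there is `n + 1`,
  -- one more than wanted.
  · have hmem : ∀ y, y ∈ (rvac (Antichains.map g A)).1 ↔
        y = α ∨ ∃ x ∈ (rvac A).1, g x = y := by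
      refine mem_rvac_iff_of_minimal g (fun y hy => ?_) (fun y => by rw [hg, hα]) (fun x => ?_)
        fun a ha => ?_
      · have h1 : n + 1 ≤ y.i := hy.1
        have h2 : y.j ≤ n + 1 := hy.2.1
        have h3 := y.le_j
        exact Cell.ext (show y.i = n + 1 by omega) (show y.j = n + 1 by omega) y.s_eq_false'
      · rw [Antichains.mem_map]
        exact ⟨fun ⟨z, hz, h⟩ => g.injective h ▸ hz, fun h => ⟨x, h, rfl⟩⟩
      · obtain ⟨x, -, rfl⟩ := (Antichains.mem_map g A a).1 ha
        exact (hα _).1 (F x).2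
    have hrvac : (rvac (Antichains.map g A)).1 = insert α (Antichains.map g (rvac A)).1 := by
      ext y
      rw [hmem, Finset.mem_insert, Antichains.mem_map]
    have hnot : α ∉ (Antichains.map g (rvac A)).1 := fun hc => by
      obtain ⟨x, -, hx⟩ := (Antichains.mem_map g _ _).1 hc
      exact (hα _).1 ((hg _).1 ⟨x, hx⟩) le_rfl
    have hcard := (Cell.card_single (by omega) (Antichains.map g A)).1
    rw [hrvac, Finset.card_insert_of_notMem hnot, ← NN.card_roots, ← NN.card_roots] at hcard
    rw [S.card_support]
    omega
  · rw [(hF z (F z)).2 rfl]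
    exact (hl (F z)).2

end LettersA

end TypeA

/-! ### Assembling the types -/

section Main

variable {ι M N : Type*} [Fintype ι] [AddCommGroup M] [Module ℝ M] [AddCommGroup N] [Module ℝ N]
  {P : RootPairing ι ℝ M N} [P.IsRootSystem] [P.IsCrystallographic] [P.IsReduced] {b : P.Base}

theorem nonempty_facts_of_hasType {X : ClassicalType} (hX : X.Admissible) (h : HasType b X) :
    Nonempty (RootPosetFacts b X.coxeterNumber) := by
  cases X with
  | A n =>
    obtain ⟨S⟩ := nonempty_lettersA h
    exact S.nonempty_facts hX
  | B n =>
    obtain ⟨S⟩ := nonempty_lettersB h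
    exact S.nonempty_facts hX
  | C n =>
    obtain ⟨S⟩ := nonempty_lettersC h
    exact S.nonempty_facts hX
  | D n =>
    have hn : 4 ≤ n := hX
    obtain ⟨c, rfl⟩ : ∃ c, n = c + 1 := ⟨n - 1, by omega⟩
    obtain ⟨S⟩ := nonempty_lettersD (by omega) h
    exact S.nonempty_facts (by omega)

theorem RootPosetFacts.rvac_rankLevel {h : ℕ} (T : RootPosetFacts b h) {i : ℕ} (hi : i ≤ h - 1) :
    rvac (rankLevel (PosRoot b Finset.univ) i) =
      rankLevel (PosRoot b Finset.univ) (h - 1 - i) := by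
  have h1 := T.rank_top
  rw [Rowvacuation.rvac_rankLevel PosRoot.isRanked T.le_top (by omega)]
  congr 1
  omega

end Main

end Rowvacuation

end

open Rowvacuation in
theorem mainTheorem1 {ι M N : Type*} [Fintype ι]
    [AddCommGroup M] [Module ℝ M] [AddCommGroup N] [Module ℝ N]
    (P : RootPairing ι ℝ M N) [P.IsRootSystem] [P.IsCrystallographic] [P.IsReduced]
    (b : P.Base) :
    (∀ J : Finset b.support,
      IsRanked (PosRoot b J) ∧ Function.Involutive (rvac : NN b J → NN b J)) ∧
    (∀ J J' J'' : Finset b.support, Disjoint J' J'' → J' ∪ J'' = J →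
      (∀ i ∈ J', ∀ j ∈ J'', P.pairing i j = 0) →
      ∀ A : NN b J, ∃ (A' : NN b J') (A'' : NN b J''),
        (∀ i, i ∈ NN.roots A' ↔ i ∈ NN.roots A ∧ P.root i ∈ simpleCone b J') ∧
        (∀ i, i ∈ NN.roots A'' ↔ i ∈ NN.roots A ∧ P.root i ∈ simpleCone b J'') ∧
        NN.roots (rvac A) = NN.roots (rvac A') ∪ NN.roots (rvac A'')) ∧
    ∀ X : ClassicalType, X.Admissible → HasType b X →
      (∀ A : NN b Finset.univ,
        (NN.roots A).card + (NN.roots (rvac A)).card = Module.finrank ℝ M) ∧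
      (∀ (A : NN b Finset.univ) (c : ℝ),
        ((NN.roots A).filter fun i => P.RootForm (P.root i) (P.root i) = c).card +
          ((NN.roots (rvac A)).filter fun i => P.RootForm (P.root i) (P.root i) = c).card =
          (b.support.filter fun i => P.RootForm (P.root i) (P.root i) = c).card) ∧
      (∀ i : ℕ, i ≤ X.coxeterNumber - 1 →
        rvac (rankLevel (PosRoot b Finset.univ) i) =
          rankLevel (PosRoot b Finset.univ) (X.coxeterNumber - 1 - i)) ∧
      (∀ (A : NN b Finset.univ) (α : b.support), (α : ι) ∈ NN.roots A →
        ∃ A' : NN b (Finset.univ.erase α), NN.roots A' = (NN.roots A).erase α ∧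
          NN.roots (rvac A) = NN.roots (rvac A')) ∧
      (∀ (A : NN b Finset.univ) (α : b.support),
        (∀ i ∈ NN.roots A, P.root i ∈ simpleCone b (Finset.univ.erase α)) →
        ∃ A' : NN b (Finset.univ.erase α), NN.roots A' = NN.roots A ∧
          NN.roots (rvac A) = insert (α : ι) (NN.roots (rvac A'))) := by
  refine ⟨fun J => ⟨PosRoot.isRanked, rvac_involutive PosRoot.isRanked⟩,
    fun J J' J'' hd hJ h A => roots_rvac_of_orthogonal hd hJ h A, fun X hX hT => ?_⟩
  obtain ⟨T⟩ := nonempty_facts_of_hasType hX hT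
  refine ⟨fun A => ?_, T.card_length_add, fun i hi => T.rvac_rankLevel hi,
    roots_rvac_of_simple_mem, roots_rvac_of_subset_erase⟩
  rw [T.card_add, Module.finrank_eq_card_basis b.toWeightBasis, Fintype.card_coe]
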